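/- Let $R$ be a ternary relation symbol whose primary key is its first position, and let $q_4 := \exists x\,y\,z\; R(\underline{x}\,y\,z)\wedge R(\underline{z}\,x\,y)$. A database $D$ is a finite set of facts $R(a,b,c)$; its blocks are the maximal sets of facts of $D$ with the same first entry; a repair of $D$ is a subset of $D$ containing exactly one fact of each block; and $q_4$ is certain for $D$ if every repair of $D$ satisfies $q_4$. Write $D\models q_4(uv)$ if $u=R(a,b,c)$ and $v=R(c,a,b)$ are facts of $D$ for some $a,b,c$. The problem $\mathrm{certain}(q_4)$ asks, given $D$ (as a list of facts, the constants being named by binary words), whether $q_4$ is certain for $D$. The saturating bipartite matching problem (SBM) asks, given a finite bipartite graph $(V_1\cup V_2,E)$ (by its adjacency matrix), whether there is an injective $f:V_1\to V_2$ with $(v,f(v))\in E$ for all $v\in V_1$. 1. $\mathrm{certain}(q_4)$ is decidable by a deterministic Turing machine in polynomial time. 2. There is a logspace reduction from $\mathrm{certain}(q_4)$ to SBM, making a single SBM query whose answer is negated: there is a function $D\mapsto G_D$ from databases to bipartite graphs, computable by a deterministic Turing machine with a read-only input tape, a write-only output tape and $O(\log n)$ cells of work tape on inputs of length $n$, such that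 $q_4$ is certain for $D$ if and only if $G_D$ has no $V_1$-saturating matching. 3. Let $D'$ be the set of facts $a\in D$ with $D\not\models q_4(aa)$, and let the solution graph of $D'$ be the graph on $D'$ in which distinct facts $a,b$ are adjacent if $D'\models q_4(ab)$ or $D'\models q_4(ba)$. Then $q_4$ is not certain for $D$ if and only if there is an injective map $f$ from the blocks of $D$ to the maximal cliques of the solution graph of $D'$ such that $B\cap f(B)\neq\emptyset$ for every block $B$ of $D$. -/

import Mathlib

namespace CQA

universe u v

/-! ### Databases, primary keys, repairs, Boolean conjunctive queries -/

/-- A relational signature (a type of relation symbols with arities), together with a primary key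
constraint for each symbol, namely the set of its key positions. -/
structure KeyedSignature where
  Rel : Type
  arity : Rel → ℕ
  key : (R : Rel) → Finset (Fin (arity R))

/-- A term `R(t₁, …, tₙ)` with entries in `A`. It is a fact if `A` is a set of constants and an atom
if `A` is a set of variables. -/
@[ext] structure Term (S : KeyedSignature) (A : Type u) where
  rel : S.Rel
  args : Fin (S.arity rel) → A

/-- Apply a map of the entries to a term. -/
def Term.map {S : KeyedSignature} {A : Type u} {B : Type v} (g : A → B) (t : Term S A) :
    Term S B where
  rel := t.rel
  args := g ∘ t.args

/-- A database with constants from `A`: a finite set of facts. -/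
abbrev Database (S : KeyedSignature) (A : Type u) := Finset (Term S A)

/-- A Boolean conjunctive query with variables from `V`: a list of atoms, all variables being
existentially quantified. -/
abbrev Query (S : KeyedSignature) (V : Type v) := List (Term S V)

/-- Two facts are key-equivalent if they have the same relation symbol and agree on the key
positions of that symbol. -/
def KeyEquiv {S : KeyedSignature} {A : Type u} (s t : Term S A) : Prop :=
  ∃ h : s.rel = t.rel, ∀ i ∈ S.key s.rel, s.args i = t.args (Fin.cast (congrArg S.arity h) i)

/-- The blocks of a database: its classes of key-equivalent facts. -/
def IsBlock {S : KeyedSignature} {A : Type u} (D : Database S A) (B : Set (Term S A)) : Prop :=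
  ∃ s ∈ D, B = {t | t ∈ D ∧ KeyEquiv s t}

/-- A repair of `D`: a subset of the facts of `D` that has exactly one element in each block. -/
def IsRepair {S : KeyedSignature} {A : Type u} (D r : Database S A) : Prop :=
  r ⊆ D ∧ ∀ B, IsBlock D B → ∃! t, t ∈ r ∧ t ∈ B

/-- `IsSolution q D us`: the sequence of facts `us` is a solution to `q` in `D`, that is, the image
of the sequence of atoms of `q` under an assignment of the variables, all of it lying in `D`. -/
def IsSolution {S : KeyedSignature} {A : Type u} {V : Type v} (q : Query S V) (D : Database S A)
    (us : List (Term S A)) : Prop :=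
  ∃ μ : V → A, us = q.map (Term.map μ) ∧ ∀ t ∈ us, t ∈ D

/-- `D ⊨ q`. -/
def Satisfies {S : KeyedSignature} {A : Type u} {V : Type v} (D : Database S A) (q : Query S V) :
    Prop :=
  ∃ us, IsSolution q D us

/-- `q` is certain for `D`: every repair of `D` satisfies `q`. -/
def Certain {S : KeyedSignature} {A : Type u} {V : Type v} (q : Query S V) (D : Database S A) :
    Prop :=
  ∀ r, IsRepair D r → Satisfies r q

/-! ### The query `R(x; y, z) ∧ R(z; x, y)` -/

/-- One ternary relation symbol `R`, whose key is its first position. -/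
def sigR : KeyedSignature where
  Rel := Unit
  arity _ := 3
  key _ := {0}

/-- The term `R(a, b, c)`. -/
def R {A : Type u} (a b c : A) : Term sigR A where
  rel := ()
  args := ![a, b, c]

/-- The query `∃ x y z, R(x, y, z) ∧ R(z, x, y)`; the variables `x, y, z` are `0, 1, 2`. -/
def q4 : Query sigR (Fin 3) := [R 0 1 2, R 2 0 1]

/-- The facts of `D` that do not form a solution `q4(a a)` with themselves. -/
noncomputable def loopFree {A : Type u} (D : Database sigR A) : Database sigR A :=
  open Classical in D.filter fun a => ¬ IsSolution q4 D [a, a]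

/-- The solution graph of `D`: its vertices are the facts of `D`, and two facts `a, b` are adjacent
if `q4(a b)` or `q4(b a)` holds in `D`. (Self-loops are not recorded: the graph is used only for
databases without them.) -/
def solutionGraph {A : Type u} (D : Database sigR A) : SimpleGraph {a // a ∈ D} where
  Adj a b := a ≠ b ∧ (IsSolution q4 D [a.1, b.1] ∨ IsSolution q4 D [b.1, a.1])
  symm := ⟨fun _ _ h => ⟨h.1.symm, h.2.symm⟩⟩
  loopless := ⟨fun _ h => h.1 rfl⟩

/-- An injective assignment, to the blocks of `D`, of maximal cliques of the solution graph of
`loopFree D`, such that each block shares a fact with the clique assigned to it. -/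
def BlocksMatchCliques {A : Type u} (D : Database sigR A) : Prop :=
  ∃ f : {B // IsBlock D B} → {C // Maximal (solutionGraph (loopFree D)).IsClique C},
    Function.Injective f ∧ ∀ B, ∃ a ∈ (f B).1, a.1 ∈ B.1

/-! ### Saturating bipartite matching -/

/-- A finite bipartite graph with sides `V₁ = {0, …, m - 1}` and `V₂ = {0, …, n - 1}`. -/
structure BipartiteGraph where
  m : ℕ
  n : ℕ
  adj : Fin m → Fin n → Bool

/-- There is an injective `f : V₁ → V₂` all of whose pairs `(v, f v)` are edges. -/
def BipartiteGraph.HasSaturatingMatching (G : BipartiteGraph) : Prop :=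
  ∃ f : Fin G.m → Fin G.n, Function.Injective f ∧ ∀ i, G.adj i (f i) = true

/-! ### Encodings of the inputs as words over `{0, 1, #}` -/

/-- A letter is a bit (`some b`) or the separator `#` (`none`). -/
abbrev Letter := Option Bool

/-- Constants are named by binary words. An input lists the facts of a database over `R`, in any
order, repetitions being allowed. -/
abbrev DatabaseInput := List (Term sigR (List Bool))

/-- The database whose facts are listed. -/
noncomputable def DatabaseInput.toDatabase (l : DatabaseInput) : Database sigR (List Bool) :=
  open Classical in l.toFinset

/-- A fact `R(a, b, c)` is written `a#b#c#`. -/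
def encodeFact (t : Term sigR (List Bool)) : List Letter :=
  (List.ofFn t.args).flatMap fun w => w.map some ++ [none]

/-- A database is written as the concatenation of its listed facts. -/
def encodeDatabase (l : DatabaseInput) : List Letter :=
  l.flatMap encodeFact

/-- A bipartite graph is written as `1ᵐ#1ⁿ#` followed by the rows of its adjacency matrix. -/
def encodeGraph (G : BipartiteGraph) : List Letter :=
  List.replicate G.m (some true) ++ [none] ++ List.replicate G.n (some true) ++ [none] ++
    (List.ofFn fun i => (List.ofFn (G.adj i)).map some).flatten

/-! ### Polynomial time -/

/-- The decision problem `P`, with inputs encoded by `e`, is decided by a Turing machine in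
polynomial time. -/
def InPTime {α Γ : Type} (e : α → List Γ) (P : α → Prop) : Prop :=
  open Classical in
  Nonempty (Turing.TM2ComputableInPolyTime e Computability.encodeBool fun a => decide (P a))

/-! ### Logarithmic space -/

/-- Head movements. -/
inductive Move
  | left
  | stay
  | right

/-- What the input head sees: one of the two endmarkers or an input letter. -/
inductive Scan (I : Type)
  | leftEnd
  | letter (a : I)
  | rightEnd

/-- A deterministic Turing machine with a two-way read-only input tape over `Γ₀`, finitely many
two-way read-write work tapes over a finite alphabet `Sym`, and a one-way write-only output tape
over `Γ₁`. Depending on the state and the scanned symbols the machine halts (`none`) or chooses a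
new state, a movement of the input head, for each work tape a symbol to write and a movement, and
possibly a letter to output. -/
structure Transducer (Γ₀ Γ₁ : Type) where
  State : Type
  [stateFin : Fintype State]
  Sym : Type
  [symFin : Fintype Sym]
  blank : Sym
  tapes : ℕ
  start : State
  trans : State → Scan Γ₀ → (Fin tapes → Sym) →
    Option (State × Move × (Fin tapes → Sym × Move) × Option Γ₁)

namespace Transducer

variable {Γ₀ Γ₁ : Type}

/-- A configuration. Work tapes are infinite to the right only; their cells are numbered from 0. The
input word of length `n` occupies the cells `1, …, n` of the input tape, the cells `0` and `n + 1`
holding the endmarkers. -/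
structure Cfg (M : Transducer Γ₀ Γ₁) where
  state : M.State
  inputHead : ℕ
  work : Fin M.tapes → ℕ → M.Sym
  head : Fin M.tapes → ℕ
  output : List Γ₁

/-- The initial configuration: blank work tapes, all heads on cell 0, nothing output. -/
def init (M : Transducer Γ₀ Γ₁) : M.Cfg where
  state := M.start
  inputHead := 0
  work _ _ := M.blank
  head _ := 0
  output := []

/-- The content of cell `p` of the input tape on input `w`. -/
def scan (w : List Γ₀) : ℕ → Scan Γ₀
  | 0 => .leftEnd
  | p + 1 => match w[p]? with
    | some a => .letter a
    | none => .rightEnd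

/-- Movement of a head; at cell 0 a movement to the left has no effect. -/
def moveHead : Move → ℕ → ℕ
  | .left, p => p - 1
  | .stay, p => p
  | .right, p => p + 1

/-- One step on input `w`; the result is `none` if the machine halts. The input head does not move
beyond the right endmarker. -/
def step (M : Transducer Γ₀ Γ₁) (w : List Γ₀) (c : M.Cfg) : Option M.Cfg :=
  (M.trans c.state (scan w c.inputHead) fun i => c.work i (c.head i)).map fun a =>
    { state := a.1
      inputHead := min (moveHead a.2.1 c.inputHead) (w.length + 1)
      work := fun i => Function.update (c.work i) (c.head i) (a.2.2.1 i).1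
      head := fun i => moveHead (a.2.2.1 i).2 (c.head i)
      output := c.output ++ a.2.2.2.toList }

/-- On input `w` the machine halts with output `y`. -/
def Outputs (M : Transducer Γ₀ Γ₁) (w : List Γ₀) (y : List Γ₁) : Prop :=
  ∃ c, StateTransition.Reaches (M.step w) M.init c ∧ M.step w c = none ∧ c.output = y

/-- On input `w` the machine uses at most the first `s` cells of each work tape. -/
def UsesSpace (M : Transducer Γ₀ Γ₁) (w : List Γ₀) (s : ℕ) : Prop :=
  ∀ c, StateTransition.Reaches (M.step w) M.init c → ∀ i, c.head i < s

end Transducer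

/-- `f`, with arguments encoded by `e₀` and values encoded by `e₁`, is computed by a Turing machine
that uses `O(log n)` cells of its work tapes on inputs of length `n`. -/
def LogspaceComputable {α β Γ₀ Γ₁ : Type} (e₀ : α → List Γ₀) (e₁ : β → List Γ₁) (f : α → β) :
    Prop :=
  ∃ (M : Transducer Γ₀ Γ₁) (k : ℕ), ∀ a, M.Outputs (e₀ a) (e₁ (f a)) ∧
    M.UsesSpace (e₀ a) (k * (Nat.log 2 (e₀ a).length + 1))

end CQA

/-! A solution of `q4` consists of a fact and its cyclic shift `rot`, and `rot` has order three.
Hence two different facts in one orbit of `rot` form a solution in at least one order, and a fact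
forms a solution with itself exactly if `rot` fixes it. So a repair falsifies `q4` if and only if
its facts are not fixed by `rot` and lie in pairwise different orbits. Such repairs amount to a
`GoodChoice` of one fact per block (`certain_iff`). On the facts not fixed by `rot`, adjacency in
the solution graph means lying in the same orbit. The graph is a disjoint union of cliques, and a
good choice is an injective assignment of maximal cliques to the blocks they meet
(`blocksMatchCliques_iff`).

For the complexity claims, a block or an orbit is represented by the position of the input word
where its first listed fact starts. The incidence `Edge` of blocks and orbits is then a first-order
property of positions, expressed with addition, letters, and the number of preceding separators
modulo three (`Fm.holds_edge`, `exists_matching_iff`). Evaluating this formula at all pairs of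
positions writes an adjacency matrix. Positions that represent no block receive private partners, so
that the size of the graph depends on the length of the word only (`hasSaturatingMatching_graphOf`).

Matching itself is decided by an auction. When no further offer is possible, either all bidders hold
objects, which is a matching, or an unassigned bidder starts an alternating chain too long for a
matching to exist (`Fair.unassigned_iff`). The state of the auction is a growing set of triples of
positions, so it fits on a tape whose cells are marked and never erased. The rule for new offers is
again first-order.

Both algorithms are written in one loop language whose only loop repeats its body as often as the
input has letters. Running time is therefore polynomial by construction (`Prog.flow_correct`), and
so are the values of all counters. Stack machines keep the counters in unary and run in polynomial
time (`inPTime_of_prog`). Transducers keep them in binary with `O(log n)` digits, and handle the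
programs that never inspect the tape (`logspaceComputable_of_prog`). -/

open Function

namespace CQA

/-! ### A loop language with polynomial running time -/

/-- Tests of the loop language: whether a counter vanishes, which letter is under the input head,
and whether the current tape cell is marked. -/
inductive Test
  | zero (r : ℕ)
  | letter (c : Option Letter)
  | cell

/-- Elementary actions of the loop language. -/
inductive Act
  | inc (r : ℕ)
  | dec (r : ℕ)
  | left
  | right
  | tapeLeft
  | tapeRight
  | mark
  | emit (c : Letter)

/-- Programs of the loop language; `rep p` repeats `p` as often as the input has letters. -/
inductive Prog
  | act (a : Act)
  | seq (p q : Prog)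
  | ite (t : Test) (p q : Prog)
  | rep (p : Prog)

/-- The memory of a program: counters, the position of the input head, a tape of bits with its head,
and the output. -/
structure Store where
  ctr : ℕ → ℕ
  pos : ℕ
  tape : ℕ → Bool
  head : ℕ
  out : List Letter

/-- The memory at the start of a computation. -/
def Store.zero : Store := ⟨fun _ => 0, 0, fun _ => false, 0, []⟩

def Test.eval (w : List Letter) (s : Store) : Test → Bool
  | zero r => s.ctr r == 0
  | letter c => w[s.pos]? == c
  | cell => s.tape s.head

def Act.run (w : List Letter) (s : Store) : Act → Store
  | inc r => { s with ctr := update s.ctr r (s.ctr r + 1) }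
  | dec r => { s with ctr := update s.ctr r (s.ctr r - 1) }
  | left => { s with pos := s.pos - 1 }
  | right => { s with pos := min (s.pos + 1) w.length }
  | tapeLeft => { s with head := s.head - 1 }
  | tapeRight => { s with head := s.head + 1 }
  | mark => { s with tape := update s.tape s.head true }
  | emit c => { s with out := s.out ++ [c] }

def Prog.run (w : List Letter) : Prog → Store → Store
  | act a, s => a.run w s
  | seq p q, s => q.run w (p.run w s)
  | ite t p q, s => if t.eval w s then p.run w s else q.run w s
  | rep p, s => (p.run w)^[w.length] s

/-! ### Flowcharts -/

/-- Instructions of a flowchart, with the addresses of their successors. -/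
inductive Instr
  | act (a : Act) (e : ℕ)
  | br (t : Test) (y n : ℕ)

def Instr.next (w : List Letter) (s : Store) : Instr → ℕ × Store
  | act a e => (e, a.run w s)
  | br t y n => (if t.eval w s then y else n, s)

/-- One step of a flowchart. -/
def flowStep (w : List Letter) (C : List Instr) (c : ℕ × Store) : Option (ℕ × Store) :=
  C[c.1]?.map (Instr.next w c.2)

/-- `StepsTo f n a b`: `n` steps of `f` lead from `a` to `b`. -/
inductive StepsTo {σ : Type*} (f : σ → Option σ) : ℕ → σ → σ → Prop
  | refl (a : σ) : StepsTo f 0 a a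
  | head {n : ℕ} {a b c : σ} : f a = some b → StepsTo f n b c → StepsTo f (n + 1) a c

theorem StepsTo.trans {σ : Type*} {f : σ → Option σ} {m n : ℕ} {a b c : σ}
    (h : StepsTo f m a b) (h' : StepsTo f n b c) : StepsTo f (m + n) a c := by
  induction h with
  | refl => simpa using h'
  | head e _ ih => rw [Nat.add_right_comm]; exact .head e (ih h')

/-- `b` can be reached from `a` in at most `n` steps of `f`. -/
def Within {σ : Type*} (f : σ → Option σ) (n : ℕ) (a b : σ) : Prop :=
  ∃ m ≤ n, StepsTo f m a b

section Within

variable {σ : Type*} {f : σ → Option σ} {m n : ℕ} {a b c : σ}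

theorem Within.refl (a : σ) : Within f 0 a a := ⟨0, le_rfl, .refl a⟩

theorem Within.trans (h : Within f m a b) (h' : Within f n b c) : Within f (m + n) a c := by
  obtain ⟨i, hi, hab⟩ := h
  obtain ⟨j, hj, hbc⟩ := h'
  exact ⟨i + j, by omega, hab.trans hbc⟩

theorem Within.head (h : f a = some b) (h' : Within f n b c) : Within f (n + 1) a c := by
  obtain ⟨j, hj, hbc⟩ := h'
  exact ⟨j + 1, by omega, .head h hbc⟩

theorem Within.single (h : f a = some b) : Within f 1 a b := .head h (.refl b)

theorem Within.mono (h : Within f m a b) (hn : m ≤ n) : Within f n a b := by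
  obtain ⟨i, hi, hab⟩ := h
  exact ⟨i, by omega, hab⟩

/-- Iterating: a chain of `n` pieces, each of at most `m` steps. -/
theorem Within.chain (x : ℕ → σ) (h : ∀ i < n, Within f m (x i) (x (i + 1))) :
    Within f (n * m) (x 0) (x n) := by
  induction n with
  | zero => simpa using Within.refl (x 0)
  | succ n ih =>
    rw [Nat.succ_mul]
    exact (ih fun i hi => h i (by omega)).trans (h n (by omega))

end Within

/-! ### Compilation of programs to flowcharts -/

namespace Prog

/-- Nesting depth of loops. -/
def height : Prog → ℕ
  | act _ => 0
  | seq p q => max p.height q.height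
  | ite _ p q => max p.height q.height
  | rep p => p.height + 1

end Prog

def Test.bound : Test → ℕ
  | zero r => r + 1
  | _ => 0

def Act.bound : Act → ℕ
  | inc r => r + 1
  | dec r => r + 1
  | _ => 0

namespace Prog

/-- All counters used by the program are below this bound. -/
def bound : Prog → ℕ
  | act a => a.bound
  | seq p q => max p.bound q.bound
  | ite t p q => max t.bound (max p.bound q.bound)
  | rep p => p.bound

/-- Number of instructions of the compiled program. -/
def size : Prog → ℕ
  | act _ => 1
  | seq p q => p.size + q.size
  | ite _ p q => 1 + p.size + q.size
  | rep p => 3 + p.size + 3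

/-- Compilation to a flowchart located at the addresses from `b` on, with exit to `e`. The counters
from `K` on drive the loops. -/
def code (K : ℕ) : Prog → ℕ → ℕ → List Instr
  | act a, _, e => [.act a e]
  | seq p q, b, e => p.code K b (b + p.size) ++ q.code K (b + p.size) e
  | ite t p q, b, e =>
    .br t (b + 1) (b + 1 + p.size) :: (p.code K (b + 1) e ++ q.code K (b + 1 + p.size) e)
  | rep p, b, e =>
    [.br (.zero (K + 2 * p.height)) (b + 3 + p.size) (b + 1),
      .act (.dec (K + 2 * p.height)) (b + 2), .act (.inc (K + 2 * p.height + 1)) (b + 3)] ++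
    (p.code K (b + 3) b ++
    [.br (.zero (K + 2 * p.height + 1)) e (b + 3 + p.size + 1),
      .act (.dec (K + 2 * p.height + 1)) (b + 3 + p.size + 2),
      .act (.inc (K + 2 * p.height)) (b + 3 + p.size)])

theorem length_code (K : ℕ) (p : Prog) (b e : ℕ) : (p.code K b e).length = p.size := by
  induction p generalizing b e with
  | act a => rfl
  | seq p q hp hq => simp [code, size, hp, hq]
  | ite t p q hp hq => simp [code, size, hp, hq]; omega
  | rep p hp => simp [code, size, hp]; omega

/-- A bound on the number of steps of the compiled program. -/
noncomputable def cost : Prog → Polynomial ℕ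
  | act _ => 1
  | seq p q => p.cost + q.cost
  | ite _ p q => 1 + p.cost + q.cost
  | rep p => .X * (p.cost + 3) + 1 + .X * 3 + 1

end Prog

/-- Replacing the counters from `K` on by those of `c`. -/
def Store.patch (K : ℕ) (s : Store) (c : ℕ → ℕ) : Store :=
  { s with ctr := fun r => if r < K then s.ctr r else c r }

theorem Test.eval_patch {w : List Letter} {K : ℕ} {t : Test} (h : t.bound ≤ K) (s : Store)
    (c : ℕ → ℕ) : t.eval w (s.patch K c) = t.eval w s := by
  cases t with
  | zero r => simp [Test.eval, Store.patch, show r < K from h]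
  | letter => rfl
  | cell => rfl

theorem Act.run_patch {w : List Letter} {K : ℕ} {a : Act} (h : a.bound ≤ K) (s : Store)
    (c : ℕ → ℕ) : a.run w (s.patch K c) = (a.run w s).patch K c := by
  cases a with
  | inc r =>
    have hr : r < K := h
    simp only [Act.run, Store.patch, hr, if_true]
    congr 1
    funext x
    by_cases hx : x = r
    · subst hx; simp [hr]
    · simp [hx]
  | dec r =>
    have hr : r < K := h
    simp only [Act.run, Store.patch, hr, if_true]
    congr 1
    funext x
    by_cases hx : x = r
    · subst hx; simp [hr]
    · simp [hx]
  | _ => rfl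

theorem Store.inc_patch (w : List Letter) (K r : ℕ) (h : K ≤ r) (s : Store) (c : ℕ → ℕ) :
    (Act.inc r).run w (s.patch K c) = s.patch K (update c r (c r + 1)) := by
  simp only [Act.run, Store.patch, not_lt.2 h, if_false]
  congr 1
  funext x
  by_cases hx : x = r
  · subst hx; simp [not_lt.2 h]
  · simp [hx]

theorem Store.dec_patch (w : List Letter) (K r : ℕ) (h : K ≤ r) (s : Store) (c : ℕ → ℕ) :
    (Act.dec r).run w (s.patch K c) = s.patch K (update c r (c r - 1)) := by
  simp only [Act.run, Store.patch, not_lt.2 h, if_false]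
  congr 1
  funext x
  by_cases hx : x = r
  · subst hx; simp [not_lt.2 h]
  · simp [hx]

theorem Store.zero_patch (w : List Letter) (K r : ℕ) (h : K ≤ r) (s : Store) (c : ℕ → ℕ) :
    (Test.zero r).eval w (s.patch K c) = (c r == 0) := by
  simp [Test.eval, Store.patch, not_lt.2 h]

/-- The list `l` of instructions is located at address `b` of `C`. -/
def LocatedAt (C : List Instr) (b : ℕ) (l : List Instr) : Prop := l <+: C.drop b

theorem LocatedAt.left {C l l' : List Instr} {b : ℕ} (h : LocatedAt C b (l ++ l')) :
    LocatedAt C b l := (List.prefix_append l l').trans h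

theorem LocatedAt.right {C l l' : List Instr} {b : ℕ} (h : LocatedAt C b (l ++ l')) :
    LocatedAt C (b + l.length) l' := by
  obtain ⟨m, hm⟩ := h
  refine ⟨m, ?_⟩
  rw [← List.drop_drop, ← hm, List.append_assoc, List.drop_left]

theorem LocatedAt.tail {C l : List Instr} {b : ℕ} {i : Instr} (h : LocatedAt C b (i :: l)) :
    LocatedAt C (b + 1) l := LocatedAt.right (l := [i]) h

theorem LocatedAt.get {C l : List Instr} {b : ℕ} {i : Instr} (h : LocatedAt C b (i :: l)) :
    C[b]? = some i := by
  obtain ⟨m, hm⟩ := h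
  have := congrArg (fun l => l[0]?) hm
  simpa using this.symm

theorem LocatedAt.step {C l : List Instr} {b : ℕ} {i : Instr} (h : LocatedAt C b (i :: l))
    (w : List Letter) (s : Store) : flowStep w C (b, s) = some (i.next w s) := by
  simp [flowStep, h.get]

/-- The counters driving the loops of a program of height at most `H` are ready for use. -/
def LoopsReady (n K H : ℕ) (c : ℕ → ℕ) : Prop :=
  ∀ h < H, c (K + 2 * h) = n ∧ c (K + 2 * h + 1) = 0

/-- Induction on the program. The loop counters from `K` on end with the values `c` they started
with, so consecutive pieces and successive passes of a loop can share them. A loop around a body of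
height `h` is driven by the pair number `h`, while the body uses only pairs of smaller number. -/
theorem Prog.code_correct {w : List Letter} {C : List Instr} {K : ℕ} {p : Prog} (hK : p.bound ≤ K)
    {b e : ℕ} (s : Store) {c : ℕ → ℕ} (hC : LocatedAt C b (p.code K b e))
    (hc : LoopsReady w.length K p.height c) :
    Within (flowStep w C) (p.cost.eval w.length) (b, s.patch K c) (e, (p.run w s).patch K c) := by
  induction p generalizing b e s c with
  | act a =>
    simp only [cost, Polynomial.eval_one]
    refine Within.single ?_
    rw [hC.step]
    simp only [Instr.next, Act.run_patch hK, run]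
  | seq p q hp hq =>
    simp only [bound, sup_le_iff] at hK
    simp only [cost, Polynomial.eval_add]
    have h1 := hp hK.1 s hC.left fun h hh => hc h (lt_of_lt_of_le hh (le_max_left _ _))
    have hR := hC.right
    rw [length_code] at hR
    exact h1.trans (hq hK.2 _ hR fun h hh => hc h (lt_of_lt_of_le hh (le_max_right _ _)))
  | ite t p q hp hq =>
    simp only [bound, sup_le_iff] at hK
    simp only [cost, Polynomial.eval_add, Polynomial.eval_one]
    have hR := hC.tail.right
    rw [length_code] at hR
    have h0 := hC.step w (s.patch K c)
    simp only [Instr.next, Test.eval_patch hK.1] at h0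
    cases ht : t.eval w s with
    | true =>
      simp only [ht, if_true] at h0
      simp only [run, ht, if_true]
      exact (Within.head h0 (hp hK.2.1 s hC.tail.left
        fun h hh => hc h (lt_of_lt_of_le hh (le_max_left _ _)))).mono (by omega)
    | false =>
      simp only [ht, Bool.false_eq_true, if_false] at h0
      simp only [run, ht, Bool.false_eq_true, if_false]
      exact (Within.head h0 (hq hK.2.2 s hR
        fun h hh => hc h (lt_of_lt_of_le hh (le_max_right _ _)))).mono (by omega)
  | rep p hp =>
    set n := w.length with hn
    set A := K + 2 * p.height with hA
    have hready := hc p.height (Nat.lt_succ_self _)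
    rw [← hA] at hready
    have e0 := hC.left
    have e1 := hC.right
    simp only [List.length_cons, List.length_nil, Nat.zero_add, Nat.reduceAdd] at e1
    have e2 := e1.right
    rw [length_code] at e2
    have hup : ∀ u v u' : ℕ, update (update (update c A u) (A + 1) v) A u' =
        update (update c A u') (A + 1) v := by
      intro u v u'
      rw [update_comm (by omega), update_idem, update_comm (by omega)]
    -- `x i` is the configuration after `i` passes through the body, when `i` units have been moved
    -- from counter `A` to counter `A + 1`. `y i` is the configuration after `i` units have been
    -- moved back.
    let x : ℕ → ℕ × Store := fun i =>
      (b, ((p.run w)^[i] s).patch K (update (update c A (n - i)) (A + 1) i))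
    let y : ℕ → ℕ × Store := fun i =>
      (b + 3 + p.size, ((p.run w)^[n] s).patch K (update (update c A i) (A + 1) (n - i)))
    have hx : ∀ i < n, Within (flowStep w C) (p.cost.eval n + 3) (x i) (x (i + 1)) := by
      intro i hi
      have s0 := e0.step w ((p.run w)^[i] s |>.patch K (update (update c A (n - i)) (A + 1) i))
      have s1 := e0.tail.step w
        ((p.run w)^[i] s |>.patch K (update (update c A (n - i)) (A + 1) i))
      have s2 := e0.tail.tail.step w
        ((p.run w)^[i] s |>.patch K (update (update c A (n - i - 1)) (A + 1) i))
      simp only [Instr.next, ← hA, Store.zero_patch w K A (by omega)] at s0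
      simp only [Instr.next, ← hA, Store.dec_patch w K A (by omega)] at s1
      simp only [Instr.next, ← hA, Store.inc_patch w K (A + 1) (by omega)] at s2
      rw [update_of_ne (by omega), update_self, if_neg (by simp; omega)] at s0
      rw [update_of_ne (by omega), update_self, hup] at s1
      rw [update_self, update_idem] at s2
      have := hp hK ((p.run w)^[i] s) (c := update (update c A (n - i - 1)) (A + 1) (i + 1)) e1.left
        (fun h hh => by
          rw [update_of_ne (by omega), update_of_ne (by omega), update_of_ne (by omega),
            update_of_ne (by omega)]
          exact hc h (Nat.lt_succ_of_lt hh))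
      rw [← iterate_succ_apply' (f := p.run w)] at this
      exact (Within.head s0 (Within.head s1 (Within.head s2 this))).mono (by omega)
    have hy : ∀ i < n, Within (flowStep w C) 3 (y i) (y (i + 1)) := by
      intro i hi
      have s0 := e2.step w ((p.run w)^[n] s |>.patch K (update (update c A i) (A + 1) (n - i)))
      have s1 := e2.tail.step w
        ((p.run w)^[n] s |>.patch K (update (update c A i) (A + 1) (n - i)))
      have s2 := e2.tail.tail.step w
        ((p.run w)^[n] s |>.patch K (update (update c A i) (A + 1) (n - i - 1)))
      simp only [Instr.next, ← hA, Store.zero_patch w K (A + 1) (by omega)] at s0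
      simp only [Instr.next, ← hA, Store.dec_patch w K (A + 1) (by omega)] at s1
      simp only [Instr.next, ← hA, Store.inc_patch w K A (by omega)] at s2
      rw [update_self, if_neg (by simp; omega)] at s0
      rw [update_self, update_idem] at s1
      rw [update_of_ne (by omega), update_self, hup] at s2
      exact Within.head s0 (Within.head s1 (Within.single s2))
    have sx := e0.step w ((p.run w)^[n] s |>.patch K (update (update c A (n - n)) (A + 1) n))
    simp only [Instr.next, ← hA, Store.zero_patch w K A (by omega)] at sx
    rw [update_of_ne (by omega), update_self, if_pos (by simp)] at sx
    have sy := e2.step w ((p.run w)^[n] s |>.patch K (update (update c A n) (A + 1) (n - n)))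
    simp only [Instr.next, ← hA, Store.zero_patch w K (A + 1) (by omega)] at sy
    rw [update_self, if_pos (by simp)] at sy
    have u0 : update (update c A (n - 0)) (A + 1) 0 = c := by
      rw [Nat.sub_zero, ← hready.1, update_eq_self, ← hready.2, update_eq_self]
    have u1 : update (update c A n) (A + 1) (n - n) = c := by
      rw [Nat.sub_self]; simpa using u0
    have hx' := Within.chain x hx
    have hy' := Within.chain y hy
    simp only [x, iterate_zero_apply, u0] at hx'
    simp only [y, Nat.sub_zero] at hy'
    rw [u1] at sy hy'
    rw [Nat.sub_self] at sx hx'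
    simp only [cost, Polynomial.eval_add, Polynomial.eval_mul, Polynomial.eval_X,
      Polynomial.eval_one, Polynomial.eval_ofNat, run]
    exact ((hx'.trans (.single sx)).trans hy').trans (.single sy)

/-- Instructions that set the loop counters to the length of the input, followed by the program. -/
def Prog.flow (p : Prog) : List Instr :=
  [.br (.letter none) (3 + p.height) 1, .act .right 2] ++
  ((List.range (p.height + 1)).map (fun i =>
    .act (.inc (p.bound + 2 * i)) (if i = p.height then 0 else 3 + i)) ++
  ([.br (.zero (p.bound + 2 * p.height)) (6 + p.height) (4 + p.height),
    .act (.dec (p.bound + 2 * p.height)) (5 + p.height), .act .left (3 + p.height)] ++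
  p.code p.bound (6 + p.height) (6 + p.height + p.size)))

theorem Prog.length_flow (p : Prog) : p.flow.length = 6 + p.height + p.size := by
  simp [flow, length_code]; omega

/-- A bound on the number of steps of the flowchart of a program. -/
noncomputable def Prog.time (p : Prog) : Polynomial ℕ :=
  .X * ((p.height + 3 : ℕ) : Polynomial ℕ) + 1 + .X * 3 + 1 + p.cost

/-- The prelude walks over the input and increases all loop counters at each letter. One extra
counter, number `p.height`, also receives the length; it brings the head back to the first letter.
-/
theorem Prog.flow_correct (w : List Letter) (p : Prog) :
    ∃ c, Within (flowStep w p.flow) (p.time.eval w.length) (0, Store.zero)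
      (p.flow.length, (p.run w Store.zero).patch p.bound c) := by
  set n := w.length with hn
  set H := p.height with hH
  set K := p.bound with hK
  -- `ind j` is the indicator function of the first `j` counters that are to receive the length of
  -- the input.
  let ind : ℕ → ℕ → ℕ := fun j r => if ∃ h < j, r = K + 2 * h then 1 else 0
  let st : ℕ → (ℕ → ℕ) → Store := fun i c => { Store.zero with ctr := c, pos := i }
  have e0 : LocatedAt p.flow 0 p.flow := List.prefix_refl _
  have e1 := e0.right
  have e2 := e1.right
  have e3 := e2.right
  simp only [List.length_cons, List.length_nil, List.length_map, List.length_range] at e1 e2 e3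
  rw [← hH, ← hK] at e2 e3
  have hinc : ∀ j < H + 1, p.flow[2 + j]? =
      some (.act (.inc (K + 2 * j)) (if j = H then 0 else 3 + j)) := by
    intro j hj
    obtain ⟨m, hm⟩ := e1.left
    have := congrArg (fun l => l[j]?) hm
    simp only [List.getElem?_drop, Nat.zero_add] at this
    rw [← this, List.getElem?_append_left (by simpa using hj)]
    simp [List.getElem?_map, List.getElem?_range hj, ← hH, ← hK]
  have hincs : ∀ i c, Within (flowStep w p.flow) (H + 1) (2, st i c)
      (0, st i (fun r => c r + ind (H + 1) r)) := by
    intro i c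
    -- The last of the `H + 1` increments jumps back to address `0`; this accounts for the case
    -- distinction.
    have := Within.chain (f := flowStep w p.flow) (m := 1) (n := H + 1)
      (fun j => (if j = H + 1 then 0 else 2 + j, st i (fun r => c r + ind j r))) (by
        intro j hj
        apply Within.single
        simp only [flowStep, if_neg (show j ≠ H + 1 by omega), hinc j hj, Option.map_some,
          Instr.next, Act.run, st]
        congr 2
        · split_ifs <;> omega
        · congr 1
          funext r
          by_cases hr : r = K + 2 * j
          · subst hr
            have h1 : ind j (K + 2 * j) = 0 := if_neg (by rintro ⟨h, hh, e⟩; omega)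
            have h2 : ind (j + 1) (K + 2 * j) = 1 := if_pos ⟨j, by omega, rfl⟩
            simp [h1, h2]
          · rw [update_of_ne hr]
            have : ind (j + 1) r = ind j r := by
              simp only [ind]
              congr 1
              apply propext
              constructor
              · rintro ⟨h, hh, e⟩
                exact ⟨h, by rcases Nat.lt_succ_iff_lt_or_eq.1 hh with h' | rfl <;> tauto, e⟩
              · rintro ⟨h, hh, e⟩
                exact ⟨h, by omega, e⟩
            rw [this])
    have h0 : ∀ r, ind 0 r = 0 := fun r => if_neg (by rintro ⟨h, hh, e⟩; omega)
    simpa [h0] using this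
  have hfwd := Within.chain (f := flowStep w p.flow) (m := H + 3) (n := n)
    (fun i => (0, st i (fun r => i * ind (H + 1) r))) (by
      intro i hi
      have s0 := e0.left.step w (st i (fun r => i * ind (H + 1) r))
      have s1 := e0.left.tail.step w (st i (fun r => i * ind (H + 1) r))
      have hi' : w[i]? ≠ none := by simp; omega
      simp only [Instr.next, Test.eval, st, beq_eq_false_iff_ne.2 hi', Bool.false_eq_true,
        if_false, Act.run, ← hn, show min (i + 1) n = i + 1 by omega] at s0 s1
      have s2 := hincs (i + 1) (fun r => i * ind (H + 1) r)
      simp only [← Nat.succ_mul] at s2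
      exact Within.head s0 (Within.head s1 s2))
  have hmid : flowStep w p.flow (0, st n (fun r => n * ind (H + 1) r)) =
      some (3 + H, st n (fun r => n * ind (H + 1) r)) := by
    rw [e0.left.step]
    simp [Instr.next, Test.eval, st, hn, hH]
  have hbwd := Within.chain (f := flowStep w p.flow) (m := 3) (n := n)
    (fun i => (3 + H, st (n - i) (update (fun r => n * ind (H + 1) r) (K + 2 * H) (n - i)))) (by
      intro i hi
      have s0 := e2.left.step w
        (st (n - i) (update (fun r => n * ind (H + 1) r) (K + 2 * H) (n - i)))
      have s1 := e2.left.tail.step w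
        (st (n - i) (update (fun r => n * ind (H + 1) r) (K + 2 * H) (n - i)))
      have s2 := e2.left.tail.tail.step w
        (st (n - i) (update (fun r => n * ind (H + 1) r) (K + 2 * H) (n - i - 1)))
      simp only [Instr.next, Test.eval, st, Act.run, update_self, update_idem] at s0 s1 s2
      rw [if_neg (by simp; omega)] at s0
      have a1 : 0 + 2 + (H + 1) = 3 + H := by omega
      have a2 : 0 + 2 + (H + 1) + 1 = 4 + H := by omega
      have a3 : 0 + 2 + (H + 1) + 1 + 1 = 5 + H := by omega
      rw [a1] at s0
      rw [a2] at s1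
      rw [a3] at s2
      exact Within.head s0 (Within.head s1 (Within.single s2)))
  -- The extra counter is spent on the way back. It drives no loop of `p`, since the pairs in use
  -- have numbers below `H`.
  set c := update (fun r => n * ind (H + 1) r) (K + 2 * H) 0 with hc
  have hlast : flowStep w p.flow (3 + H, st (n - n) c) = some (6 + H, st 0 c) := by
    have a1 : 0 + 2 + (H + 1) = 3 + H := by omega
    have := e2.left.step w (st (n - n) c)
    rw [a1] at this
    rw [this]
    simp [Instr.next, Test.eval, st, hc]
  have hind : ∀ h < H + 1, ind (H + 1) (K + 2 * h) = 1 := fun h hh => if_pos ⟨h, hh, rfl⟩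
  have hpatch : st 0 c = Store.zero.patch K c := by
    simp only [st, Store.patch, Store.zero]
    congr 1
    funext r
    split_ifs with hr
    · rw [hc, update_of_ne (by omega)]
      have : ind (H + 1) r = 0 := if_neg (by rintro ⟨h, hh, e⟩; omega)
      rw [this, Nat.mul_zero]
    · rfl
  have a4 : 0 + 2 + (H + 1) + (0 + 1 + 1 + 1) = 6 + H := by omega
  rw [a4] at e3
  have hmain := p.code_correct (w := w) le_rfl Store.zero (c := c) (by simpa using e3) (by
    intro h hh
    constructor
    · rw [hc, update_of_ne (by omega), hind h (by omega), Nat.mul_one]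
    · rw [hc, update_of_ne (by omega)]
      have : ind (H + 1) (K + 2 * h + 1) = 0 := if_neg (by rintro ⟨h', hh, e⟩; omega)
      rw [this, Nat.mul_zero])
  refine ⟨c, ?_⟩
  have z0 : st 0 (fun r => 0 * ind (H + 1) r) = Store.zero := by simp [st, Store.zero]
  have z1 : update (fun r => n * ind (H + 1) r) (K + 2 * H) n =
      fun r => n * ind (H + 1) r := by
    rw [update_eq_self_iff, hind H (by omega)]; simp
  simp only [z0] at hfwd
  simp only [Nat.sub_zero, z1] at hbwd
  rw [Nat.sub_self, ← hc] at hbwd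
  rw [Nat.sub_self] at hlast
  rw [hpatch] at hbwd hlast
  rw [length_flow]
  simp only [time, Polynomial.eval_add, Polynomial.eval_mul, Polynomial.eval_X,
    Polynomial.eval_one, Polynomial.eval_ofNat, Polynomial.eval_natCast]
  exact (((hfwd.trans (.single hmid)).trans hbwd).trans (.single hlast)).trans hmain

/-! ### Simulation of flowcharts by stack machines -/

def Instr.bound : Instr → ℕ
  | .act a _ => a.bound
  | .br t _ _ => t.bound

/-- The stacks of the simulating machine: the unread and the read part of the input, the two halves
of the tape, the counters, and the output. -/
inductive Stack (K : ℕ)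
  | input
  | seen
  | tapeL
  | tapeR
  | ctr (i : Fin K)
  | out
  deriving DecidableEq, Fintype

namespace Stack

variable {K : ℕ}

abbrev Sym : Stack K → Type
  | input => Letter
  | seen => Letter
  | tapeL => Bool
  | tapeR => Bool
  | ctr _ => Unit
  | out => Bool

/-- The address `pc` as a label; `none` is the exit. -/
def label (C : List Instr) (pc : ℕ) : Option (Fin C.length) :=
  if h : pc < C.length then some ⟨pc, h⟩ else none

theorem label_eq_some {C : List Instr} {pc : ℕ} {i : Instr} (h : C[pc]? = some i) :
    ∃ a, label C pc = some a ∧ C.get a = i := by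
  obtain ⟨h1, h2⟩ := List.getElem?_eq_some_iff.1 h
  exact ⟨⟨pc, h1⟩, dif_pos h1, h2⟩

/-- Labels of the machine: `none` is the final clean-up. -/
abbrev Label (C : List Instr) := Option (Option (Fin C.length))

/-- Internal states: the symbol seen last. -/
abbrev Reg := Option Letter

abbrev Statement (K : ℕ) (C : List Instr) := Turing.TM2.Stmt (Sym (K := K)) (Label C) Reg

open Turing.TM2.Stmt

/-- Performing an action. -/
def actStmt (K : ℕ) (C : List Instr) (q : Statement K C) : Act → Statement K C
  | .inc r => if h : r < K then push (ctr ⟨r, h⟩) (fun _ => ()) q else q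
  | .dec r => if h : r < K then pop (ctr ⟨r, h⟩) (fun v _ => v) q else q
  | .left => pop seen (fun _ o => o) (branch Option.isSome (push input (fun v => v.getD none) q) q)
  | .right => pop input (fun _ o => o) (branch Option.isSome (push seen (fun v => v.getD none) q) q)
  | .tapeLeft => pop tapeL (fun _ o => o.map some)
      (branch Option.isSome (push tapeR (fun v => v == some (some true)) q) q)
  | .tapeRight => pop tapeR (fun _ o => o.map some) (push tapeL (fun v => v == some (some true)) q)
  | .mark => pop tapeR (fun v _ => v) (push tapeR (fun _ => true) q)
  | .emit _ => q

/-- Branching according to a test. -/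
def testStmt (K : ℕ) (C : List Instr) (y n : Statement K C) : Test → Statement K C
  | .zero r => if h : r < K then
      peek (ctr ⟨r, h⟩) (fun _ o => o.map fun _ => none) (branch Option.isNone y n) else n
  | .letter c => peek input (fun _ o => o) (branch (fun v => v == c) y n)
  | .cell => peek tapeR (fun _ o => o.map some) (branch (fun v => v == some (some true)) y n)

def jump {K : ℕ} {C : List Instr} (pc : ℕ) : Statement K C := goto fun _ => some (label C pc)

def instrStmt (K : ℕ) (C : List Instr) : Instr → Statement K C
  | .act a e => actStmt K C (jump e) a
  | .br t y n => testStmt K C (jump y) (jump n) t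

/-- Pop all stacks in a list, and stop if all of them were empty. -/
def cleanStmt (K : ℕ) (C : List Instr) : List (Stack K) → Statement K C
  | [] => branch Option.isSome (load (fun _ => none) (goto fun _ => none))
      (load (fun _ => none) halt)
  | k :: l => pop k (fun v o => if o.isSome then some none else v) (cleanStmt K C l)

/-- Output whether the counter `F` is nonzero. -/
def answerStmt (K : ℕ) (C : List Instr) (F : Fin K) : Statement K C :=
  peek (ctr F) (fun _ o => o.map fun _ => none)
    (push out Option.isSome (load (fun _ => none) (goto fun _ => none)))

noncomputable def program (K : ℕ) (C : List Instr) (F : Fin K) : Label C → Statement K C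
  | none => cleanStmt K C (Finset.univ.erase out).toList
  | some none => answerStmt K C F
  | some (some a) => instrStmt K C (C.get a)

/-- The stack machine simulating a flowchart. -/
noncomputable def machine (K : ℕ) (C : List Instr) (F : Fin K) : Turing.FinTM2 where
  K := Stack K
  k₀ := input
  k₁ := out
  Γ := Sym
  Λ := Label C
  main := some (label C 0)
  σ := Reg
  initialState := none
  Γk₀Fin := inferInstanceAs (Fintype Letter)
  m := program K C F

/-- The stacks represent the store `s`. -/
structure Represents (w : List Letter) (s : Store) (S : ∀ k : Stack K, List k.Sym) : Prop where
  pos : s.pos ≤ w.length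
  input : S input = w.drop s.pos
  seen : S seen = (w.take s.pos).reverse
  tapeL : S tapeL = ((List.range s.head).map s.tape).reverse
  tapeR : ∀ i, (S tapeR)[i]?.getD false = s.tape (s.head + i)
  ctr : ∀ r : Fin K, S (ctr r) = List.replicate (s.ctr r) ()
  out : S out = []

/-- A symbol missing from `tapeR` stands for an unmarked cell, so moving right on an empty stack
pushes `false` onto `tapeL`. Output is not simulated: the stack machine is used for decision
problems only, and `out` has to stay empty until the answer is given. -/
theorem stepAux_act {w : List Letter} {C : List Instr} {s : Store}
    {S : ∀ k : Stack K, List k.Sym} (hS : Represents w s S) {a : Act} (ha : a.bound ≤ K)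
    (q : Statement K C) (v : Reg) (m : ℕ) (hm : ∀ k, (S k).length ≤ m) :
    ∃ v' S', Turing.TM2.stepAux (actStmt K C q a) v S = Turing.TM2.stepAux q v' S' ∧
      Represents w (a.run w s) S' ∧ ∀ k, (S' k).length ≤ m + 1 := by
  have hm' : ∀ k, (S k).length ≤ m + 1 := fun k => (hm k).trans (Nat.le_succ m)
  have key : ∀ (k : Stack K) (x : List k.Sym), x.length ≤ m + 1 →
      ∀ S' : ∀ k : Stack K, List k.Sym, (∀ k, (S' k).length ≤ m + 1) →
      ∀ k', (update S' k x k').length ≤ m + 1 := by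
    intro k x hx S' hS' k'
    by_cases h : k' = k
    · subst h; simpa using hx
    · rw [update_of_ne h]; exact hS' k'
  have tl : ∀ k, (S k).tail.length ≤ m + 1 := fun k => by
    rw [List.length_tail]; exact (Nat.sub_le _ _).trans (hm' k)
  cases a with
  | inc r =>
    have hr : r < K := ha
    refine ⟨v, _, by simp only [actStmt, dif_pos hr]; rfl, ?_,
      key _ _ (by simpa using hm _) _ hm'⟩
    constructor <;> try simp [Act.run, hS.pos, hS.input, hS.seen, hS.tapeL, hS.tapeR, hS.out]
    intro r'
    by_cases h : r' = ⟨r, hr⟩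
    · subst h; simp [hS.ctr, List.replicate_succ]
    · rw [update_of_ne (by simpa using h), hS.ctr, update_of_ne (by simpa [Fin.ext_iff] using h)]
  | dec r =>
    have hr : r < K := ha
    refine ⟨v, _, by simp only [actStmt, dif_pos hr]; rfl, ?_, key _ _ (tl _) _ hm'⟩
    constructor <;> try simp [Act.run, hS.pos, hS.input, hS.seen, hS.tapeL, hS.tapeR, hS.out]
    intro r'
    by_cases h : r' = ⟨r, hr⟩
    · subst h; simp [hS.ctr]
    · rw [update_of_ne (by simpa using h), hS.ctr, update_of_ne (by simpa [Fin.ext_iff] using h)]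
  | left =>
    rcases hp : s.pos with _ | p
    · have h0 : S Stack.seen = [] := by rw [hS.seen, hp]; rfl
      have e : update S Stack.seen (S Stack.seen).tail = S := by
        rw [h0, List.tail_nil, ← h0, update_eq_self]
      refine ⟨none, S, ?_, ?_, hm'⟩
      · simp only [actStmt, Turing.TM2.stepAux]; rw [e, h0]; rfl
      · have : Act.left.run w s = s := by simp [Act.run, hp]; rw [← hp]
        rwa [this]
    · have hlt : p < w.length := by have := hS.pos; omega
      have hs : S Stack.seen = w[p] :: (w.take p).reverse := by
        rw [hS.seen, hp, List.take_succ_eq_append_getElem hlt]; simp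
      refine ⟨some w[p], update (update S Stack.seen (w.take p).reverse) Stack.input
        (w[p] :: S Stack.input), ?_, ?_, key _ _ (by simpa using hm _) _ (key _ _ ?_ _ hm')⟩
      · simp only [actStmt, Turing.TM2.stepAux, hs]; rfl
      · constructor <;> simp [Act.run, hp, hlt.le, hS.tapeL, hS.tapeR, hS.out, hS.ctr, hS.input]
      · have := tl Stack.seen; rw [hs] at this; exact this
  | right =>
    by_cases hlt : s.pos < w.length
    · have hs : S Stack.input = w[s.pos] :: w.drop (s.pos + 1) := by
        rw [hS.input, List.drop_eq_getElem_cons hlt]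
      refine ⟨some w[s.pos], update (update S Stack.input (w.drop (s.pos + 1))) Stack.seen
        (w[s.pos] :: S Stack.seen), ?_, ?_, key _ _ (by simpa using hm _) _ (key _ _ ?_ _ hm')⟩
      · simp only [actStmt, Turing.TM2.stepAux, hs]; rfl
      · have hmin : min (s.pos + 1) w.length = s.pos + 1 := by omega
        have hrun : Act.right.run w s = { s with pos := s.pos + 1 } := by rw [Act.run, hmin]
        rw [hrun]
        constructor
        · exact hlt
        · simp
        · rw [update_self, hS.seen]
          dsimp only
          rw [List.take_succ_eq_append_getElem hlt, List.reverse_append]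
          rfl
        · simp [hS.tapeL]
        · simp [hS.tapeR]
        · simp [hS.ctr]
        · simp [hS.out]
      · have := tl Stack.input; rw [hs] at this; exact this
    · have hp : s.pos = w.length := by have := hS.pos; omega
      have h0 : S Stack.input = [] := by rw [hS.input, hp]; simp
      have e : update S Stack.input (S Stack.input).tail = S := by
        rw [h0, List.tail_nil, ← h0, update_eq_self]
      refine ⟨none, S, ?_, ?_, hm'⟩
      · simp only [actStmt, Turing.TM2.stepAux]; rw [e, h0]; rfl
      · have : Act.right.run w s = s := by simp [Act.run, hp]; rw [← hp]
        rwa [this]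
  | tapeLeft =>
    rcases hp : s.head with _ | p
    · have h0 : S Stack.tapeL = [] := by rw [hS.tapeL, hp]; rfl
      have e : update S Stack.tapeL (S Stack.tapeL).tail = S := by
        rw [h0, List.tail_nil, ← h0, update_eq_self]
      refine ⟨none, S, ?_, ?_, hm'⟩
      · simp only [actStmt, Turing.TM2.stepAux]; rw [e, h0]; rfl
      · have : Act.tapeLeft.run w s = s := by simp [Act.run, hp]; rw [← hp]
        rwa [this]
    · have hs : S Stack.tapeL = s.tape p :: ((List.range p).map s.tape).reverse := by
        rw [hS.tapeL, hp, List.range_succ]; simp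
      refine ⟨some (some (s.tape p)), update (update S Stack.tapeL
        ((List.range p).map s.tape).reverse) Stack.tapeR (s.tape p :: S Stack.tapeR), ?_, ?_,
        key _ _ (by simpa using hm _) _ (key _ _ ?_ _ hm')⟩
      · simp only [actStmt, Turing.TM2.stepAux, hs]; cases s.tape p <;> rfl
      · constructor <;> simp [Act.run, hp, hS.pos, hS.seen, hS.out, hS.ctr, hS.input]
        intro i
        cases i with
        | zero => simp
        | succ i => have := hS.tapeR i; rw [hp] at this; simp [this]; congr 1; omega
      · have := tl Stack.tapeL; rw [hs] at this; exact this
  | tapeRight =>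
    refine ⟨(S Stack.tapeR).head?.map some, update (update S Stack.tapeR (S Stack.tapeR).tail)
      Stack.tapeL (s.tape s.head :: S Stack.tapeL), ?_, ?_,
        key _ _ (by simpa using hm _) _ (key _ _ (tl _) _ hm')⟩
    · simp only [actStmt, Turing.TM2.stepAux]
      have := hS.tapeR 0
      congr 2
      rw [update_of_ne (by simp)]
      congr 1
      rw [Nat.add_zero] at this
      rw [← this]
      rcases S Stack.tapeR with _ | ⟨b, l⟩
      · rfl
      · cases b <;> rfl
    · constructor <;> simp [Act.run, hS.pos, hS.seen, hS.out, hS.ctr, hS.input, hS.tapeL,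
        List.range_succ]
      intro i
      have := hS.tapeR (i + 1)
      simp only [this, Nat.add_assoc, Nat.add_comm 1 i]
  | mark =>
    refine ⟨v, update S Stack.tapeR (true :: (S Stack.tapeR).tail), ?_, ?_, key _ _ ?_ _ hm'⟩
    · simp [actStmt, Turing.TM2.stepAux]
    · constructor <;> simp [Act.run, hS.pos, hS.seen, hS.out, hS.ctr, hS.input, hS.tapeL]
      · intro a ha
        rw [update_of_ne (by omega)]
      · intro i
        cases i with
        | zero => simp
        | succ i =>
          rw [update_of_ne (by omega), ← hS.tapeR]; simp
    · simp only [List.length_cons, List.length_tail]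
      have := hm Stack.tapeR
      omega
  | emit c =>
    exact ⟨v, S, rfl, ⟨hS.pos, hS.input, hS.seen, hS.tapeL, hS.tapeR, hS.ctr, hS.out⟩, hm'⟩

theorem stepAux_branch {C : List Instr} {f : Reg → Bool} {b : Bool} (y n : Statement K C) (v : Reg)
    (S : ∀ k : Stack K, List k.Sym) (h : f v = b) :
    Turing.TM2.stepAux (branch f y n) v S = Turing.TM2.stepAux (if b then y else n) v S := by
  subst h
  rw [Turing.TM2.stepAux]
  cases f v <;> rfl

theorem stepAux_test {w : List Letter} {C : List Instr} {s : Store}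
    {S : ∀ k : Stack K, List k.Sym} (hS : Represents w s S) {t : Test} (ht : t.bound ≤ K)
    (y n : Statement K C) (v : Reg) :
    ∃ v', Turing.TM2.stepAux (testStmt K C y n t) v S =
      Turing.TM2.stepAux (if t.eval w s then y else n) v' S := by
  cases t with
  | zero r =>
    have hr : r < K := ht
    simp only [testStmt, dif_pos hr]
    refine ⟨(S (ctr ⟨r, hr⟩)).head?.map fun _ => none, stepAux_branch _ _ _ _ ?_⟩
    rw [hS.ctr]
    cases h : s.ctr r <;> simp [Test.eval, h]
  | letter c =>
    rw [testStmt, Turing.TM2.stepAux]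
    refine ⟨(S input).head?, stepAux_branch _ _ _ _ ?_⟩
    rw [hS.input, List.head?_drop]
    rfl
  | cell =>
    rw [testStmt, Turing.TM2.stepAux]
    refine ⟨(S tapeR).head?.map some, stepAux_branch _ _ _ _ ?_⟩
    have h := hS.tapeR 0
    rw [Nat.add_zero] at h
    simp only [Test.eval, ← h]
    rcases S Stack.tapeR with _ | ⟨b, l⟩
    · rfl
    · cases b <;> rfl

/-- One step of the flowchart is one step of the machine. The growth of the stacks is recorded
because it bounds the duration of the final clean-up. -/
theorem step_simulates {w : List Letter} {C : List Instr} (F : Fin K)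
    (hC : ∀ i ∈ C, i.bound ≤ K) {c d : ℕ × Store} (h : flowStep w C c = some d)
    {S : ∀ k : Stack K, List k.Sym} (hS : Represents w c.2 S) (v : Reg) (m : ℕ)
    (hm : ∀ k, (S k).length ≤ m) :
    ∃ v' S', Turing.TM2.step (program K C F) ⟨some (some (label C c.1)), v, S⟩ =
      some ⟨some (some (label C d.1)), v', S'⟩ ∧
      Represents w d.2 S' ∧ ∀ k, (S' k).length ≤ m + 1 := by
  obtain ⟨i, hi, rfl⟩ := Option.map_eq_some_iff.1 h
  obtain ⟨a, ha, hai⟩ := label_eq_some hi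
  have hb := hC i (List.mem_of_getElem? hi)
  rw [ha]
  simp only [Turing.TM2.step, program, hai]
  cases i with
  | act x e =>
    obtain ⟨v', S', h1, h2, h3⟩ := stepAux_act (C := C) hS (a := x) hb (jump e) v m hm
    exact ⟨v', S', by simp only [instrStmt, h1]; rfl, h2, h3⟩
  | br t y n =>
    obtain ⟨v', h1⟩ := stepAux_test (C := C) hS (t := t) hb (jump y) (jump n) v
    refine ⟨v', S, ?_, hS, fun k => (hm k).trans (Nat.le_succ m)⟩
    simp only [instrStmt, h1, Instr.next]
    split_ifs <;> rfl

theorem steps_simulate {w : List Letter} {C : List Instr} (F : Fin K)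
    (hC : ∀ i ∈ C, i.bound ≤ K) {t : ℕ} {c d : ℕ × Store} (h : StepsTo (flowStep w C) t c d)
    {S : ∀ k : Stack K, List k.Sym} (hS : Represents w c.2 S) (v : Reg) (m : ℕ)
    (hm : ∀ k, (S k).length ≤ m) :
    ∃ v' S', StepsTo (Turing.TM2.step (program K C F)) t ⟨some (some (label C c.1)), v, S⟩
      ⟨some (some (label C d.1)), v', S'⟩ ∧
      Represents w d.2 S' ∧ ∀ k, (S' k).length ≤ m + t := by
  induction h generalizing S v m with
  | refl a => exact ⟨v, S, .refl _, hS, hm⟩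
  | head e _ ih =>
    obtain ⟨v1, S1, h1, h2, h3⟩ := step_simulates F hC e hS v m hm
    obtain ⟨v2, S2, h4, h5, h6⟩ := ih h2 v1 (m + 1) h3
    exact ⟨v2, S2, .head h1 h4, h5, fun k => (h6 k).trans (by omega)⟩

/-- Once a popped stack was nonempty the register is no longer `none`, so after the pass it tells
whether another pass is required. -/
theorem stepAux_clean (C : List Instr) (l : List (Stack K)) (hl : l.Nodup) (v : Reg)
    (S : ∀ k : Stack K, List k.Sym) :
    ∃ v', Turing.TM2.stepAux (cleanStmt K C l) v S =
      Turing.TM2.stepAux (cleanStmt K C []) v' (fun k => if k ∈ l then (S k).tail else S k) ∧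
      (v' = none ↔ v = none ∧ ∀ k ∈ l, S k = []) := by
  induction l generalizing v S with
  | nil => exact ⟨v, by simp⟩
  | cons k l ih =>
    obtain ⟨hk, hl⟩ := List.nodup_cons.1 hl
    obtain ⟨v', h1, h2⟩ := ih hl (if (S k).head?.isSome then some none else v)
      (update S k (S k).tail)
    refine ⟨v', ?_, ?_⟩
    · conv_lhs => rw [cleanStmt, Turing.TM2.stepAux]
      rw [h1]
      congr 1
      funext k'
      by_cases hk' : k' = k
      · subst hk'; simp [hk]
      · simp [hk']
    · rw [h2]
      have : ∀ k' ∈ l, update S k (S k).tail k' = S k' := fun k' hk' =>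
        update_of_ne (by rintro rfl; exact hk hk') _ _
      rw [List.forall_mem_cons]
      rcases hSk : S k with _ | ⟨x, xs⟩
      · rw [hSk] at this
        simp only [List.head?_nil, Option.isSome_none, Bool.false_eq_true, if_false, true_and]
        exact and_congr Iff.rfl (forall₂_congr fun k' hk' => by rw [this k' hk'])
      · simp

/-- The clean-up empties all stacks but the output. -/
theorem clean_correct (C : List Instr) (F : Fin K) (m : ℕ) (S : ∀ k : Stack K, List k.Sym)
    (hm : ∀ k, k ≠ out → (S k).length ≤ m) :
    Within (Turing.TM2.step (program K C F)) (m + 1) ⟨some none, none, S⟩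
      ⟨none, none, fun k => if k = out then S k else []⟩ := by
  have hl : ((Finset.univ : Finset (Stack K)).erase out).toList.Nodup := Finset.nodup_toList _
  have hmem : ∀ k : Stack K, k ∈ ((Finset.univ : Finset (Stack K)).erase out).toList ↔ k ≠ out := by
    simp
  induction m generalizing S with
  | zero =>
    obtain ⟨v', h1, h2⟩ := stepAux_clean C _ hl none S
    have hS : ∀ k, k ≠ out → S k = [] := fun k hk => List.length_eq_zero_iff.1 (by simpa using hm k hk)
    rw [h2.2 ⟨rfl, fun k hk => hS k ((hmem k).1 hk)⟩] at h1
    apply Within.single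
    simp only [Turing.TM2.step, program, h1]
    simp only [cleanStmt, Turing.TM2.stepAux, Option.isSome_none, cond_false]
    congr 2
    funext k
    by_cases hk : k = out
    · simp [hk]
    · simp [hk, hS k hk]
  | succ m ih =>
    obtain ⟨v', h1, h2⟩ := stepAux_clean C _ hl none S
    rcases v' with _ | v'
    · have hS : ∀ k, k ≠ out → S k = [] := fun k hk => (h2.1 rfl).2 k ((hmem k).2 hk)
      refine (Within.single ?_).mono (Nat.le_add_left _ _)
      simp only [Turing.TM2.step, program, h1]
      simp only [cleanStmt, Turing.TM2.stepAux, Option.isSome_none, cond_false]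
      congr 2
      funext k
      by_cases hk : k = out
      · simp [hk]
      · simp [hk, hS k hk]
    · have := ih (fun k => if k ∈ ((Finset.univ : Finset (Stack K)).erase out).toList
        then (S k).tail else S k) (by
          intro k hk
          rw [if_pos ((hmem k).2 hk), List.length_tail]
          have := hm k hk
          omega)
      refine Within.head ?_ ?_ (b := ⟨some none, none, fun k => if k ∈ ((Finset.univ :
        Finset (Stack K)).erase out).toList then (S k).tail else S k⟩)
      · simp only [Turing.TM2.step, program, h1]
        simp only [cleanStmt, Turing.TM2.stepAux, Option.isSome_some, cond_true]
      · convert this using 3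
        rename_i k
        by_cases hk : k = out
        · simp [hk]
        · simp [hk]

/-- Conversion to the form in which the definition of polynomial time counts steps. -/
theorem iterate_bind_of_stepsTo {σ : Type*} {f : σ → Option σ} {n : ℕ} {a b : σ}
    (h : StepsTo f n a b) : (flip bind f)^[n] (some a) = some b := by
  induction h with
  | refl a => rfl
  | head e _ ih =>
    rw [iterate_succ_apply, ← ih, ← e]
    rfl

end Stack

/-! ### Polynomial time from programs -/

theorem exists_bound (C : List Instr) (F : ℕ) : ∃ K, F < K ∧ ∀ i ∈ C, i.bound ≤ K := by
  induction C with
  | nil => exact ⟨F + 1, by simp⟩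
  | cons i C ih =>
    obtain ⟨K, h1, h2⟩ := ih
    refine ⟨max K i.bound, lt_of_lt_of_le h1 (le_max_left _ _), ?_⟩
    intro j hj
    rcases List.mem_cons.1 hj with rfl | hj
    · exact le_max_right _ _
    · exact (h2 j hj).trans (le_max_left _ _)

/-- A problem decided by a program of the loop language is in polynomial time. -/
theorem inPTime_of_prog {α : Type} (e : α → List Letter) (P : α → Prop) (p : Prog) (F : ℕ)
    (hF : F < p.bound) (h : ∀ a, (p.run (e a) Store.zero).ctr F ≠ 0 ↔ P a) : InPTime e P := by
  obtain ⟨K, hFK, hK⟩ := exists_bound p.flow F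
  refine ⟨{
    tm := Stack.machine K p.flow ⟨F, hFK⟩
    inputAlphabet := Equiv.refl _
    outputAlphabet := Equiv.refl _
    -- The three summands are for the flowchart, the answer, and the clean-up. The clean-up is
    -- governed by the heights of the stacks, at most the length of the input plus the number of
    -- steps made.
    time := p.time + 1 + (.X + p.time + 1)
    outputsFun := ?_ }⟩
  intro a
  apply Classical.choice
  set w := e a with hw
  let S : ∀ k : Stack K, List k.Sym := fun k => match k with
    | .input => w
    | .seen => []
    | .tapeL => []
    | .tapeR => []
    | .ctr _ => []
    | .out => []
  have hS : Stack.Represents w Store.zero S := by constructor <;> simp [S, Store.zero]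
  have hSl : ∀ k, (S k).length ≤ w.length := by rintro (_ | _ | _ | _ | _ | _) <;> simp [S]
  obtain ⟨c, t, ht, hflow⟩ := p.flow_correct w
  obtain ⟨v1, S1, h1, h2, h3⟩ := Stack.steps_simulate ⟨F, hFK⟩ hK hflow hS none w.length hSl
  set b : Bool := (List.replicate (((p.run w Store.zero).patch p.bound c).ctr F) ()).head?.isSome
    with hb
  have hbP : b = @decide (P a) (Classical.propDecidable _) := by
    rw [Bool.eq_iff_iff, @decide_eq_true_iff _ (Classical.propDecidable _), ← h a, hb, ← hw]
    simp only [Store.patch, hF, if_true]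
    cases (p.run w Store.zero).ctr F <;> simp
  have h4 : Turing.TM2.step (Stack.program K p.flow ⟨F, hFK⟩)
      ⟨some (some (Stack.label p.flow p.flow.length)), v1, S1⟩ =
      some ⟨some none, none, update S1 .out [b]⟩ := by
    have : Stack.label p.flow p.flow.length = none := dif_neg (lt_irrefl _)
    rw [this]
    simp only [Turing.TM2.step, Stack.program, Stack.answerStmt, Turing.TM2.stepAux, h2.out,
      h2.ctr, Option.isSome_map, hb]
  have h5 := Stack.clean_correct p.flow ⟨F, hFK⟩ (w.length + t) (update S1 .out [b]) (by
    intro k hk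
    rw [update_of_ne hk]
    exact h3 k)
  obtain ⟨t', ht', hfin⟩ := ((show Within _ t _ _ from ⟨t, le_rfl, h1⟩).trans (.single h4)).trans h5
  have hit := Stack.iterate_bind_of_stepsTo hfin
  refine ⟨⟨⟨t', ?_⟩, ?_⟩⟩
  · refine Eq.trans ?_ (hit.trans ?_)
    · congr 2
      simp only [Turing.initList, Stack.machine, Equiv.invFun_as_coe, Equiv.refl_symm,
        Equiv.coe_refl, List.map_id]
      congr 1
      funext k
      cases k <;> rfl
    · simp only [Option.map_some, Turing.haltList, Stack.machine, Equiv.invFun_as_coe,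
        Equiv.refl_symm, Equiv.coe_refl, List.map_id, Computability.encodeBool]
      congr 2
      funext k
      cases k <;> first | rfl | skip
      simp [hbP]
  · simp only [Polynomial.eval_add, Polynomial.eval_X, Polynomial.eval_one]
    omega

/-! ### Paths along which an invariant holds -/

/-- `f` leads from `a` to `b`, and all configurations passed before `b` satisfy `I`. -/
def Confined {σ : Type*} (f : σ → Option σ) (I : σ → Prop) : σ → σ → Prop :=
  Relation.ReflTransGen fun a b => I a ∧ f a = some b

theorem Confined.reaches {σ : Type*} {f : σ → Option σ} {I : σ → Prop} {a b : σ}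
    (h : Confined f I a b) : StateTransition.Reaches f a b :=
  Relation.ReflTransGen.mono (fun _ _ h => h.2) _ _ h

theorem Confined.head {σ : Type*} {f : σ → Option σ} {I : σ → Prop} {a b c : σ} (ha : I a)
    (h : f a = some b) (h' : Confined f I b c) : Confined f I a c :=
  Relation.ReflTransGen.head ⟨ha, h⟩ h'

/-- By determinism everything reachable from `a` lies on the path to the halting configuration `b`.
-/
theorem Confined.invariant {σ : Type*} {f : σ → Option σ} {I : σ → Prop} {a b : σ}
    (h : Confined f I a b) (hb : f b = none) (hI : I b) {c : σ}
    (hc : StateTransition.Reaches f a c) : I c := by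
  induction h using Relation.ReflTransGen.head_induction_on with
  | refl =>
    rcases Relation.ReflTransGen.cases_head hc with rfl | ⟨d, hd, _⟩
    · exact hI
    · rw [hb] at hd; exact absurd hd (by simp)
  | head h _ ih =>
    rcases Relation.ReflTransGen.cases_head hc with rfl | ⟨d, hd, hdc⟩
    · exact h.1
    · rw [h.2] at hd
      cases hd
      exact ih hdc

/-! ### Binary counters on a work tape -/

/-- Symbols on work tapes: cells hold blanks, bits, or the mark of cell `0`. -/
inductive TSym
  | blank
  | mark
  | bit (b : Bool)
  deriving Fintype

/-- Phases of an operation on a counter. -/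
inductive Phase
  | main
  | scan
  | ret (b : Bool)
  | fill
  deriving Fintype

/-- Operations on a counter: incrementing, decrementing, and testing whether it vanishes. -/
inductive CounterOp
  | inc
  | dec
  | test

namespace CounterOp

/-- The next phase, or the result of the operation. -/
abbrev Next := Phase ⊕ Bool

/-- Scanning the digits of a counter from the least significant one. -/
def scan : CounterOp → TSym → TSym × Move × Next
  | inc, .bit true => (.bit false, .right, .inl .scan)
  | inc, _ => (.bit true, .left, .inl (.ret false))
  | dec, .bit false => (.bit false, .right, .inl .scan)
  | dec, .bit true => (.bit false, .left, .inl .fill)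
  | dec, x => (x, .left, .inl (.ret false))
  | test, .bit false => (.bit false, .right, .inl .scan)
  | test, .bit true => (.bit true, .left, .inl (.ret false))
  | test, x => (x, .left, .inl (.ret true))

def trans (o : CounterOp) : Phase → TSym → TSym × Move × Next
  | .main, x => (x, .right, .inl .scan)
  | .scan, x => o.scan x
  | .ret b, .mark => (.mark, .stay, .inr b)
  | .ret b, x => (x, .left, .inl (.ret b))
  | .fill, .mark => (.mark, .stay, .inr false)
  | .fill, _ => (.bit true, .left, .inl .fill)

/-- The state, the tape and the head of a counter. -/
abbrev Cfg := Next × (ℕ → TSym) × ℕ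

def step (o : CounterOp) : Cfg → Option Cfg
  | (.inl p, t, h) => some ((o.trans p (t h)).2.2, update t h (o.trans p (t h)).1,
      Transducer.moveHead (o.trans p (t h)).2.1 h)
  | (.inr _, _, _) => none

/-- The tape whose digits are `l`. -/
def tape (l : List Bool) : ℕ → TSym
  | 0 => .mark
  | i + 1 => l[i]?.elim .blank .bit

theorem tape_append (l l' : List Bool) (b : Bool) : tape (l ++ b :: l') (l.length + 1) = .bit b := by
  simp [tape]

theorem tape_end (l : List Bool) : tape l (l.length + 1) = .blank := by
  simp [tape]

theorem update_tape (l l' : List Bool) (b c : Bool) :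
    update (tape (l ++ b :: l')) (l.length + 1) (.bit c) = tape (l ++ c :: l') := by
  funext i
  rcases i with _ | i
  · simp [tape]
  · by_cases h : i = l.length
    · subst h; simp [tape]
    · rw [update_of_ne (by omega)]
      simp only [tape]
      congr 1
      rcases lt_or_gt_of_ne h with h | h
      · rw [List.getElem?_append_left h, List.getElem?_append_left h]
      · rw [List.getElem?_append_right h.le, List.getElem?_append_right h.le]
        obtain ⟨k, hk⟩ : ∃ k, i - l.length = k + 1 := ⟨i - l.length - 1, by omega⟩
        simp [hk]

theorem update_tape_end (l : List Bool) (c : Bool) :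
    update (tape l) (l.length + 1) (.bit c) = tape (l ++ [c]) := by
  funext i
  rcases i with _ | i
  · simp [tape]
  · by_cases h : i = l.length
    · subst h; simp [tape]
    · rw [update_of_ne (by omega)]
      simp only [tape]
      congr 1
      rcases lt_or_gt_of_ne h with h | h
      · rw [List.getElem?_append_left h]
      · rw [List.getElem?_eq_none h.le, List.getElem?_eq_none (by simp; omega)]

/-- The number with the binary digits `l`, the least significant one first. -/
def value : List Bool → ℕ
  | [] => 0
  | b :: l => b.toNat + 2 * value l

def incDigits : List Bool → List Bool
  | [] => [true]
  | false :: l => true :: l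
  | true :: l => false :: incDigits l

theorem value_incDigits (l : List Bool) : value (incDigits l) = value l + 1 := by
  induction l with
  | nil => rfl
  | cons b l ih =>
    cases b
    · simp [incDigits, value, Nat.add_comm]
    · simp only [incDigits, value, ih, Bool.toNat_false, Bool.toNat_true]; omega

/-- A carry out of the highest of `n` digits occurs only when all of them are ones, and that is
excluded by the bound on the value. -/
theorem length_incDigits {l : List Bool} {n : ℕ} (hl : l.length ≤ n) (h : value l + 1 < 2 ^ n) :
    (incDigits l).length ≤ n := by
  induction l generalizing n with
  | nil =>
    rcases n with _ | n
    · simp [value] at h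
    · simp [incDigits]
  | cons b l ih =>
    cases b
    · simpa [incDigits] using hl
    · rcases n with _ | n
      · simp at hl
      · simp only [incDigits, List.length_cons, Nat.add_le_add_iff_right] at hl ⊢
        refine ih hl ?_
        simp only [value, Bool.toNat_true, pow_succ] at h
        omega

theorem value_zeros (n : ℕ) : value (List.replicate n false) = 0 := by
  induction n with
  | zero => rfl
  | succ n ih => simp [List.replicate_succ, value, ih]

/-- Borrowing: decrementing turns the trailing zeros into ones and the lowest one into a zero. -/
theorem value_borrow (n : ℕ) (l : List Bool) :
    value (List.replicate n false ++ true :: l) =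
      value (List.replicate n true ++ false :: l) + 1 := by
  induction n with
  | zero => simp [value]; omega
  | succ n ih => simp [List.replicate_succ, value, ih]; omega

theorem eq_zeros_or (l : List Bool) : l = List.replicate l.length false ∨
    ∃ n l', l = List.replicate n false ++ true :: l' := by
  induction l with
  | nil => exact .inl rfl
  | cons b l ih =>
    cases b
    · rcases ih with h | ⟨n, l', h⟩
      · left; rw [List.length_cons, List.replicate_succ, ← h]
      · right; exact ⟨n + 1, l', by rw [h]; simp [List.replicate_succ]⟩
    · exact .inr ⟨0, l, rfl⟩

section Run

variable {o : CounterOp} {S : ℕ}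

/-- Runs with the head below `S`. -/
def Run (o : CounterOp) (S : ℕ) : Cfg → Cfg → Prop := Confined o.step fun c => c.2.2 < S

theorem Run.head {c d e : Cfg} (h : c.2.2 < S) (h1 : o.step c = some d) (h2 : Run o S d e) :
    Run o S c e := Confined.head h h1 h2

theorem run_ret (b : Bool) (l : List Bool) (h : ℕ) (hS : h < S) :
    Run o S (.inl (.ret b), tape l, h) (.inr b, tape l, 0) := by
  induction h with
  | zero =>
    refine Run.head hS ?_ .refl
    simp only [step, trans, tape, Transducer.moveHead]
    congr 3
    exact update_eq_self_iff.2 rfl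
  | succ h ih =>
    refine Run.head hS ?_ (ih (by omega))
    have : tape l (h + 1) ≠ .mark := by
      simp only [tape]
      cases l[h]? <;> simp
    have e : o.trans (.ret b) (tape l (h + 1)) = (tape l (h + 1), .left, .inl (.ret b)) := by
      rw [trans]; exact this
    simp only [step, e, update_eq_self]
    rfl

/-- The zeros passed while looking for the lowest one become ones on the way back to the mark of
cell `0`. -/
theorem run_fill (l : List Bool) (h : ℕ) (hS : h < S) :
    Run o S (.inl .fill, tape (List.replicate h false ++ l), h)
      (.inr false, tape (List.replicate h true ++ l), 0) := by
  induction h generalizing l with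
  | zero =>
    refine Run.head hS ?_ .refl
    simp only [step, trans, tape, Transducer.moveHead, List.replicate_zero, List.nil_append]
    congr 3
    exact update_eq_self_iff.2 rfl
  | succ h ih =>
    have := ih (true :: l) (by omega)
    rw [List.append_cons (List.replicate h true), ← List.replicate_succ'] at this
    refine Run.head hS ?_ this
    rw [List.replicate_succ', List.append_assoc, List.singleton_append]
    have e := tape_append (List.replicate h false) l false
    have e' := update_tape (List.replicate h false) l false true
    rw [List.length_replicate] at e e'
    simp only [step, e, trans, e']
    rfl

theorem run_zeros (ho : o = dec ∨ o = test) (l : List Bool) (n : ℕ) (hS : n < S) :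
    Run o S (.inl .main, tape (List.replicate n false ++ l), 0)
      (.inl .scan, tape (List.replicate n false ++ l), n + 1) := by
  refine Run.head (by omega : 0 < S) ?_ (d := (.inl .scan, tape (List.replicate n false ++ l), 1)) ?_
  · simp only [step, trans, update_eq_self]; rfl
  -- Induction on the number `j` of zeros still to be passed.
  have key : ∀ j ≤ n, Run o S (.inl .scan, tape (List.replicate n false ++ l), n - j + 1)
      (.inl .scan, tape (List.replicate n false ++ l), n + 1) := by
    intro j hj
    induction j with
    | zero => exact .refl
    | succ j ih =>
      have ih := ih (by omega)
      rw [show n - j + 1 = n - (j + 1) + 1 + 1 by omega] at ih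
      refine Run.head ?_ ?_ ih
      · change n - (j + 1) + 1 < S
        omega
      · have e : tape (List.replicate n false ++ l) (n - (j + 1) + 1) = .bit false := by
          simp only [tape]
          rw [List.getElem?_append_left (by simp; omega), List.getElem?_replicate,
            if_pos (by omega)]
          rfl
        have e' : o.scan (.bit false) = (.bit false, .right, .inl .scan) := by
          rcases ho with rfl | rfl <;> rfl
        simp only [step, e, trans, e']
        rw [← e, update_eq_self]
        rfl
  simpa using key n le_rfl

theorem run_inc (l : List Bool) (hS : l.length + 1 < S) :
    Run inc S (.inl .main, tape l, 0) (.inr false, tape (incDigits l), 0) := by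
  refine Run.head (by omega : 0 < S) ?_ (d := (.inl .scan, tape l, 1)) ?_
  · simp only [step, trans, update_eq_self]; rfl
  -- `pre` consists of the digits already passed, at which the carry has done its work.
  have key : ∀ (suf pre : List Bool), pre.length + suf.length + 1 < S →
      Run inc S (.inl .scan, tape (pre ++ suf), pre.length + 1)
        (.inr false, tape (pre ++ incDigits suf), 0) := by
    intro suf
    induction suf with
    | nil =>
      intro pre h
      simp only [List.length_nil] at h
      refine Run.head (by dsimp only; omega) ?_ (run_ret false (pre ++ [true]) pre.length (by omega))
      rw [List.append_nil]
      simp only [step, tape_end, trans, scan, update_tape_end]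
      rfl
    | cons b suf ih =>
      intro pre h
      simp only [List.length_cons] at h
      cases b
      · refine Run.head (by dsimp only; omega) ?_
          (run_ret false (pre ++ true :: suf) pre.length (by omega))
        simp only [step, tape_append, trans, scan, update_tape]
        rfl
      · have := ih (pre ++ [false]) (by simp; omega)
        simp only [List.append_assoc, List.singleton_append, List.length_append,
          List.length_singleton] at this
        refine Run.head (by dsimp only; omega) ?_ this
        simp only [step, tape_append, trans, scan, update_tape]
        rfl
  simpa using key l [] (by simpa using hS)

theorem run_dec (l : List Bool) (hS : l.length + 1 < S) :
    ∃ l' : List Bool, l'.length = l.length ∧ value l' = value l - 1 ∧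
      Run dec S (.inl .main, tape l, 0) (.inr false, tape l', 0) := by
  rcases eq_zeros_or l with h | ⟨n, l', h⟩
  · refine ⟨l, rfl, by rw [h, value_zeros], ?_⟩
    have h1 := run_zeros (o := dec) (.inl rfl) [] l.length (S := S) (by omega)
    rw [List.append_nil, ← h] at h1
    refine Relation.ReflTransGen.trans h1 (Run.head hS ?_ (run_ret false l l.length (by omega)))
    simp only [step, tape_end, trans, scan]
    rw [← tape_end l, update_eq_self]
    rfl
  · subst h
    rw [List.length_append, List.length_replicate, List.length_cons] at hS
    refine ⟨List.replicate n true ++ false :: l', by simp, by rw [value_borrow]; simp, ?_⟩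
    refine Relation.ReflTransGen.trans (run_zeros (.inl rfl) (true :: l') n (by omega))
      (Run.head (by dsimp only; omega) ?_ (run_fill (false :: l') n (by omega)))
    have e := tape_append (List.replicate n false) l' true
    have e' := update_tape (List.replicate n false) l' true false
    rw [List.length_replicate] at e e'
    simp only [step, e, trans, scan, e']
    rfl

theorem run_test (l : List Bool) (hS : l.length + 1 < S) :
    Run test S (.inl .main, tape l, 0) (.inr (value l == 0), tape l, 0) := by
  rcases eq_zeros_or l with h | ⟨n, l', h⟩
  · have h1 := run_zeros (o := test) (.inr rfl) [] l.length (S := S) (by omega)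
    have h0 : value l = 0 := by rw [h, value_zeros]
    rw [List.append_nil, ← h] at h1
    refine Relation.ReflTransGen.trans h1 (Run.head hS ?_ (run_ret _ l l.length (by omega)))
    simp only [step, tape_end, trans, scan, h0]
    rw [← tape_end l, update_eq_self]
    rfl
  · subst h
    rw [List.length_append, List.length_replicate, List.length_cons] at hS
    refine Relation.ReflTransGen.trans (run_zeros (.inr rfl) (true :: l') n (by omega))
      (Run.head (by dsimp only; omega) ?_ (run_ret _ _ n (by omega)))
    have e := tape_append (List.replicate n false) l' true
    rw [List.length_replicate] at e
    simp only [step, e, trans, scan, value_borrow]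
    rw [← e, update_eq_self]
    simp [Transducer.moveHead]

end Run

end CounterOp

/-! ### Simulation of flowcharts by transducers -/

namespace Simulator

open Stack (label label_eq_some)

/-- States of the simulating transducer: `none` is the initial state. -/
abbrev State (C : List Instr) := Option (Option (Fin C.length) × Phase)

/-- What a step of the transducer does. -/
abbrev Action (K : ℕ) (C : List Instr) :=
  State C × Move × (Fin K → TSym × Move) × Option Letter

variable {K : ℕ} {C : List Instr}

/-- A step of an operation on counter `r`, with exit to `e`. -/
def counterAct (o : CounterOp) (r : ℕ) (e : Bool → ℕ) (a : Option (Fin C.length)) (p : Phase)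
    (x : Fin K → TSym) : Option (Action K C) :=
  if h : r < K then
    some (some ((o.trans p (x ⟨r, h⟩)).2.2.elim (fun p' => (a, p'))
        fun b => (label C (e b), .main)), .stay,
      fun i => if i.val = r then ((o.trans p (x i)).1, (o.trans p (x i)).2.1) else (x i, .stay),
      none)
  else none

/-- A step that leaves the work tapes alone. -/
def plainAct (s : Option (Fin C.length) × Phase) (m : Move) (o : Option Letter)
    (x : Fin K → TSym) : Option (Action K C) :=
  some (some s, m, fun i => (x i, .stay), o)

def scanned : Scan Letter → Option Letter
  | .letter c => some c
  | _ => none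

/-- Position `p` of a store is cell `p + 1` of the input tape. A movement to the left takes two
steps: the head moves left and, if it has reached the left endmarker, returns, so that position `0`
is not left. The work tapes do not hold the tape of the store, so actions on it are void. -/
def instrAct (a : Option (Fin C.length)) (p : Phase) (y : Scan Letter) (x : Fin K → TSym) :
    Instr → Option (Action K C)
  | .act (.inc r) e => counterAct .inc r (fun _ => e) a p x
  | .act (.dec r) e => counterAct .dec r (fun _ => e) a p x
  | .act .left e => match p, y with
    | .main, _ => plainAct (a, .scan) .left none x
    | _, .leftEnd => plainAct (label C e, .main) .right none x
    | _, _ => plainAct (label C e, .main) .stay none x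
  | .act .right e => plainAct (label C e, .main) .right none x
  | .act (.emit c) e => plainAct (label C e, .main) .stay (some c) x
  | .act _ e => plainAct (label C e, .main) .stay none x
  | .br (.zero r) y n => counterAct .test r (fun b => if b then y else n) a p x
  | .br (.letter c) y' n =>
    plainAct (label C (if scanned y == c then y' else n), .main) .stay none x
  | .br .cell _ n => plainAct (label C n, .main) .stay none x

/-- The transducer simulating the flowchart `C` with `K` counters; tape tests are not supported. -/
abbrev transducer (K : ℕ) (C : List Instr) : Transducer Letter Letter where
  State := State C
  Sym := TSym
  blank := .blank
  tapes := K
  start := none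
  trans
    | none, _, _ => some (some (label C 0, .main), .right, fun _ => (.mark, .stay), none)
    | some (none, _), _, _ => none
    | some (some i, p), y, x => instrAct (some i) p y x (C.get i)

/-- The configuration `c` of the transducer represents the store `s` at address `pc`, with counters
of at most `L` digits. -/
structure Represents (w : List Letter) (L pc : ℕ) (s : Store) (c : (transducer K C).Cfg) :
    Prop where
  state : c.state = some (label C pc, .main)
  pos : s.pos ≤ w.length
  inputHead : c.inputHead = s.pos + 1
  work : ∀ r : Fin K, ∃ l : List Bool, l.length ≤ L ∧ CounterOp.value l = s.ctr r ∧
    c.work r = CounterOp.tape l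
  head : ∀ r : Fin K, c.head r = 0
  output : c.output = s.out

/-- All heads on work tapes are below `S`. -/
def Small (S : ℕ) (c : (transducer K C).Cfg) : Prop := ∀ r, c.head r < S

/-- The configuration in which counter `r` is in the course of an operation. -/
def during (e : Bool → ℕ) (a : Fin C.length) (r : Fin K) (c : (transducer K C).Cfg)
    (d : CounterOp.Cfg) : (transducer K C).Cfg :=
  { c with
    state := some (d.1.elim (fun p => (some a, p)) fun b => (label C (e b), .main))
    work := update c.work r d.2.1
    head := update c.head r d.2.2 }

theorem step_eq {w : List Letter} {c : (transducer K C).Cfg} {x : Action K C}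
    (h : (transducer K C).trans c.state (Transducer.scan w c.inputHead)
      (fun i => c.work i (c.head i)) = some x) :
    (transducer K C).step w c = some
      { state := x.1
        inputHead := min (Transducer.moveHead x.2.1 c.inputHead) (w.length + 1)
        work := fun i => update (c.work i) (c.head i) (x.2.2.1 i).1
        head := fun i => Transducer.moveHead (x.2.2.1 i).2 (c.head i)
        output := c.output ++ x.2.2.2.toList } := by
  rw [Transducer.step, h]
  rfl

/-- While an operation on counter `r` is going on, the other work tapes have their scanned symbol
rewritten and the input head rests, so the machine behaves like the isolated counter. -/
theorem step_during {w : List Letter} {o : CounterOp} {e : Bool → ℕ} {a : Fin C.length}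
    {r : Fin K} {c : (transducer K C).Cfg} (hq : c.inputHead ≤ w.length + 1)
    (hC : ∀ p y x, instrAct (K := K) (some a) p y x (C.get a) = counterAct o r e (some a) p x)
    {d d' : CounterOp.Cfg} (h : o.step d = some d') :
    (transducer K C).step w (during e a r c d) = some (during e a r c d') := by
  obtain ⟨n, t, i⟩ := d
  rcases n with p | b
  · simp only [CounterOp.step, Option.some.injEq] at h
    subst h
    refine (step_eq (w := w) (c := during e a r c (.inl p, t, i)) ((hC p _ _).trans (dif_pos r.isLt))).trans ?_
    simp only [during, Sum.elim_inl, Fin.eta, update_self]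
    congr 2
    · exact min_eq_left hq
    · funext j
      by_cases hj : j = r
      · subst hj; simp
      · have hj' : j.val ≠ r.val := fun h => hj (Fin.ext h)
        simp [hj, hj']
    · funext j
      by_cases hj : j = r
      · subst hj; simp
      · have hj' : j.val ≠ r.val := fun h => hj (Fin.ext h)
        simp [hj, hj', Transducer.moveHead]
    · simp
  · simp [CounterOp.step] at h

theorem run_during {w : List Letter} {o : CounterOp} {e : Bool → ℕ} {a : Fin C.length}
    {r : Fin K} {c : (transducer K C).Cfg} (hq : c.inputHead ≤ w.length + 1)
    (hC : ∀ p y x, instrAct (K := K) (some a) p y x (C.get a) = counterAct o r e (some a) p x)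
    {S : ℕ} (hc : Small S c) {d d' : CounterOp.Cfg} (h : CounterOp.Run o S d d') :
    Confined ((transducer K C).step w) (Small S) (during e a r c d) (during e a r c d') := by
  induction h using Relation.ReflTransGen.head_induction_on with
  | refl => exact .refl
  | head h _ ih =>
    refine Confined.head ?_ (step_during hq hC h.2) ih
    intro j
    by_cases hj : j = r
    · subst hj; simpa [during] using h.1
    · simpa [during, hj] using hc j

/-- The head stays below `L + 2` since a counter occupies the marked cell `0`, at most `L` digits,
and the blank cell where the scan turns back. -/
theorem counter_simulates {w : List Letter} {o : CounterOp} {e : Bool → ℕ} {a : Fin C.length}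
    {r : Fin K} {c : (transducer K C).Cfg} {L : ℕ} {s s' : Store} {pc : ℕ}
    (hc : Represents w L pc s c) (ha : label C pc = some a)
    (hC : ∀ p y x, instrAct (K := K) (some a) p y x (C.get a) = counterAct o r e (some a) p x)
    {b : Bool} {l l' : List Bool} (hl : c.work r = CounterOp.tape l)
    (hrun : CounterOp.Run o (L + 2) (.inl .main, CounterOp.tape l, 0)
      (.inr b, CounterOp.tape l', 0))
    (hl' : l'.length ≤ L) (hv : CounterOp.value l' = s'.ctr r)
    (hctr : ∀ i, i ≠ r.val → s'.ctr i = s.ctr i) (hpos : s'.pos = s.pos) (hout : s'.out = s.out) :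
    ∃ c', Confined ((transducer K C).step w) (Small (L + 2)) c c' ∧ Represents w L (e b) s' c' := by
  have hsmall : Small (L + 2) c := fun i => by rw [hc.head]; omega
  have h0 : during e a r c (.inl .main, CounterOp.tape l, 0) = c := by
    have h1 := hc.state
    rw [ha] at h1
    simp only [during, ← hl, ← hc.head r, update_eq_self, Sum.elim_inl, ← h1]
  have h1 := run_during (w := w) (e := e) (by rw [hc.inputHead]; have := hc.pos; omega) hC hsmall hrun
  rw [h0] at h1
  refine ⟨during e a r c (.inr b, CounterOp.tape l', 0), h1, rfl, by rw [hpos]; exact hc.pos, by rw [hpos]; exact hc.inputHead, ?_, ?_, ?_⟩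
  · intro i
    by_cases hi : i = r
    · subst hi; exact ⟨l', hl', hv, by simp [during]⟩
    · obtain ⟨m, h2, h3, h4⟩ := hc.work i
      refine ⟨m, h2, ?_, by simp [during, hi, h4]⟩
      rw [h3, hctr]
      exact fun h => hi (Fin.ext h)
  · intro i
    by_cases hi : i = r
    · subst hi; simp [during]
    · simp [during, hi, hc.head]
  · rw [hout]; exact hc.output

theorem plain_step {w : List Letter} {c : (transducer K C).Cfg} {a : Fin C.length} {p : Phase}
    (hst : c.state = some (some a, p)) {s : Option (Fin C.length) × Phase} {m : Move}
    {o : Option Letter}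
    (hC : ∀ x, instrAct (K := K) (some a) p (Transducer.scan w c.inputHead) x (C.get a) =
      plainAct s m o x) :
    (transducer K C).step w c = some { c with
      state := some s
      inputHead := min (Transducer.moveHead m c.inputHead) (w.length + 1)
      output := c.output ++ o.toList } := by
  refine (step_eq (x := (some s, m, fun i => (c.work i (c.head i), .stay), o))
    (by rw [hst]; exact hC _)).trans ?_
  simp only [update_eq_self, Transducer.moveHead]

theorem plain_simulates {w : List Letter} {c : (transducer K C).Cfg} {a : Fin C.length} {pc : ℕ}
    {s s' : Store} {L : ℕ} (hc : Represents w L pc s c) (ha : label C pc = some a)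
    {e : ℕ} {m : Move} {o : Option Letter}
    (hC : ∀ x, instrAct (K := K) (some a) .main (Transducer.scan w c.inputHead) x (C.get a) =
      plainAct (label C e, .main) m o x)
    (hctr : s'.ctr = s.ctr)
    (hpos : min (Transducer.moveHead m (s.pos + 1)) (w.length + 1) = s'.pos + 1)
    (hout : s'.out = s.out ++ o.toList) :
    ∃ c', Confined ((transducer K C).step w) (Small (L + 2)) c c' ∧ Represents w L e s' c' := by
  have hsmall : Small (L + 2) c := fun i => by rw [hc.head]; omega
  refine ⟨_, Confined.head hsmall (plain_step (by rw [hc.state, ha]) hC) .refl, rfl, ?_, ?_, ?_,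
    hc.head, ?_⟩
  · omega
  · simp only [hc.inputHead, hpos]
  · rw [hctr]; exact hc.work
  · rw [hout, ← hc.output]

theorem scanned_scan (w : List Letter) (p : ℕ) : scanned (Transducer.scan w (p + 1)) = w[p]? := by
  simp only [Transducer.scan]
  cases w[p]? <;> rfl

/-- The bound `hL` on the values after the step matters for increments only, where it prevents the
counter from outgrowing `L` digits. -/
theorem instr_simulates {w : List Letter} {c : (transducer K C).Cfg} {a : Fin C.length} {pc : ℕ}
    {s : Store} {L : ℕ} (hc : Represents w L pc s c) (ha : label C pc = some a)
    {i : Instr} (hi : C.get a = i) (hb : i.bound ≤ K) (hcell : ∀ y n, i ≠ .br .cell y n)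
    (hL : ∀ r, (i.next w s).2.ctr r < 2 ^ L) :
    ∃ c', Confined ((transducer K C).step w) (Small (L + 2)) c c' ∧
      Represents w L (i.next w s).1 (i.next w s).2 c' := by
  have hpos := hc.pos
  cases i with
  | act x e =>
    cases x with
    | inc r =>
      obtain ⟨l, h1, h2, h3⟩ := hc.work ⟨r, hb⟩
      have hL' := hL r
      simp only [Instr.next, Act.run, update_self] at hL'
      simp only at h2
      exact counter_simulates (e := fun _ => e) (r := ⟨r, hb⟩) hc ha
        (fun p y x => by rw [hi]; rfl) h3 (CounterOp.run_inc l (by omega))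
        (CounterOp.length_incDigits h1 (by rw [h2]; exact hL'))
        (by simp [Instr.next, Act.run, CounterOp.value_incDigits, h2])
        (fun j hj => by simp [Instr.next, Act.run, hj]) rfl rfl
    | dec r =>
      obtain ⟨l, h1, h2, h3⟩ := hc.work ⟨r, hb⟩
      simp only at h2
      obtain ⟨l', h4, h5, h6⟩ := CounterOp.run_dec l (S := L + 2) (by omega)
      exact counter_simulates (e := fun _ => e) (r := ⟨r, hb⟩) hc ha
        (fun p y x => by rw [hi]; rfl) h3 h6 (by omega)
        (by simp [Instr.next, Act.run, h5, h2])
        (fun j hj => by simp [Instr.next, Act.run, hj]) rfl rfl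
    | left =>
      have hsmall : Small (L + 2) c := fun i => by rw [hc.head]; omega
      have h1 := plain_step (w := w) (c := c) (a := a) (p := .main) (by rw [hc.state, ha])
        (s := (some a, .scan)) (m := .left) (o := none) (fun x => by rw [hi]; rfl)
      simp only [hc.inputHead, Transducer.moveHead, Nat.add_sub_cancel] at h1
      rw [min_eq_left (by omega)] at h1
      refine Exists.imp (fun c' => And.imp_left (Confined.head hsmall h1)) ?_
      simp only [Instr.next, Act.run]
      rcases hp : s.pos with _ | p
      · refine ⟨_, Confined.head (fun i => hsmall i) (plain_step (a := a) (p := .scan) rfl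
          (s := (label C e, .main)) (m := .right) (o := none) ?_) .refl, rfl, ?_, ?_, hc.work,
          hc.head, ?_⟩
        · intro x; rw [hi]; rfl
        · simp
        · simp [Transducer.moveHead]
        · simp [hc.output]
      · refine ⟨_, Confined.head (fun i => hsmall i) (plain_step (a := a) (p := .scan) rfl
          (s := (label C e, .main)) (m := .stay) (o := none) ?_) .refl, rfl, ?_, ?_, hc.work,
          hc.head, ?_⟩
        · intro x
          rw [hi]
          simp only [instrAct, Transducer.scan]
          cases w[p]? <;> rfl
        · simp; omega
        · simp [Transducer.moveHead]; omega
        · simp [hc.output]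
    | right =>
      refine plain_simulates hc ha (m := .right) (o := none) (e := e)
        (fun x => by rw [hi]; rfl) rfl ?_ (by simp [Instr.next, Act.run])
      simp only [Instr.next, Act.run, Transducer.moveHead]
      omega
    | emit b =>
      refine plain_simulates hc ha (m := .stay) (o := some b) (e := e)
        (fun x => by rw [hi]; rfl) rfl ?_ (by simp [Instr.next, Act.run])
      simp only [Instr.next, Act.run, Transducer.moveHead]
      omega
    | tapeLeft | tapeRight | mark =>
      refine plain_simulates hc ha (m := .stay) (o := none) (e := e)
        (fun x => by rw [hi]; rfl) rfl ?_ (by simp [Instr.next, Act.run])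
      simp only [Instr.next, Act.run, Transducer.moveHead]
      omega
  | br t y n =>
    cases t with
    | zero r =>
      obtain ⟨l, h1, h2, h3⟩ := hc.work ⟨r, hb⟩
      simp only at h2
      have := counter_simulates (s' := s) (e := fun b => if b then y else n) (r := ⟨r, hb⟩) hc ha
        (fun p y x => by rw [hi]; rfl) h3 (CounterOp.run_test l (by omega)) h1 h2
        (fun _ _ => rfl) rfl rfl
      rwa [h2] at this
    | letter b =>
      refine plain_simulates (s' := s) hc ha (m := .stay) (o := none)
        (e := if w[s.pos]? == b then y else n) (fun x => ?_) rfl ?_ (by simp)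
      · rw [hi, hc.inputHead, instrAct, scanned_scan]
      · simp only [Transducer.moveHead]
        omega
    | cell => exact absurd rfl (hcell y n)

theorem _root_.CQA.Instr.ctr_next_le (w : List Letter) (s : Store) (i : Instr) (r : ℕ) :
    (i.next w s).2.ctr r ≤ s.ctr r + 1 := by
  cases i with
  | act a e =>
    cases a with
    | inc r' | dec r' =>
      simp only [Instr.next, Act.run]
      by_cases h : r = r'
      · subst h; simp; try omega
      · simp [h]
    | _ => simp [Instr.next, Act.run]
  | br t y n => simp [Instr.next]

/-- A counter grows by at most one in each step, so `m + t` bounds all values that occur and `L`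
digits suffice throughout. -/
theorem steps_simulate {w : List Letter} (hC : ∀ i ∈ C, i.bound ≤ K)
    (hcell : ∀ y n, Instr.br .cell y n ∉ C) {t L m : ℕ} {d d' : ℕ × Store}
    (h : StepsTo (flowStep w C) t d d') {c : (transducer K C).Cfg}
    (hc : Represents w L d.1 d.2 c) (hm : ∀ r, d.2.ctr r ≤ m) (hL : m + t < 2 ^ L) :
    ∃ c', Confined ((transducer K C).step w) (Small (L + 2)) c c' ∧
      Represents w L d'.1 d'.2 c' := by
  induction h generalizing c m with
  | refl => exact ⟨c, .refl, hc⟩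
  | @head t d d1 d' e _ ih =>
    obtain ⟨i, hi, rfl⟩ := Option.map_eq_some_iff.1 e
    obtain ⟨a, ha, hai⟩ := label_eq_some hi
    have hmem := List.mem_of_getElem? hi
    have hle : ∀ r, (i.next w d.2).2.ctr r ≤ m + 1 := fun r =>
      (i.ctr_next_le w d.2 r).trans (Nat.add_le_add_right (hm r) 1)
    obtain ⟨c1, h1, h2⟩ := instr_simulates hc ha hai (hC i hmem)
      (fun y n h => hcell y n (h ▸ hmem)) (fun r => by have := hle r; omega)
    obtain ⟨c2, h3, h4⟩ := ih h2 hle (by omega)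
    exact ⟨c2, h1.trans h3, h4⟩

end Simulator

/-! ### Logarithmic space from programs -/

/-- Numbers bounded by a polynomial in `n` have `O(log n)` binary digits. This rests on `n < 2 ^
(Nat.log 2 n + 1)`, applied to each monomial. -/
theorem exists_eval_lt_two_pow (P : Polynomial ℕ) :
    ∃ k : ℕ, ∀ n : ℕ, P.eval n < 2 ^ (k * (Nat.log 2 n + 1)) := by
  induction P using Polynomial.induction_on' with
  | add p q hp hq =>
    obtain ⟨k, hk⟩ := hp
    obtain ⟨l, hl⟩ := hq
    refine ⟨max k l + 1, fun n => ?_⟩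
    have h1 := hk n
    have h2 := hl n
    have h3 : 2 ^ (k * (Nat.log 2 n + 1)) ≤ 2 ^ (max k l * (Nat.log 2 n + 1)) :=
      Nat.pow_le_pow_right (by omega) (Nat.mul_le_mul_right _ (le_max_left _ _))
    have h4 : 2 ^ (l * (Nat.log 2 n + 1)) ≤ 2 ^ (max k l * (Nat.log 2 n + 1)) :=
      Nat.pow_le_pow_right (by omega) (Nat.mul_le_mul_right _ (le_max_right _ _))
    -- The additional one in the coefficient pays for the factor two that comes from adding two
    -- values.
    have h5 : 2 ^ (max k l * (Nat.log 2 n + 1) + 1) ≤ 2 ^ ((max k l + 1) * (Nat.log 2 n + 1)) :=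
      Nat.pow_le_pow_right (by omega) (by rw [Nat.succ_mul]; omega)
    rw [pow_succ] at h5
    rw [Polynomial.eval_add]
    omega
  | monomial d a =>
    refine ⟨a + 1 + d, fun n => ?_⟩
    rw [Polynomial.eval_monomial, Nat.add_mul, pow_add]
    have h1 : n < 2 ^ (Nat.log 2 n + 1) := Nat.lt_pow_succ_log_self (by omega) n
    have h2 : n ^ d ≤ 2 ^ (d * (Nat.log 2 n + 1)) := by
      rw [Nat.mul_comm, pow_mul]; exact Nat.pow_le_pow_left h1.le d
    have h3 : a < 2 ^ ((a + 1) * (Nat.log 2 n + 1)) :=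
      lt_of_lt_of_le (Nat.lt_two_pow_self) (Nat.pow_le_pow_right (by omega) (by nlinarith))
    exact Nat.mul_lt_mul_of_lt_of_le h3 h2 (by positivity)

/-- Programs that do not inspect the tape. -/
def Prog.NoTape : Prog → Prop
  | act _ => True
  | seq p q => p.NoTape ∧ q.NoTape
  | ite t p q => t ≠ .cell ∧ p.NoTape ∧ q.NoTape
  | rep p => p.NoTape

theorem Prog.NoTape.code {p : Prog} (hp : p.NoTape) (K b e y n : ℕ) :
    Instr.br .cell y n ∉ p.code K b e := by
  induction p generalizing b e with
  | act a => simp [Prog.code]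
  | seq p q ihp ihq => simp [Prog.code, ihp hp.1, ihq hp.2]
  | ite t p q ihp ihq => simp [Prog.code, ihp hp.2.1, ihq hp.2.2, hp.1.symm]
  | rep p ih => simp [Prog.code, ih hp]

/-- A function computed by a program of the loop language that does not inspect the tape is
computable in logarithmic space. -/
theorem logspaceComputable_of_prog {α β : Type} (e₀ : α → List Letter) (e₁ : β → List Letter)
    (f : α → β) (p : Prog) (hp : p.NoTape) (h : ∀ a, (p.run (e₀ a) Store.zero).out = e₁ (f a)) :
    LogspaceComputable e₀ e₁ f := by
  obtain ⟨K, -, hK⟩ := exists_bound p.flow 0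
  obtain ⟨k, hk⟩ := exists_eval_lt_two_pow p.time
  have hcell : ∀ y n, Instr.br .cell y n ∉ p.flow := by
    intro y n
    simp [Prog.flow, hp.code]
  -- Heads stay below `L + 2`, and the two extra cells are absorbed by raising the coefficient `k`
  -- by two.
  refine ⟨Simulator.transducer K p.flow, k + 2, fun a => ?_⟩
  set w := e₀ a with hw
  set M := Simulator.transducer K p.flow with hM
  set L := k * (Nat.log 2 w.length + 1) with hL
  let c₀ : M.Cfg :=
    { state := some (Stack.label p.flow 0, .main)
      inputHead := 1
      work := fun _ => CounterOp.tape []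
      head := fun _ => 0
      output := [] }
  have hstart : M.step w M.init = some c₀ := by
    refine (Simulator.step_eq (x := (some (Stack.label p.flow 0, .main), .right,
      fun _ => (.mark, .stay), none)) rfl).trans ?_
    simp only [c₀]
    congr 2
    · funext r i
      change update (fun _ => TSym.blank) 0 TSym.mark i = CounterOp.tape [] i
      by_cases hi : i = 0
      · subst hi; simp [CounterOp.tape]
      · obtain ⟨j, rfl⟩ := Nat.exists_eq_succ_of_ne_zero hi
        simp [CounterOp.tape]
  have hc₀ : Simulator.Represents w L 0 Store.zero c₀ :=
    ⟨rfl, Nat.zero_le _, rfl, fun r => ⟨[], Nat.zero_le _, rfl, rfl⟩, fun _ => rfl, rfl⟩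
  obtain ⟨c, t, ht, hflow⟩ := p.flow_correct w
  obtain ⟨c₁, h1, h2⟩ := Simulator.steps_simulate hK hcell hflow hc₀ (m := 0)
    (fun _ => le_rfl) (by have := hk w.length; rw [← hL] at this; omega)
  have h3 : Confined (M.step w) (Simulator.Small (L + 2)) M.init c₁ :=
    Confined.head (fun r => by simp [Transducer.init]) hstart h1
  have hend : M.step w c₁ = none := by
    have hl : Stack.label p.flow p.flow.length = none := dif_neg (lt_irrefl _)
    have : ∀ y x, M.trans c₁.state y x = none := fun y x => by
      rw [h2.state, hl]
    simp [Transducer.step, this]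
  refine ⟨⟨c₁, h3.reaches, hend, ?_⟩, fun c' hc' r => ?_⟩
  · rw [h2.output, ← h a]; rfl
  · have := h3.invariant hend (fun r => by rw [h2.head]; omega) hc' r
    refine this.trans_le ?_
    rw [Nat.add_mul]
    omega

/-! ### First-order formulas over words and their evaluation -/

namespace Prog

/-- The order matters: a decrement undoes an increment, but not conversely, because subtraction is
truncated. -/
def skip : Prog := seq (act (.inc 0)) (act (.dec 0))

@[simp] theorem run_skip (w : List Letter) (s : Store) : skip.run w s = s := by
  simp [skip, run, Act.run]

/-- Counting counter `r` down to zero and executing `p` each time. -/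
def for' (r : ℕ) (p : Prog) : Prog :=
  rep (ite (.zero r) skip (seq (act (.dec r)) p))

/-- `g i` is the memory after `i` effective passes. The underlying loop makes as many passes as the
input has letters, and those after the counter has vanished do nothing; this requires `k ≤
w.length`. -/
theorem run_for {w : List Letter} {r : ℕ} {p : Prog} {k : ℕ} (hk : k ≤ w.length) (g : ℕ → Store)
    (hg : ∀ i ≤ k, (g i).ctr r = k - i)
    (hp : ∀ i < k, p.run w ((Act.dec r).run w (g i)) = g (i + 1)) : (for' r p).run w (g 0) = g k := by
  have key : ∀ j, (run w (ite (.zero r) skip (seq (act (.dec r)) p)))^[j] (g 0) = g (min j k) := by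
    intro j
    induction j with
    | zero => simp
    | succ j ih =>
      rw [iterate_succ_apply', ih]
      by_cases h : j < k
      · have h1 : (g j).ctr r ≠ 0 := by rw [hg j h.le]; omega
        rw [min_eq_left h.le, min_eq_left (by omega)]
        simp only [run, Test.eval, beq_iff_eq, h1, if_false]
        exact hp j h
      · have h1 : (g k).ctr r = 0 := by rw [hg k le_rfl]; omega
        rw [min_eq_right (by omega), min_eq_right (by omega)]
        simp only [run, Test.eval, beq_iff_eq, h1, if_true, run_skip]
  rw [for', run, key, min_eq_right hk]

theorem run_rep {w : List Letter} {p : Prog} (g : ℕ → Store)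
    (hp : ∀ i < w.length, p.run w (g i) = g (i + 1)) : (rep p).run w (g 0) = g w.length := by
  have key : ∀ j ≤ w.length, (run w p)^[j] (g 0) = g j := by
    intro j
    induction j with
    | zero => simp
    | succ j ih =>
      intro hj
      rw [iterate_succ_apply', ih (by omega), hp j hj]
  exact key _ le_rfl

/-- Setting a counter to zero, provided its value is at most the length of the input. -/
def clear (r : ℕ) : Prog := rep (act (.dec r))

theorem run_clear (w : List Letter) (r : ℕ) (s : Store) :
    (clear r).run w s = { s with ctr := update s.ctr r (s.ctr r - w.length) } := by
  have := run_rep (w := w) (p := act (.dec r))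
    (fun i => { s with ctr := update s.ctr r (s.ctr r - i) })
    (fun i _ => by simp [run, Act.run, Nat.sub_sub])
  simpa [clear] using this

theorem run_rep_tapeRight (w : List Letter) (p : Prog) (m : ℕ)
    (hp : ∀ s, p.run w s = { s with head := s.head + m }) (s : Store) :
    (rep p).run w s = { s with head := s.head + w.length * m } := by
  have := run_rep (w := w) (p := p) (fun i => { s with head := s.head + i * m })
    (fun i _ => by simp [hp, Nat.succ_mul, Nat.add_assoc])
  simpa using this

theorem run_rep_tapeLeft (w : List Letter) (p : Prog) (m : ℕ)
    (hp : ∀ s, p.run w s = { s with head := s.head - m }) (s : Store) :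
    (rep p).run w s = { s with head := s.head - w.length * m } := by
  have := run_rep (w := w) (p := p) (fun i => { s with head := s.head - i * m })
    (fun i _ => by simp [hp, Nat.succ_mul, Nat.sub_sub])
  simpa using this

/-- Setting the flag, counter `0`, to the outcome of a test. -/
def setFlag (t : Test) : Prog :=
  ite t (seq (act (.dec 0)) (act (.inc 0))) (act (.dec 0))

/-- One decrement clears the flag, because its value is at most one. -/
theorem run_setFlag (w : List Letter) (t : Test) (s : Store) (hs : s.ctr 0 ≤ 1) :
    (setFlag t).run w s = { s with ctr := update s.ctr 0 (if t.eval w s then 1 else 0) } := by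
  simp only [setFlag, run]
  split_ifs with h <;> simp only [Act.run, update_self, update_idem] <;>
    rw [Nat.sub_eq_zero_of_le hs]

/-- Restoring the value of counter `x` from counter `t`. -/
theorem run_restore {w : List Letter} {x t : ℕ} (hxt : x ≠ t) (s : Store) (ht : s.ctr t ≤ w.length) :
    (for' t (act (.inc x))).run w s =
      { s with ctr := update (update s.ctr x (s.ctr x + s.ctr t)) t 0 } := by
  have := run_for (w := w) (r := t) (p := act (.inc x)) ht
    (fun i => { s with ctr := update (update s.ctr x (s.ctr x + i)) t (s.ctr t - i) })
    (fun i _ => by simp) (fun i _ => by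
      simp only [run, Act.run]
      congr 1
      funext r
      simp only [update_apply]
      split_ifs <;> omega)
  simpa using this

/-- Restoring the value of counter `x` from counter `t`, while moving the input head to the left. -/
theorem run_restore_left {w : List Letter} {x t : ℕ} (hxt : x ≠ t) (s : Store)
    (ht : s.ctr t ≤ w.length) :
    (for' t (seq (act (.inc x)) (act .left))).run w s =
      { s with
        ctr := update (update s.ctr x (s.ctr x + s.ctr t)) t 0
        pos := s.pos - s.ctr t } := by
  have := run_for (w := w) (r := t) (p := seq (act (.inc x)) (act .left)) ht
    (fun i => { s with
      ctr := update (update s.ctr x (s.ctr x + i)) t (s.ctr t - i)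
      pos := s.pos - i })
    (fun i _ => by simp) (fun i _ => by
      simp only [run, Act.run]
      congr 1
      funext r
      simp only [update_apply]
      split_ifs <;> omega)
  simpa using this

end Prog

/-- Formulas about positions of a word and cells of a tape, with de Bruijn indices. -/
inductive Fm
  /-- the sum of the first two variables is the third -/
  | plus (x y z : ℕ)
  /-- there is a given letter at a position -/
  | letter (c : Letter) (x : ℕ)
  /-- the number of separators before a position is divisible by three -/
  | sep (x : ℕ)
  /-- the tape cell addressed by three variables is marked -/
  | mem (x y z : ℕ)
  | and (φ ψ : Fm)
  | not (φ : Fm)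
  | ex (φ : Fm)

/-- Extending an assignment by a value of a new variable `0`. -/
def scons {α : Type} (a : α) (v : ℕ → α) : ℕ → α
  | 0 => a
  | i + 1 => v i

@[simp] theorem scons_zero {α : Type} (a : α) (v : ℕ → α) : scons a v 0 = a := rfl
@[simp] theorem scons_succ {α : Type} (a : α) (v : ℕ → α) (i : ℕ) : scons a v (i + 1) = v i := rfl

/-- The address of the tape cell given by three numbers. -/
def address (n x y z : ℕ) : ℕ := x * (n * n) + y * n + z

namespace Fm

/-- Satisfaction; quantifiers range over the positions of the word. -/
def Sat (w : List Letter) (tape : ℕ → Bool) : Fm → (ℕ → ℕ) → Prop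
  | plus x y z, v => v x + v y = v z
  | letter c x, v => w[v x]? = some c
  | sep x, v => (w.take (v x)).count none % 3 = 0
  | mem x y z, v => tape (address w.length (v x) (v y) (v z)) = true
  | and φ ψ, v => φ.Sat w tape v ∧ ψ.Sat w tape v
  | not φ, v => ¬ φ.Sat w tape v
  | ex φ, v => ∃ a < w.length, φ.Sat w tape (scons a v)

/-- The counter of variable `x` at depth `d`; counters `0, 1, 2` are the flag and auxiliary. -/
def reg (d x : ℕ) : ℕ := 3 + (d - 1 - x)

open Prog

/-- Adding counter `r` to counter `1`. -/
def addTo (r : ℕ) : Prog :=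
  seq (for' r (seq (act (.inc 1)) (act (.inc 2)))) (for' 2 (act (.inc r)))

/-- Moving the tape head to the address given by three counters. -/
def seek (x y z : ℕ) : Prog :=
  let go (x : ℕ) (p : Prog) : Prog := seq (for' x (seq (act (.inc 1)) p)) (for' 1 (act (.inc x)))
  seq (go x (rep (rep (act .tapeRight)))) (seq (go y (rep (act .tapeRight))) (go z (act .tapeRight)))

/-- Moving the tape head back to the first cell. -/
def rewind : Prog :=
  seq (rep (rep (rep (act .tapeLeft)))) (seq (rep (rep (act .tapeLeft))) (rep (act .tapeLeft)))

/-- Testing whether the sum of two counters is a third. -/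
def plusProg (x y z : ℕ) : Prog :=
  seq (act (.dec 0)) (seq (addTo x) (seq (addTo y)
    (seq (for' z (seq (act (.inc 2))
      (ite (.zero 1) (seq (act (.dec 0)) (act (.inc 0))) (act (.dec 1)))))
    (seq (for' 2 (act (.inc z)))
    (seq (ite (.zero 0) (setFlag (.zero 1)) (act (.dec 0)))
    (seq (clear 1) (clear 1)))))))

/-- Testing the letter at the position given by a counter. -/
def letterProg (c : Letter) (x : ℕ) : Prog :=
  seq (for' x (seq (act (.inc 1)) (act .right)))
    (seq (setFlag (.letter (some c))) (for' 1 (seq (act (.inc x)) (act .left))))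

/-- Incrementing counter `2` modulo three. -/
def rotate : Prog :=
  ite (.zero 2) (act (.inc 2)) (seq (act (.dec 2))
    (ite (.zero 2) (seq (act (.inc 2)) (act (.inc 2))) (act (.dec 2))))

/-- Counting separators modulo three. -/
def sepProg (x : ℕ) : Prog :=
  seq (for' x (seq (act (.inc 1)) (seq (ite (.letter (some none)) rotate skip) (act .right))))
    (seq (setFlag (.zero 2)) (seq (for' 1 (seq (act (.inc x)) (act .left)))
      (seq (act (.dec 2)) (act (.dec 2)))))

/-- Testing the tape cell addressed by three counters. -/
def memProg (x y z : ℕ) : Prog := seq (seek x y z) (seq (setFlag .cell) rewind)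

/-- The program evaluating a formula at depth `d`. The result is the value of counter `0`. -/
def prog : Fm → ℕ → Prog
  | plus x y z, d => plusProg (reg d x) (reg d y) (reg d z)
  | letter c x, d => letterProg c (reg d x)
  | sep x, d => sepProg (reg d x)
  | mem x y z, d => memProg (reg d x) (reg d y) (reg d z)
  | and φ ψ, d => seq (φ.prog d) (ite (.zero 0) skip (ψ.prog d))
  | not φ, d => seq (φ.prog d) (ite (.zero 0) (act (.inc 0)) (act (.dec 0)))
  | ex φ, d =>
    seq (act (.dec 0)) (seq (rep (ite (.zero 0)
      (seq (φ.prog (d + 1)) (ite (.zero 0) (act (.inc (3 + d))) skip)) skip)) (clear (3 + d)))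

/-- The values of the variables at depth `d`. -/
def env (d : ℕ) (s : Store) (x : ℕ) : ℕ := s.ctr (reg d x)

/-- The store is ready for the evaluation of formulas at depth `d`. -/
structure Ready (w : List Letter) (d : ℕ) (s : Store) : Prop where
  pos : s.pos = 0
  head : s.head = 0
  flag : s.ctr 0 ≤ 1
  one : s.ctr 1 = 0
  two : s.ctr 2 = 0
  le : ∀ i < d, s.ctr (3 + i) ≤ w.length
  zero : ∀ i, d ≤ i → s.ctr (3 + i) = 0

/-- By truncated subtraction all variables from `d - 1` on are read from counter `3`. So the bound
holds for every `x`, provided that there is at least one variable. -/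
theorem Ready.reg_le {w : List Letter} {d : ℕ} {s : Store} (h : Ready w d s) (hd : 0 < d) (x : ℕ) :
    s.ctr (reg d x) ≤ w.length := h.le _ (by omega)

theorem Ready.setFlag {w : List Letter} {d : ℕ} {s : Store} (h : Ready w d s) {b : ℕ} (hb : b ≤ 1) :
    Ready w d { s with ctr := update s.ctr 0 b } :=
  ⟨h.pos, h.head, by simpa using hb, by simpa using h.one, by simpa using h.two,
    fun i hi => by simpa [update_apply] using h.le i hi,
    fun i hi => by simpa [update_apply] using h.zero i hi⟩

theorem run_addTo {w : List Letter} {r : ℕ} (hr : 3 ≤ r) (s : Store) (h2 : s.ctr 2 = 0)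
    (hle : s.ctr r ≤ w.length) :
    (addTo r).run w s = { s with ctr := update s.ctr 1 (s.ctr 1 + s.ctr r) } := by
  have h1 := run_for (w := w) (r := r) (p := seq (act (.inc 1)) (act (.inc 2))) hle
    (fun i => { s with
      ctr := update (update (update s.ctr r (s.ctr r - i)) 1 (s.ctr 1 + i)) 2 i })
    (fun i _ => by simp only [update_apply]; split_ifs <;> omega) (fun i _ => by
      simp only [run, Act.run]
      congr 1
      funext j
      simp only [update_apply]
      split_ifs <;> omega)
  have h0 : update (update (update s.ctr r (s.ctr r - 0)) 1 (s.ctr 1 + 0)) 2 0 = s.ctr := by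
    funext j
    simp only [update_apply]
    split_ifs <;> simp_all
  rw [h0] at h1
  rw [addTo, run, h1, run_restore (by omega) _ (by simpa using hle)]
  congr 1
  funext j
  simp only [update_apply]
  split_ifs <;> simp_all

theorem run_seek {w : List Letter} {x y z : ℕ} (hx : 3 ≤ x) (hy : 3 ≤ y) (hz : 3 ≤ z) (s : Store)
    (h1 : s.ctr 1 = 0) (hx' : s.ctr x ≤ w.length) (hy' : s.ctr y ≤ w.length)
    (hz' : s.ctr z ≤ w.length) :
    (seek x y z).run w s =
      { s with head := s.head + address w.length (s.ctr x) (s.ctr y) (s.ctr z) } := by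
  have key : ∀ (x : ℕ) (p : Prog) (m : ℕ) (s : Store), 3 ≤ x → s.ctr 1 = 0 → s.ctr x ≤ w.length →
      (∀ s, p.run w s = { s with head := s.head + m }) →
      (seq (for' x (seq (act (.inc 1)) p)) (for' 1 (act (.inc x)))).run w s =
        { s with head := s.head + s.ctr x * m } := by
    intro x p m s hx h1 hx' hp
    have h3 := run_for (w := w) (r := x) (p := seq (act (.inc 1)) p) hx'
      (fun i => { s with
        ctr := update (update s.ctr x (s.ctr x - i)) 1 i
        head := s.head + i * m })
      (fun i _ => by simp only [update_apply]; split_ifs <;> omega) (fun i _ => by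
        simp only [run, Act.run, hp]
        congr 1
        · funext j
          simp only [update_apply]
          split_ifs <;> omega
        · rw [Nat.succ_mul, Nat.add_assoc])
    have h0 : update (update s.ctr x (s.ctr x - 0)) 1 0 = s.ctr := by
      funext j
      simp only [update_apply]
      split_ifs <;> simp_all
    simp only [h0, Nat.zero_mul, Nat.add_zero] at h3
    rw [run, h3, run_restore (by omega) _ (by simpa using hx')]
    congr 1
    funext j
    simp only [update_apply]
    split_ifs <;> simp_all
  have r1 : ∀ s, (act .tapeRight).run w s = { s with head := s.head + 1 } := fun _ => rfl
  have r2 := run_rep_tapeRight w _ _ r1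
  have r3 := run_rep_tapeRight w _ _ r2
  simp only [Nat.mul_one] at r2 r3
  rw [seek]
  simp only
  rw [run, key x _ _ s hx h1 hx' r3, run.eq_2,
    key y _ _ { s with head := s.head + s.ctr x * (w.length * w.length) } hy h1 hy' r2,
    key z _ _ { s with head := s.head + s.ctr x * (w.length * w.length) + s.ctr y * w.length }
      hz h1 hz' r1]
  simp [address, Nat.add_assoc]

/-- Movements to the left have no effect at cell `0`, so it suffices to make as many as the largest
address requires. -/
theorem run_rewind (w : List Letter) (s : Store)
    (h : s.head ≤ w.length * (w.length * w.length) + w.length * w.length + w.length) :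
    rewind.run w s = { s with head := 0 } := by
  have r1 : ∀ s, (act .tapeLeft).run w s = { s with head := s.head - 1 } := fun _ => rfl
  have r2 := run_rep_tapeLeft w _ _ r1
  have r3 := run_rep_tapeLeft w _ _ r2
  have r4 := run_rep_tapeLeft w _ _ r3
  simp only [Nat.mul_one] at r2 r3 r4
  rw [rewind, run, run, r4, r3, r2]
  congr 1
  simp only
  omega

theorem address_le {n x y z : ℕ} (hx : x ≤ n) (hy : y ≤ n) (hz : z ≤ n) :
    address n x y z ≤ n * (n * n) + n * n + n :=
  Nat.add_le_add (Nat.add_le_add (Nat.mul_le_mul_right _ hx) (Nat.mul_le_mul_right _ hy)) hz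

theorem run_plusProg {w : List Letter} {X Y Z : ℕ} (hX : 3 ≤ X) (hY : 3 ≤ Y) (hZ : 3 ≤ Z) {s : Store}
    (h0 : s.ctr 0 ≤ 1) (h1 : s.ctr 1 = 0) (h2 : s.ctr 2 = 0) (hx : s.ctr X ≤ w.length)
    (hy : s.ctr Y ≤ w.length) (hz : s.ctr Z ≤ w.length) :
    (plusProg X Y Z).run w s =
      { s with ctr := update s.ctr 0 (if s.ctr X + s.ctr Y = s.ctr Z then 1 else 0) } := by
  set A := s.ctr X + s.ctr Y with hA
  have e1 : (addTo Y).run w ((addTo X).run w ((Act.dec 0).run w s)) =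
      { s with ctr := update (update s.ctr 0 0) 1 A } := by
    rw [run_addTo hX, run_addTo hY]
    · simp only [Act.run]
      congr 1
      funext j
      simp only [update_apply]
      split_ifs <;> omega
    · simp [Act.run, h2]
    · simpa [Act.run, update_apply, show Y ≠ 1 by omega, show Y ≠ 0 by omega] using hy
    · simp [Act.run, h2]
    · simpa [Act.run, update_apply, show X ≠ 0 by omega] using hx
  -- Counting down `Z` diminishes the sum `A` held by counter `1`. The flag is raised when a unit is
  -- to be taken from zero, that is, once more than `A` units have been counted.
  have e2 := run_for (w := w) (r := Z) (k := s.ctr Z) (p := seq (act (.inc 2))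
      (ite (.zero 1) (seq (act (.dec 0)) (act (.inc 0))) (act (.dec 1)))) hz
    (fun i => { s with
      ctr := update (update (update (update s.ctr 0 (if A < i then 1 else 0)) 1 (A - i)) 2 i) Z
        (s.ctr Z - i) })
    (fun i _ => by simp) (fun i hi => by
      have h10 : 1 ≠ Z := by omega
      have h20 : 2 ≠ Z := by omega
      have h30 : 0 ≠ Z := by omega
      by_cases h : A ≤ i
      · have hA0 : (A - i == 0) = true := by rw [beq_iff_eq]; omega
        simp only [run, Act.run, Test.eval, update_self, update_idem, update_of_ne, ne_eq, h10, h20,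
          not_false_eq_true, hA0, if_true, reduceCtorEq, OfNat.one_ne_ofNat]
        congr 1
        funext j
        simp only [update_apply]
        split_ifs <;> first | omega | contradiction
      · have hA0 : (A - i == 0) = false := beq_eq_false_iff_ne.2 (by omega)
        simp only [run, Act.run, Test.eval, update_self, update_idem, update_of_ne, ne_eq, h10, h20,
          not_false_eq_true, hA0, Bool.false_eq_true, if_false, reduceCtorEq, OfNat.one_ne_ofNat]
        congr 1
        funext j
        simp only [update_apply]
        split_ifs <;> omega)
  have e0 : update (update (update (update s.ctr 0 (if A < 0 then 1 else 0)) 1 (A - 0)) 2 0) Z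
      (s.ctr Z - 0) = update (update s.ctr 0 0) 1 A := by
    rw [if_neg (by omega)]
    funext j
    rcases eq_or_ne j Z with rfl | hj
    · simp only [update_apply]
      split_ifs <;> omega
    · simp only [update_apply]
      split_ifs <;> first | omega | (subst_vars; omega)
  simp only [e0] at e2
  have h2Z : (2 : ℕ) ≠ Z := by omega
  change (clear 1).run w ((clear 1).run w ((ite (.zero 0) (setFlag (.zero 1)) (act (.dec 0))).run w
    ((for' 2 (act (.inc Z))).run w ((for' Z _).run w ((addTo Y).run w ((addTo X).run w
      ((Act.dec 0).run w s))))))) = _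
  have e3 : update (update (update (update (update (update s.ctr 0 (if A < s.ctr Z then 1 else 0)) 1
      (A - s.ctr Z)) 2 (s.ctr Z)) Z (s.ctr Z - s.ctr Z)) Z (s.ctr Z)) 2 0 =
      update (update s.ctr 0 (if A < s.ctr Z then 1 else 0)) 1 (A - s.ctr Z) := by
    funext j
    rcases eq_or_ne j Z with rfl | hj
    · simp only [update_apply]
      split_ifs <;> omega
    · simp only [update_apply]
      split_ifs <;> first | omega | contradiction | (subst_vars; omega)
  rw [e1, e2, run_restore (by omega) _ (by simpa [update_apply, h2Z] using hz)]
  simp only [update_self, update_of_ne h2Z, Nat.sub_self, Nat.zero_add]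
  rw [Nat.sub_self] at e3
  -- Counter `1` may hold up to twice the length of the input, so it is cleared twice.
  rw [e3, run_clear, run_clear, run]
  by_cases hlt : A < s.ctr Z
  · have hsub : A - s.ctr Z = 0 := by omega
    simp only [Test.eval, hlt, hsub, if_true, if_neg hlt.ne, run, Act.run, update_self, ne_eq,
      zero_ne_one, not_false_eq_true, update_of_ne, one_ne_zero, beq_iff_eq, if_false]
    congr 1
    funext j
    simp only [update_apply]
    split_ifs <;> first | omega | contradiction | (subst_vars; omega)
  · rw [if_neg hlt]
    simp only [Test.eval, update_self, ne_eq, zero_ne_one, not_false_eq_true, update_of_ne,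
      beq_self_eq_true, if_true]
    rw [run_setFlag _ _ _ (by simp)]
    simp only [Test.eval, update_self, beq_iff_eq]
    congr 1
    funext j
    simp only [update_apply]
    split_ifs <;> first | omega | contradiction | (subst_vars; omega)

theorem run_letterProg {w : List Letter} (c : Letter) {X : ℕ} (hX : 3 ≤ X) {s : Store}
    (h0 : s.ctr 0 ≤ 1) (h1 : s.ctr 1 = 0) (hp : s.pos = 0) (hx : s.ctr X ≤ w.length) :
    (letterProg c X).run w s =
      { s with ctr := update s.ctr 0 (if w[s.ctr X]? = some c then 1 else 0) } := by
  have e1 := run_for (w := w) (r := X) (p := seq (act (.inc 1)) (act .right)) hx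
    (fun i => { s with ctr := update (update s.ctr X (s.ctr X - i)) 1 i, pos := i })
    (fun i _ => by simp only [update_apply]; split_ifs <;> omega) (fun i hi => by
      simp only [run, Act.run]
      congr 1
      · funext j
        simp only [update_apply]
        split_ifs <;> omega
      · omega)
  have e0 : update (update s.ctr X (s.ctr X - 0)) 1 0 = s.ctr := by
    funext j
    simp only [update_apply]
    split_ifs <;> simp_all
  have e2 : ({ s with ctr := s.ctr, pos := 0 } : Store) = s := by rw [← hp]
  simp only [e0, e2] at e1
  rw [letterProg, run, e1, run, run_setFlag _ _ _
    (by simpa [update_apply, show 0 ≠ X by omega] using h0), run_restore_left (by omega) _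
    (by simpa [update_apply] using hx)]
  simp only [Test.eval, beq_iff_eq]
  congr 1
  · funext j
    simp only [update_apply]
    split_ifs <;> simp_all
  · simp [hp]

theorem run_rotate (w : List Letter) (s : Store) (h : s.ctr 2 < 3) :
    rotate.run w s = { s with ctr := update s.ctr 2 ((s.ctr 2 + 1) % 3) } := by
  obtain ⟨c, hc⟩ : ∃ c, s.ctr 2 = c := ⟨_, rfl⟩
  have : c = 0 ∨ c = 1 ∨ c = 2 := by omega
  rcases this with rfl | rfl | rfl <;> simp [rotate, run, Test.eval, Act.run, hc]

theorem run_sepProg {w : List Letter} {X : ℕ} (hX : 3 ≤ X) {s : Store}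
    (h0 : s.ctr 0 ≤ 1) (h1 : s.ctr 1 = 0) (h2 : s.ctr 2 = 0) (hp : s.pos = 0)
    (hx : s.ctr X ≤ w.length) :
    (sepProg X).run w s =
      { s with ctr := update s.ctr 0 (if (w.take (s.ctr X)).count none % 3 = 0 then 1 else 0) } := by
  have e1 := run_for (w := w) (r := X) (p := seq (act (.inc 1))
      (seq (ite (.letter (some none)) rotate skip) (act .right))) hx
    (fun i => { s with
      ctr := update (update (update s.ctr X (s.ctr X - i)) 1 i) 2 ((w.take i).count none % 3)
      pos := i })
    (fun i _ => by simp only [update_apply]; split_ifs <;> omega) (fun i hi => by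
      have hi' : i < w.length := by omega
      have hlt : (w.take i).count none % 3 < 3 := Nat.mod_lt _ (by omega)
      have hX1 : X ≠ 1 := by omega
      have hX2 : X ≠ 2 := by omega
      have hmin : min (i + 1) w.length = i + 1 := by omega
      rw [List.take_succ_eq_append_getElem hi', List.count_append]
      simp only [run, Act.run, Test.eval]
      by_cases h : w[i] = none
      · simp only [List.getElem?_eq_getElem hi', h, beq_self_eq_true, if_true]
        rw [run_rotate _ _ (by simpa [update_apply, hX2.symm] using hlt)]
        simp only [hmin]
        congr 1
        funext j
        simp only [update_apply, List.count_singleton_self]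
        split_ifs <;> omega
      · have h' : (some w[i] == some none) = false :=
          beq_eq_false_iff_ne.2 fun e => h (Option.some.inj e)
        simp only [List.getElem?_eq_getElem hi', h', Bool.false_eq_true, if_false, run_skip, hmin]
        congr 1
        funext j
        simp only [update_apply, List.count_singleton, beq_eq_false_iff_ne.2 h, Bool.false_eq_true,
          if_false, Nat.add_zero]
        split_ifs <;> omega)
  have e0 : update (update (update s.ctr X (s.ctr X - 0)) 1 0) 2 0 = s.ctr := by
    funext j
    simp only [update_apply]
    split_ifs <;> first | omega | (subst_vars; omega)
  have e2 : ({ s with ctr := s.ctr, pos := 0 } : Store) = s := by rw [← hp]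
  simp only [List.take_zero, List.count_nil, Nat.zero_mod, e0, e2] at e1
  rw [sepProg, run, e1, run, run_setFlag _ _ _
    (by simpa [update_apply, show 0 ≠ X by omega] using h0), run, run_restore_left (by omega) _
    (by simpa [update_apply] using hx)]
  have hlt : (w.take (s.ctr X)).count none % 3 < 3 := Nat.mod_lt _ (by omega)
  simp only [Test.eval, beq_iff_eq, run, Act.run]
  congr 1
  · funext j
    rcases eq_or_ne j X with rfl | hj
    · simp only [update_apply]
      split_ifs <;> first | omega | contradiction
    · simp only [update_apply]
      split_ifs <;> first | omega | contradiction | (subst_vars; omega)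
  · simp [hp]

theorem run_memProg {w : List Letter} {X Y Z : ℕ} (hX : 3 ≤ X) (hY : 3 ≤ Y) (hZ : 3 ≤ Z) {s : Store}
    (h0 : s.ctr 0 ≤ 1) (h1 : s.ctr 1 = 0) (hh : s.head = 0) (hx : s.ctr X ≤ w.length)
    (hy : s.ctr Y ≤ w.length) (hz : s.ctr Z ≤ w.length) :
    (memProg X Y Z).run w s = { s with
      ctr := update s.ctr 0
        (if s.tape (address w.length (s.ctr X) (s.ctr Y) (s.ctr Z)) = true then 1 else 0) } := by
  have hle := address_le hx hy hz
  rw [memProg, run, run_seek hX hY hZ s h1 hx hy hz, run, run_setFlag _ _ { s with head := s.head + _ } h0,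
    run_rewind _ _ (by simpa [hh] using hle)]
  simp [Test.eval, hh]

open Classical in
-- Induction on the formula. Evaluation changes nothing but the flag, so subformulas can be
-- evaluated one after the other. For a quantifier the new variable is counted up until a witness is
-- found.
theorem run_prog {w : List Letter} (φ : Fm) {d : ℕ} (hd : 0 < d) {s : Store} (hs : Ready w d s) :
    (φ.prog d).run w s =
      { s with ctr := update s.ctr 0 (if φ.Sat w s.tape (env d s) then 1 else 0) } := by
  have hreg : ∀ x, 3 ≤ reg d x := fun x => Nat.le_add_right _ _
  induction φ generalizing d s with
  | plus x y z =>
    rw [prog, run_plusProg (hreg x) (hreg y) (hreg z) hs.flag hs.one hs.two (hs.reg_le hd x)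
      (hs.reg_le hd y) (hs.reg_le hd z)]
    simp only [Sat, env]
    congr
  | letter c x =>
    rw [prog, run_letterProg c (hreg x) hs.flag hs.one hs.pos (hs.reg_le hd x)]
    simp only [Sat, env]
    congr
  | sep x =>
    rw [prog, run_sepProg (hreg x) hs.flag hs.one hs.two hs.pos (hs.reg_le hd x)]
    simp only [Sat, env]
    congr
  | mem x y z =>
    rw [prog, run_memProg (hreg x) (hreg y) (hreg z) hs.flag hs.one hs.head (hs.reg_le hd x)
      (hs.reg_le hd y) (hs.reg_le hd z)]
    simp only [Sat, env]
    congr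
  | and φ ψ hφ hψ =>
    rw [prog, run, hφ hd hs hreg, run]
    by_cases h : φ.Sat w s.tape (env d s)
    · have hr := hs.setFlag (b := 1) le_rfl
      have he : env d { s with ctr := update s.ctr 0 1 } = env d s := by
        funext x; simp [env, reg]
      simp only [Test.eval, h, if_true, Sat, true_and, update_self]
      have := hψ hd hr hreg
      simp only [he, update_idem] at this
      exact this
    · simp [Test.eval, h, Sat]
  | not φ hφ =>
    rw [prog, run, hφ hd hs hreg, run]
    by_cases h : φ.Sat w s.tape (env d s) <;> simp [Test.eval, h, Sat, run, Act.run]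
  | ex φ hφ =>
    set Q : ℕ → Prop := fun a => φ.Sat w s.tape (scons a (env d s)) with hQ
    have hclear : ∀ t : Store, t = { s with ctr := t.ctr } → t.ctr (3 + d) ≤ w.length →
        (clear (3 + d)).run w t = { s with ctr := update t.ctr (3 + d) 0 } := by
      intro t ht hle
      rw [run_clear, Nat.sub_eq_zero_of_le hle]
      conv_lhs => rw [ht]
    -- `g j` is the value of the quantified variable after `j` passes: the least witness below `j`
    -- if there is one, and `j` otherwise.
    obtain ⟨g, hg0, hg, hgf⟩ : ∃ g : ℕ → ℕ, g 0 = 0 ∧ (∀ j, g j ≤ j) ∧ ∀ j, (if ∃ a < j, Q a then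
        Q (g j) ∧ g (j + 1) = g j else g j = j ∧ g (j + 1) = if Q j then j else j + 1) := by
      refine ⟨fun j => if h : ∃ a < j, Q a then Nat.find h else j, by simp, fun j => ?_, fun j => ?_⟩
      · dsimp only
        split_ifs with h
        · exact (Nat.find_spec h).1.le
        · exact le_rfl
      · by_cases h : ∃ a < j, Q a
        · have h' : ∃ a < j + 1, Q a := h.imp fun a ha => ⟨by omega, ha.2⟩
          dsimp only
          rw [if_pos h, dif_pos h, dif_pos h']
          refine ⟨(Nat.find_spec h).2, ?_⟩
          refine (Nat.find_eq_iff h').2 ⟨⟨by have := (Nat.find_spec h).1; omega,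
            (Nat.find_spec h).2⟩, fun a ha hc => Nat.find_min h ha ⟨?_, hc.2⟩⟩
          have := (Nat.find_spec h).1; omega
        · dsimp only
          rw [if_neg h, dif_neg h]
          refine ⟨rfl, ?_⟩
          by_cases hj : Q j
          · have h' : ∃ a < j + 1, Q a := ⟨j, by omega, hj⟩
            rw [dif_pos h', if_pos hj]
            exact (Nat.find_eq_iff h').2 ⟨⟨by omega, hj⟩, fun a ha hc => h ⟨a, ha, hc.2⟩⟩
          · rw [if_neg hj, dif_neg]
            rintro ⟨a, ha, hc⟩
            rcases Nat.lt_succ_iff_lt_or_eq.1 ha with h1 | rfl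
            · exact h ⟨a, h1, hc⟩
            · exact hj hc
    have h3 : (3 + d) ≠ 0 := by omega
    have hrep := run_rep (w := w) (p := ite (.zero 0)
      (seq (φ.prog (d + 1)) (ite (.zero 0) (act (.inc (3 + d))) skip)) skip)
      (fun j => { s with
        ctr := update (update s.ctr 0 (if ∃ a < j, Q a then 1 else 0)) (3 + d) (g j) })
      (fun j hj => by
        have hgj := hgf j
        by_cases h : ∃ a < j, Q a
        · have h' : ∃ a < j + 1, Q a := h.imp fun a ha => ⟨by omega, ha.2⟩
          rw [if_pos h] at hgj
          rw [run, if_neg, run_skip, if_pos h, if_pos h', hgj.2]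
          simp [Test.eval, h, update_of_ne h3.symm]
        · rw [if_neg h] at hgj
          rw [run, if_pos (by simp [Test.eval, h, update_of_ne h3.symm]), if_neg h, hgj.1, hgj.2]
          have hr : Ready w (d + 1) { s with ctr := update (update s.ctr 0 0) (3 + d) j } := by
            refine ⟨hs.pos, hs.head, by simp [update_of_ne h3.symm], ?_, ?_, fun i hi => ?_,
              fun i hi => ?_⟩
            · simpa [update_apply, show 1 ≠ 3 + d by omega] using hs.one
            · simpa [update_apply, show 2 ≠ 3 + d by omega] using hs.two
            · by_cases hid : i = d
              · simpa [hid] using hj.le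
              · simpa [update_apply, hid] using hs.le i (by omega)
            · simpa [update_apply, show i ≠ d by omega] using hs.zero i (by omega)
          have he : env (d + 1) { s with ctr := update (update s.ctr 0 0) (3 + d) j } =
              scons j (env d s) := by
            funext x
            cases x with
            | zero => simp [env, reg]
            | succ x =>
              have h1 : reg (d + 1) (x + 1) = reg d x := by simp only [reg]; omega
              have h2 : reg d x ≠ 3 + d := by simp only [reg]; omega
              have h3 : reg d x ≠ 0 := by simp only [reg]; omega
              simp [env, h1, h2, h3]
          rw [run, hφ (by omega) hr (fun x => Nat.le_add_right _ _), he]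
          -- No witness has been found below `j`, so the flag now depends on `j` alone.
          have hiff : (∃ a < j + 1, Q a) ↔ Q j := by
            refine ⟨?_, fun hc => ⟨j, by omega, hc⟩⟩
            rintro ⟨a, ha, hc⟩
            rcases Nat.lt_succ_iff_lt_or_eq.1 ha with h1 | rfl
            · exact (h ⟨a, h1, hc⟩).elim
            · exact hc
          change (ite (.zero 0) (act (.inc (3 + d))) skip).run w
            { s with ctr := update (update (update s.ctr 0 0) (3 + d) j) 0 (if Q j then 1 else 0) } =
            _
          simp only [hiff]
          by_cases hQj : Q j
          · simp only [hQj, if_true, run, Test.eval, update_self, beq_iff_eq, one_ne_zero, if_false,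
              run_skip]
            congr 1
            funext r
            simp only [update_apply]
            split_ifs <;> omega
          · simp only [hQj, if_false, run, Test.eval, update_self, beq_iff_eq, if_true, Act.run]
            congr 1
            funext r
            simp only [update_apply]
            split_ifs <;> omega)
    refine (congrArg (fun t => (clear (3 + d)).run w t)
      ((congrArg (fun t => (rep _).run w t) ?_).trans hrep)).trans ?_
    · rw [hg0, if_neg (by simp)]
      have hz := hs.zero d le_rfl
      have hf := hs.flag
      simp only [run, Act.run]
      congr 1
      funext r
      simp only [update_apply]
      split_ifs <;> first | omega | contradiction | (subst_vars; omega)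
    rw [hclear _ rfl (by simpa using hg _)]
    have hz := hs.zero d le_rfl
    have : Sat w s.tape (ex φ) (env d s) ↔ ∃ a < w.length, Q a := Iff.rfl
    simp only [this]
    congr 1
    funext r
    simp only [update_apply]
    split_ifs <;> first | omega | contradiction | (subst_vars; omega)

end Fm

/-! ### A library of formulas -/

/-- Whether words `p` and `q` followed by a separator start at two positions and are equal. -/
def SameWord (w : List Letter) (p q : ℕ) : Prop :=
  ∃ d, w[p + d]? = some none ∧ w[q + d]? = some none ∧
    ∀ e < d, ∃ b : Bool, w[p + e]? = some (some b) ∧ w[q + e]? = some (some b)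

/-- Whether `q` is the position following the first separator from `p` on. -/
def Next (w : List Letter) (p q : ℕ) : Prop :=
  ∃ d, w[p + d]? = some none ∧ (∀ e < d, w[p + e]? ≠ some none) ∧ p + d + 1 = q

/-- Whether a listed fact starts at position `p`. -/
def Start (w : List Letter) (p : ℕ) : Prop :=
  (w.take p).count none % 3 = 0 ∧ (p = 0 ∨ ∃ q, q + 1 = p ∧ w[q]? = some none)

/-- Whether the facts at `p` and `q` are equal up to a cyclic shift. -/
def SameOrbitAt (w : List Letter) (p q : ℕ) : Prop :=
  ∃ p₁ p₂ q₁ q₂ : Fin w.length, Next w p p₁ ∧ Next w p₁ p₂ ∧ Next w q q₁ ∧ Next w q₁ q₂ ∧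
    (SameWord w p q ∧ SameWord w p₁ q₁ ∧ SameWord w p₂ q₂ ∨
      SameWord w p q₁ ∧ SameWord w p₁ q₂ ∧ SameWord w p₂ q ∨
      SameWord w p q₂ ∧ SameWord w p₁ q ∧ SameWord w p₂ q₁)

/-- Whether the three entries of the fact at `p` are equal. -/
def LoopAt (w : List Letter) (p : ℕ) : Prop :=
  ∃ p₁ p₂ : Fin w.length, Next w p p₁ ∧ Next w p₁ p₂ ∧ SameWord w p p₁ ∧ SameWord w p p₂

/-- Whether the first listed fact of some block starts at `i`. -/
def Bidder (w : List Letter) (i : Fin w.length) : Prop :=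
  Start w i ∧ ∀ i' : Fin w.length, i' < i → Start w i' → ¬ SameWord w i' i

/-- Whether the first listed fact of some orbit starts at `j`. -/
def Object (w : List Letter) (j : Fin w.length) : Prop :=
  Start w j ∧ ∀ j' : Fin w.length, j' < j → Start w j' → ¬ SameOrbitAt w j' j

/-- Whether `i` represents a block and `j` an orbit and they share a fact that is no loop. -/
def Edge (w : List Letter) (i j : Fin w.length) : Prop :=
  Bidder w i ∧ Object w j ∧
    ∃ k : Fin w.length, Start w k ∧ ¬ LoopAt w k ∧ SameWord w i k ∧ SameOrbitAt w j k

namespace Fm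

/-- Satisfaction under an assignment of positions. -/
def Holds (w : List Letter) (tape : ℕ → Bool) (φ : Fm) (v : ℕ → Fin w.length) : Prop :=
  φ.Sat w tape fun i => (v i : ℕ)

section Holds

variable {w : List Letter} {tape : ℕ → Bool} {v : ℕ → Fin w.length}

theorem scons_coe (a : Fin w.length) :
    (fun i => ((scons a v i : Fin w.length) : ℕ)) = scons (a : ℕ) fun i => (v i : ℕ) := by
  funext i
  cases i <;> rfl

theorem holds_plus {x y z : ℕ} : (plus x y z).Holds w tape v ↔ (v x + v y : ℕ) = v z := Iff.rfl

theorem holds_letter {c : Letter} {x : ℕ} :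
    (letter c x).Holds w tape v ↔ w[(v x : ℕ)]? = some c := Iff.rfl

theorem holds_sep {x : ℕ} :
    (sep x).Holds w tape v ↔ (w.take (v x)).count none % 3 = 0 := Iff.rfl

theorem holds_mem {x y z : ℕ} :
    (mem x y z).Holds w tape v ↔ tape (address w.length (v x) (v y) (v z)) = true := Iff.rfl

theorem holds_and {φ ψ : Fm} :
    (and φ ψ).Holds w tape v ↔ φ.Holds w tape v ∧ ψ.Holds w tape v := Iff.rfl

theorem holds_not {φ : Fm} : (not φ).Holds w tape v ↔ ¬ φ.Holds w tape v := Iff.rfl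

theorem holds_ex {φ : Fm} : (ex φ).Holds w tape v ↔ ∃ a, φ.Holds w tape (scons a v) := by
  simp only [Holds, Sat, scons_coe]
  exact ⟨fun ⟨a, ha, h⟩ => ⟨⟨a, ha⟩, h⟩, fun ⟨a, h⟩ => ⟨a, a.2, h⟩⟩

def or (φ ψ : Fm) : Fm := not (and (not φ) (not ψ))
def imp (φ ψ : Fm) : Fm := not (and φ (not ψ))
def all (φ : Fm) : Fm := not (ex (not φ))

theorem holds_or {φ ψ : Fm} :
    (or φ ψ).Holds w tape v ↔ φ.Holds w tape v ∨ ψ.Holds w tape v := by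
  rw [or, holds_not, holds_and, holds_not, holds_not]; tauto

theorem holds_imp {φ ψ : Fm} :
    (imp φ ψ).Holds w tape v ↔ (φ.Holds w tape v → ψ.Holds w tape v) := by
  rw [imp, holds_not, holds_and, holds_not]; tauto

theorem holds_all {φ : Fm} : (all φ).Holds w tape v ↔ ∀ a, φ.Holds w tape (scons a v) := by
  simp [all, holds_not, holds_ex]

/-- `x < y` -/
def lt (x y : ℕ) : Fm := ex (and (not (plus 0 0 0)) (plus (x + 1) 0 (y + 1)))

theorem holds_lt {x y : ℕ} : (lt x y).Holds w tape v ↔ v x < v y := by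
  simp only [lt, holds_ex, holds_and, holds_not, holds_plus, scons_zero, scons_succ, Fin.lt_def]
  constructor
  · rintro ⟨a, h⟩
    omega
  · intro h
    have := (v y).2
    exact ⟨⟨v y - v x, by omega⟩, by simp only; omega, by simp only; omega⟩

/-- `x + 1 = y` -/
def succ (x y : ℕ) : Fm := and (lt x y) (not (ex (and (lt (x + 1) 0) (lt 0 (y + 1)))))

theorem holds_succ {x y : ℕ} : (succ x y).Holds w tape v ↔ (v x + 1 : ℕ) = v y := by
  simp only [succ, holds_ex, holds_and, holds_not, holds_lt, scons_zero, scons_succ, Fin.lt_def]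
  constructor
  · rintro ⟨h, h'⟩
    by_contra hne
    have := (v y).2
    exact h' ⟨⟨v x + 1, by omega⟩, by simp only; omega, by simp only; omega⟩
  · intro h
    exact ⟨by omega, fun ⟨a, ha⟩ => by omega⟩

/-- a letter at position `x + y` -/
def letterAt (c : Letter) (x y : ℕ) : Fm := ex (and (plus (x + 1) (y + 1) 0) (letter c 0))

theorem holds_letterAt {c : Letter} {x y : ℕ} :
    (letterAt c x y).Holds w tape v ↔ w[(v x + v y : ℕ)]? = some c := by
  simp only [letterAt, holds_ex, holds_and, holds_plus, holds_letter, scons_zero, scons_succ]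
  constructor
  · rintro ⟨a, h, h'⟩
    rwa [h]
  · intro h
    obtain ⟨h', -⟩ := List.getElem?_eq_some_iff.1 h
    exact ⟨⟨_, h'⟩, rfl, h⟩

def sameWord (x y : ℕ) : Fm :=
  ex (and (letterAt none (x + 1) 0) (and (letterAt none (y + 1) 0) (all (imp (lt 0 1)
    (or (and (letterAt (some true) (x + 2) 0) (letterAt (some true) (y + 2) 0))
      (and (letterAt (some false) (x + 2) 0) (letterAt (some false) (y + 2) 0)))))))

/-- Offsets to letters of the word are themselves positions, so the quantifiers of formulas, which
range over positions, reach all the offsets required. -/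
theorem lt_of_getElem? {p d : ℕ} {c : Letter} (h : w[p + d]? = some c) : d < w.length := by
  obtain ⟨h', -⟩ := List.getElem?_eq_some_iff.1 h
  omega

theorem holds_sameWord {x y : ℕ} :
    (sameWord x y).Holds w tape v ↔ SameWord w (v x) (v y) := by
  simp only [sameWord, holds_ex, holds_and, holds_all, holds_imp, holds_or, holds_lt,
    holds_letterAt, scons_zero, scons_succ, SameWord, Bool.exists_bool, Fin.lt_def]
  constructor
  · rintro ⟨d, h1, h2, h3⟩
    exact ⟨d, h1, h2, fun e he => (h3 ⟨e, he.trans d.2⟩ he).symm⟩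
  · rintro ⟨d, h1, h2, h3⟩
    exact ⟨⟨d, lt_of_getElem? h1⟩, h1, h2, fun e he => (h3 e he).symm⟩

def next (x y : ℕ) : Fm :=
  ex (and (letterAt none (x + 1) 0) (and (all (imp (lt 0 1) (not (letterAt none (x + 2) 0))))
    (ex (and (plus (x + 2) 1 0) (succ 0 (y + 2))))))

theorem holds_next {x y : ℕ} : (next x y).Holds w tape v ↔ Next w (v x) (v y) := by
  simp only [next, holds_ex, holds_and, holds_all, holds_imp, holds_not, holds_lt, holds_plus,
    holds_succ, holds_letterAt, scons_zero, scons_succ, Next, Fin.lt_def]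
  constructor
  · rintro ⟨d, h1, h2, a, h3, h4⟩
    exact ⟨d, h1, fun e he => h2 ⟨e, he.trans d.2⟩ he, by omega⟩
  · rintro ⟨d, h1, h2, h3⟩
    have := (v y).2
    exact ⟨⟨d, lt_of_getElem? h1⟩, h1, fun e he => h2 e he, ⟨v x + d, by omega⟩, rfl, h3⟩

/-- `plus x x x` expresses that `x` is zero. -/
def start (x : ℕ) : Fm := and (sep x) (or (plus x x x) (ex (and (succ 0 (x + 1)) (letter none 0))))

theorem holds_start {x : ℕ} : (start x).Holds w tape v ↔ Start w (v x) := by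
  simp only [start, holds_ex, holds_and, holds_or, holds_sep, holds_plus, holds_succ, holds_letter,
    scons_zero, scons_succ, Start]
  refine and_congr_right fun _ => or_congr (by omega) ⟨fun ⟨q, h⟩ => ⟨q, h⟩, fun ⟨q, h, h'⟩ => ?_⟩
  have := (v x).2
  exact ⟨⟨q, by omega⟩, h, h'⟩

def sameOrbit (x y : ℕ) : Fm :=
  ex (ex (ex (ex (and (next (x + 4) 3) (and (next 3 2) (and (next (y + 4) 1) (and (next 1 0)
    (or (and (sameWord (x + 4) (y + 4)) (and (sameWord 3 1) (sameWord 2 0)))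
    (or (and (sameWord (x + 4) 1) (and (sameWord 3 0) (sameWord 2 (y + 4))))
      (and (sameWord (x + 4) 0) (and (sameWord 3 (y + 4)) (sameWord 2 1))))))))))))

theorem scons_two {α : Type} (a b c : α) (v : ℕ → α) : scons a (scons b (scons c v)) 2 = c := rfl
theorem scons_one {α : Type} (a b : α) (v : ℕ → α) : scons a (scons b v) 1 = b := rfl
theorem scons_three {α : Type} (a b c d : α) (v : ℕ → α) :
    scons a (scons b (scons c (scons d v))) 3 = d := rfl
theorem scons_add_two {α : Type} (a b : α) (v : ℕ → α) (x : ℕ) :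
    scons a (scons b v) (x + 2) = v x := rfl
theorem scons_add_four {α : Type} (a b c d : α) (v : ℕ → α) (x : ℕ) :
    scons a (scons b (scons c (scons d v))) (x + 4) = v x := rfl

theorem holds_sameOrbit {x y : ℕ} :
    (sameOrbit x y).Holds w tape v ↔ SameOrbitAt w (v x) (v y) := by
  simp only [sameOrbit, holds_ex, holds_and, holds_or, holds_next, holds_sameWord, scons_zero,
    scons_one, scons_two, scons_three, scons_add_four, SameOrbitAt]

def loop (x : ℕ) : Fm :=
  ex (ex (and (next (x + 2) 1) (and (next 1 0) (and (sameWord (x + 2) 1) (sameWord (x + 2) 0)))))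

theorem holds_loop {x : ℕ} : (loop x).Holds w tape v ↔ LoopAt w (v x) := by
  simp only [loop, holds_ex, holds_and, holds_next, holds_sameWord, scons_zero, scons_one,
    scons_add_two, LoopAt]

def bidder (x : ℕ) : Fm :=
  and (start x) (all (imp (lt 0 (x + 1)) (imp (start 0) (not (sameWord 0 (x + 1))))))

theorem holds_bidder {x : ℕ} : (bidder x).Holds w tape v ↔ Bidder w (v x) := by
  simp only [bidder, holds_and, holds_all, holds_imp, holds_not, holds_lt, holds_start,
    holds_sameWord, scons_zero, scons_succ, Bidder]

def object (x : ℕ) : Fm :=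
  and (start x) (all (imp (lt 0 (x + 1)) (imp (start 0) (not (sameOrbit 0 (x + 1))))))

theorem holds_object {x : ℕ} : (object x).Holds w tape v ↔ Object w (v x) := by
  simp only [object, holds_and, holds_all, holds_imp, holds_not, holds_lt, holds_start,
    holds_sameOrbit, scons_zero, scons_succ, Object]

def edge (x y : ℕ) : Fm :=
  and (bidder x) (and (object y) (ex (and (start 0) (and (not (loop 0))
    (and (sameWord (x + 1) 0) (sameOrbit (y + 1) 0))))))

theorem holds_edge {x y : ℕ} : (edge x y).Holds w tape v ↔ Edge w (v x) (v y) := by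
  simp only [edge, holds_and, holds_ex, holds_not, holds_start, holds_bidder, holds_object,
    holds_loop, holds_sameWord, holds_sameOrbit, scons_zero, scons_succ, Edge]

end Holds

/-- The formula does not refer to the tape. -/
def NoMem : Fm → Prop
  | plus _ _ _ | letter _ _ | sep _ => True
  | mem _ _ _ => False
  | and φ ψ => φ.NoMem ∧ ψ.NoMem
  | not φ => φ.NoMem
  | ex φ => φ.NoMem

theorem noMem_edge (x y : ℕ) : (edge x y).NoMem := by
  simp [edge, bidder, object, start, loop, sameWord, sameOrbit, next, letterAt, succ, lt, all, imp,
    or, NoMem]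

theorem noMem_bidder (x : ℕ) : (bidder x).NoMem := (noMem_edge x 0).1

theorem noTape_prog {φ : Fm} (h : φ.NoMem) (d : ℕ) : (φ.prog d).NoTape := by
  induction φ generalizing d with
  | plus x y z => simp [prog, plusProg, addTo, Prog.for', Prog.clear, Prog.setFlag, Prog.skip,
      Prog.NoTape]
  | letter c x => simp [prog, letterProg, Prog.for', Prog.setFlag, Prog.skip, Prog.NoTape]
  | sep x => simp [prog, sepProg, rotate, Prog.for', Prog.setFlag, Prog.skip, Prog.NoTape]
  | mem x y z => exact h.elim
  | and φ ψ hφ hψ => simp [prog, Prog.NoTape, hφ h.1, hψ h.2, Prog.skip]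
  | not φ hφ => simp [prog, Prog.NoTape, hφ h]
  | ex φ hφ => simp [prog, Prog.NoTape, hφ h, Prog.skip, Prog.clear]

end Fm

/-! ### Loops over the positions of the input -/

/-- Performing `f a` for all `a` in turn. -/
def iterFin {α : Type} (n : ℕ) (f : Fin n → α → α) (x : α) : α :=
  (List.finRange n).foldl (fun x a => f a x) x

theorem iterFin_append {β : Type} (n : ℕ) (f : Fin n → List β) (o : List β) :
    iterFin n (fun a o => o ++ f a) o = o ++ (List.ofFn f).flatten := by
  have : ∀ l : List (Fin n), ∀ o : List β,
      l.foldl (fun x a => x ++ f a) o = o ++ (l.map f).flatten := by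
    intro l
    induction l with
    | nil => simp
    | cons a l ih => intro o; simp [ih]
  rw [iterFin, this, List.ofFn_eq_map]

namespace Prog

/-- Executing `p` with all positions of the input as values of counter `r`. -/
def forEach (r : ℕ) (p : Prog) : Prog := seq (rep (seq p (act (.inc r)))) (clear r)

/-- `mk` splits the memory into the counters and the part `x` on which the loop works. Counter `r`
runs through all positions and ends at the length of the word, from where `clear` takes it back to
zero. -/
theorem run_forEach {w : List Letter} {α : Type} {r : ℕ} {p : Prog} (mk : (ℕ → ℕ) → α → Store)
    (hctr : ∀ c x, (mk c x).ctr = c) (hmk : ∀ c c' x, { mk c x with ctr := c' } = mk c' x)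
    {c : ℕ → ℕ} (hc : c r = 0) (f : Fin w.length → α → α)
    (hp : ∀ (a : Fin w.length) x,
      p.run w (mk (update c r a) x) = mk (update c r a) (f a x)) (x : α) :
    (forEach r p).run w (mk c x) = mk c (iterFin w.length f x) := by
  set g : ℕ → α := fun i => ((List.finRange w.length).take i).foldl (fun x a => f a x) x with hg
  have h := run_rep (w := w) (p := seq p (act (.inc r))) (fun i => mk (update c r i) (g i))
    (fun i hi => by
      have hgi : g (i + 1) = f ⟨i, hi⟩ (g i) := by
        simp only [hg]
        rw [List.take_succ_eq_append_getElem (by simpa using hi), List.foldl_append]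
        simp
      rw [run, hp ⟨i, hi⟩, run, Act.run, hctr, hmk, hgi]
      simp)
  have h0 : update c r 0 = c := by rw [← hc, update_eq_self]
  have hgn : g w.length = iterFin w.length f x := by
    simp only [hg, iterFin]
    rw [List.take_of_length_le (by simp)]
  simp only [h0, hgn, show g 0 = x from rfl] at h
  rw [forEach, run, h, run_clear, hctr, hmk]
  simp [h0]

end Prog

/-! ### Writing the bipartite graph -/

/-- The truth value of a proposition. -/
noncomputable def truth (P : Prop) : Bool := open Classical in decide P

/-- The bipartite graph of blocks and orbits on the positions of a word. A position that does not
represent a block is matched to a vertex of its own. -/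
noncomputable def graphOf (w : List Letter) : BipartiteGraph where
  m := w.length
  n := w.length + w.length
  adj i := Fin.append (fun j => truth (Edge w i j))
    (fun j => truth (i = j ∧ ¬ Bidder w i))

/-- The form in which the program produces the matrix: each row by two loops over all positions,
letter by letter. -/
theorem encodeGraph_graphOf (w : List Letter) :
    encodeGraph (graphOf w) = List.replicate w.length (some true) ++ [none] ++
      List.replicate (w.length + w.length) (some true) ++ [none] ++
      (List.ofFn fun i : Fin w.length => (List.ofFn fun j => [some (truth (Edge w i j))]).flatten ++
        (List.ofFn fun j => [some (truth (i = j ∧ ¬ Bidder w i))]).flatten).flatten := by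
  have h : ∀ {n : ℕ} (f : Fin n → Letter), (List.ofFn fun j => [f j]).flatten = List.ofFn f := by
    intro n f
    rw [List.ofFn_eq_map, List.ofFn_eq_map]
    induction List.finRange n with
    | nil => rfl
    | cons a l ih => simp [ih]
  have h2 : ∀ i, (List.ofFn ((graphOf w).adj i)).map some =
      (List.ofFn fun j => some (truth (Edge w i j))) ++
        List.ofFn fun j => some (truth (i = j ∧ ¬ Bidder w i)) := by
    intro i
    rw [List.map_ofFn]
    refine Eq.trans (List.ofFn_add (n := w.length) (m := w.length)
      (f := fun j => some ((graphOf w).adj i j))) ?_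
    congr 2
    · exact funext fun j => congrArg some
        (Fin.append_left (fun j => truth (Edge w i j)) (fun j => truth (i = j ∧ ¬ Bidder w i)) j)
    · exact funext fun j => congrArg some
        (Fin.append_right (fun j => truth (Edge w i j)) (fun j => truth (i = j ∧ ¬ Bidder w i)) j)
  simp only [encodeGraph, h, h2]
  rfl

namespace Fm

open Prog

/-- The store with given counters and output. -/
def outStore (c : ℕ → ℕ) (o : List Letter) : Store := ⟨c, 0, fun _ => false, 0, o⟩

/-- Writing the truth value of a formula. -/
def bit (d : ℕ) (φ : Fm) : Prog :=
  seq (φ.prog d) (ite (.zero 0) (act (.emit (some false)))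
    (seq (act (.dec 0)) (act (.emit (some true)))))

/-- Counters with loop variables `l` and otherwise zero. -/
def loopCtr (l : List ℕ) (r : ℕ) : ℕ := if r < 3 then 0 else l.getD (r - 3) 0

theorem update_loopCtr (l : List ℕ) (a : ℕ) :
    update (loopCtr l) (3 + l.length) a = loopCtr (l ++ [a]) := by
  funext r
  rw [update_apply]
  split_ifs with h
  · simp [h, loopCtr]
  · simp only [loopCtr]
    split_ifs with h'
    · rfl
    · rcases Nat.lt_or_ge (r - 3) l.length with h1 | h1
      · simp [List.getD_eq_getElem?_getD, List.getElem?_append_left h1]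
      · rw [List.getD_eq_default _ _ h1, List.getD_eq_default _ _ (by simp; omega)]

theorem loopCtr_nil : loopCtr [] = fun _ => 0 := by
  funext r
  simp [loopCtr]

theorem ready_loopCtr {w : List Letter} {l : List ℕ} (hl : ∀ a ∈ l, a ≤ w.length) (t : ℕ → Bool)
    (o : List Letter) : Ready w l.length ⟨loopCtr l, 0, t, 0, o⟩ := by
  refine ⟨rfl, rfl, by simp [loopCtr], by simp [loopCtr], by simp [loopCtr], fun i hi => ?_,
    fun i hi => ?_⟩
  · simpa [loopCtr, hi] using hl _ (List.getElem_mem hi)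
  · simp [loopCtr, hi]

open Classical in
theorem run_bit {w : List Letter} (φ : Fm) {l : List ℕ} (hl : ∀ a ∈ l, a ≤ w.length) (hn : l ≠ [])
    {v : ℕ → Fin w.length} (hv : ∀ x, loopCtr l (reg l.length x) = v x) {P : Prop}
    (hP : φ.Holds w (fun _ => false) v ↔ P) (o : List Letter) :
    (bit l.length φ).run w (outStore (loopCtr l) o) =
      outStore (loopCtr l) (o ++ [some (truth P)]) := by
  have henv : env l.length (outStore (loopCtr l) o) = fun x => (v x : ℕ) := funext hv
  rw [bit, run, outStore, run_prog φ (List.length_pos_iff.2 hn) (ready_loopCtr hl _ _)]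
  change Prog.run w _ { outStore (loopCtr l) o with
    ctr := update (loopCtr l) 0
      (if φ.Sat w (fun _ => false) (env l.length (outStore (loopCtr l) o)) then 1 else 0) } = _
  rw [henv]
  change Prog.run w _ { outStore (loopCtr l) o with
    ctr := update (loopCtr l) 0 (if φ.Holds w (fun _ => false) v then 1 else 0) } = _
  have h0 : update (loopCtr l) 0 0 = loopCtr l := update_eq_self_iff.2 (by simp [loopCtr])
  by_cases h : P <;> simp [truth, hP, h, run, Test.eval, Act.run, outStore, h0]

end Fm

/-- The formula saying that `x` is equal to `y` and does not represent a block. -/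
def Fm.spare (x y : ℕ) : Fm :=
  .and (.and (.not (.lt x y)) (.not (.lt y x))) (.not (.bidder x))

theorem Fm.holds_spare {w : List Letter} {tape : ℕ → Bool} {v : ℕ → Fin w.length} {x y : ℕ} :
    (Fm.spare x y).Holds w tape v ↔ v x = v y ∧ ¬ Bidder w (v x) := by
  simp only [spare, holds_and, holds_not, holds_lt, holds_bidder, not_lt, and_congr_left_iff]
  exact fun _ => ⟨fun h => le_antisymm h.2 h.1, fun h => ⟨h.ge, h.le⟩⟩

/-- The program writing the bipartite graph. -/
def graphProg : Prog :=
  .seq (.rep (.act (.emit (some true)))) (.seq (.act (.emit none))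
    (.seq (.rep (.seq (.act (.emit (some true))) (.act (.emit (some true)))))
      (.seq (.act (.emit none)) (.forEach 3 (.seq (.forEach 4 (Fm.bit 2 (.edge 1 0)))
        (.forEach 4 (Fm.bit 2 (.spare 1 0))))))))

theorem noTape_graphProg : graphProg.NoTape := by
  have h1 := Fm.noTape_prog (Fm.noMem_edge 1 0) 2
  have h2 : (Fm.spare 1 0).NoMem := by
    simp [Fm.spare, Fm.NoMem, Fm.noMem_bidder, Fm.lt]
  simp [graphProg, Prog.NoTape, Prog.forEach, Prog.clear, Fm.bit, h1, Fm.noTape_prog h2]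

theorem run_graphProg (w : List Letter) :
    (graphProg.run w Store.zero).out = encodeGraph (graphOf w) := by
  classical
  have hrow : ∀ (i : Fin w.length) (φ : Fm) (P : Fin w.length → Prop),
      (∀ j, φ.Holds w (fun _ => false) (scons j fun _ => i) ↔ P j) → ∀ o,
      (Prog.forEach 4 (Fm.bit 2 φ)).run w (Fm.outStore (Fm.loopCtr [(i : ℕ)]) o) =
        Fm.outStore (Fm.loopCtr [(i : ℕ)])
          (o ++ (List.ofFn fun j => [some (truth (P j))]).flatten) := by
    intro i φ P hP o
    rw [Prog.run_forEach Fm.outStore (fun _ _ => rfl) (fun _ _ _ => rfl) rfl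
      (fun j o => o ++ [some (truth (P j))]) (fun j o => ?_), iterFin_append]
    have h := Fm.update_loopCtr [(i : ℕ)] j
    change update _ 4 _ = _ at h
    rw [h]
    refine Fm.run_bit (l := [(i : ℕ), (j : ℕ)]) φ ?_ (by simp) (v := scons j fun _ => i) ?_ (hP j) o
    · simp [i.2.le, j.2.le]
    · rintro (_ | x)
      · simp [Fm.loopCtr, Fm.reg]
      · simp [Fm.loopCtr, Fm.reg]
  have hall : ∀ o, (Prog.forEach 3 (.seq (.forEach 4 (Fm.bit 2 (.edge 1 0)))
      (.forEach 4 (Fm.bit 2 (.spare 1 0))))).run w (Fm.outStore (Fm.loopCtr []) o) =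
      Fm.outStore (Fm.loopCtr []) (o ++ (List.ofFn fun i : Fin w.length =>
        (List.ofFn fun j => [some (truth (Edge w i j))]).flatten ++
        (List.ofFn fun j => [some (truth (i = j ∧ ¬ Bidder w i))]).flatten).flatten) := by
    intro o
    rw [Prog.run_forEach Fm.outStore (fun _ _ => rfl) (fun _ _ _ => rfl) rfl
      (fun i o => o ++ ((List.ofFn fun j => [some (truth (Edge w i j))]).flatten ++
        (List.ofFn fun j => [some (truth (i = j ∧ ¬ Bidder w i))]).flatten))
      (fun i o => ?_), iterFin_append]
    have h := Fm.update_loopCtr [] i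
    change update _ 3 _ = _ at h
    rw [h, List.nil_append, Prog.run, hrow i _ (fun j => Edge w i j) fun j => Fm.holds_edge,
      hrow i _ (fun j => i = j ∧ ¬ Bidder w i) fun j => Fm.holds_spare, List.append_assoc]
  have hone := fun o => Prog.run_rep (w := w) (p := .act (.emit (some true)))
    (fun i => Fm.outStore (Fm.loopCtr []) (o ++ List.replicate i (some true)))
    (fun i _ => by simp [Prog.run, Act.run, Fm.outStore, List.replicate_succ'])
  have htwo := fun o => Prog.run_rep (w := w)
    (p := .seq (.act (.emit (some true))) (.act (.emit (some true))))
    (fun i => Fm.outStore (Fm.loopCtr []) (o ++ List.replicate (i + i) (some true)))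
    (fun i _ => by
      rw [show i + 1 + (i + 1) = i + i + 1 + 1 by omega]
      simp [Prog.run, Act.run, Fm.outStore, List.replicate_succ'])
  have hz : Store.zero = Fm.outStore (Fm.loopCtr []) [] := by
    rw [Fm.loopCtr_nil]; rfl
  have hnone : ∀ o, (Prog.act (.emit none)).run w (Fm.outStore (Fm.loopCtr []) o) =
    Fm.outStore (Fm.loopCtr []) (o ++ [none]) := fun o => rfl
  simp only [List.replicate_zero, List.append_nil, Nat.add_zero] at hone htwo
  rw [graphProg, hz, Prog.run, hone, Prog.run.eq_2, hnone, Prog.run.eq_2, htwo, Prog.run.eq_2, hnone,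
    hall, encodeGraph_graphOf]
  rfl

/-! ### An auction for saturating matchings

Bidders compete for objects, the prices of which are natural numbers. A triple `(k, j, i)` records
that the bidder `i` has offered the price `k` for the object `j`. A bidder who holds no object offers
the current price of an object that is among the cheapest that are acceptable to him. -/

/-- The offers made. -/
abbrev Offers (n : ℕ) := Finset (Fin n × Fin n × Fin n)

section Auction

variable {n : ℕ} {E : Fin n → Fin n → Prop} {S : Offers n}

/-- The price `k` has been offered for the object `j`. -/
def Used (S : Offers n) (k j : Fin n) : Prop := ∃ i, (k, j, i) ∈ S

/-- An offer `k` for `j` has been topped. -/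
def Topped (S : Offers n) (k j : Fin n) : Prop := ∃ k' : Fin n, (k + 1 : ℕ) = k' ∧ Used S k' j

/-- The bidder holds no object. -/
def Unassigned (S : Offers n) (i : Fin n) : Prop := ∀ k j, (k, j, i) ∈ S → Topped S k j

/-- The offers that may be made. -/
def Bid (E : Fin n → Fin n → Prop) (S : Offers n) (k j i : Fin n) : Prop :=
  E i j ∧ ¬ Used S k j ∧ Unassigned S i ∧ ∀ k' j', k' < k → E i j' → Used S k' j'

/-- The invariants of the auction. -/
structure Fair (E : Fin n → Fin n → Prop) (S : Offers n) : Prop where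
  edge : ∀ {k j i}, (k, j, i) ∈ S → E i j
  unique : ∀ {k j i i'}, (k, j, i) ∈ S → (k, j, i') ∈ S → i = i'
  below : ∀ {k j i k' j'}, (k, j, i) ∈ S → k' < k → E i j' → Used S k' j'
  owner : ∀ {k j k' j' i}, (k, j, i) ∈ S → ¬ Topped S k j → (k', j', i) ∈ S → ¬ Topped S k' j' →
    j = j'

theorem fair_empty : Fair E ∅ := ⟨by simp, by simp, by simp, by simp⟩

theorem Used.mono {S T : Offers n} (h : S ⊆ T) {k j : Fin n} (hu : Used S k j) : Used T k j :=
  hu.imp fun _ hi => h hi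

theorem Topped.mono {S T : Offers n} (h : S ⊆ T) {k j : Fin n} (hu : Topped S k j) :
    Topped T k j :=
  hu.imp fun _ hi => ⟨hi.1, hi.2.mono h⟩

/-- Each condition on a bid protects one invariant: acceptability gives `edge`, a fresh price gives
`unique`, and exhausted cheaper prices give `below`. As for `owner`, the earlier offers of an
unassigned bidder have been topped and remain so. -/
theorem Fair.insert (hS : Fair E S) {k j i : Fin n} (h : Bid E S k j i) :
    Fair E (insert (k, j, i) S) := by
  obtain ⟨h1, h2, h3, h4⟩ := h
  have hsub : S ⊆ Insert.insert (k, j, i) S := Finset.subset_insert _ _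
  refine ⟨fun {k' j' i'} h => ?_, fun {k' j' a b} ha hb => ?_, fun {k₁ j₁ i₁ k₂ j₂} h hlt hE => ?_,
    fun {k₁ j₁ k₂ j₂ i'} ha hta hb htb => ?_⟩
  · rcases Finset.mem_insert.1 h with h | h
    · simp only [Prod.mk.injEq] at h
      obtain ⟨-, rfl, rfl⟩ := h
      exact h1
    · exact hS.edge h
  · rw [Finset.mem_insert] at ha hb
    rcases ha with ha | ha <;> rcases hb with hb | hb
    · simp only [Prod.mk.injEq] at ha hb
      exact ha.2.2.trans hb.2.2.symm
    · simp only [Prod.mk.injEq] at ha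
      obtain ⟨rfl, rfl, rfl⟩ := ha
      exact (h2 ⟨_, hb⟩).elim
    · simp only [Prod.mk.injEq] at hb
      obtain ⟨rfl, rfl, rfl⟩ := hb
      exact (h2 ⟨_, ha⟩).elim
    · exact hS.unique ha hb
  · rcases Finset.mem_insert.1 h with h | h
    · simp only [Prod.mk.injEq] at h
      obtain ⟨rfl, rfl, rfl⟩ := h
      exact (h4 _ _ hlt hE).mono hsub
    · exact (hS.below h hlt hE).mono hsub
  · have hta' : ¬ Topped S k₁ j₁ := fun h => hta (h.mono hsub)
    have htb' : ¬ Topped S k₂ j₂ := fun h => htb (h.mono hsub)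
    rw [Finset.mem_insert] at ha hb
    rcases ha with ha | ha <;> rcases hb with hb | hb
    · simp only [Prod.mk.injEq] at ha hb
      exact ha.2.1.trans hb.2.1.symm
    · simp only [Prod.mk.injEq] at ha
      obtain ⟨rfl, rfl, rfl⟩ := ha
      exact (htb' (h3 _ _ hb)).elim
    · simp only [Prod.mk.injEq] at hb
      obtain ⟨rfl, rfl, rfl⟩ := hb
      exact (hta' (h3 _ _ ha)).elim
    · exact hS.owner ha hta' hb htb'

/-- By `below`, applied to the object itself, the prices offered for an object form an initial
segment, so an offer that is not topped is the highest. -/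
theorem Fair.le_of_not_topped (hS : Fair E S) {k l j : Fin n}
    (ht : ¬ Topped S k j) (hl : Used S l j) : l ≤ k := by
  by_contra hlt
  rw [not_le, Fin.lt_def] at hlt
  obtain ⟨i', hi'⟩ := hl
  by_cases he : (k + 1 : ℕ) = l
  · exact ht ⟨l, he, i', hi'⟩
  · have := l.2
    refine ht ⟨⟨k + 1, by omega⟩, rfl, hS.below hi' ?_ (hS.edge hi')⟩
    rw [Fin.lt_def]
    simp only
    omega

theorem Used.exists_not_topped {k j : Fin n} (h : Used S k j) :
    ∃ i l, (l, j, i) ∈ S ∧ ¬ Topped S l j := by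
  classical
  obtain ⟨l, hl, hmax⟩ := Finset.exists_max_image (Finset.univ.filter fun k => Used S k j) id
    ⟨k, by simpa using h⟩
  simp only [Finset.mem_filter, Finset.mem_univ, true_and, id] at hl hmax
  obtain ⟨i, hi⟩ := hl
  refine ⟨i, l, hi, ?_⟩
  rintro ⟨k', hk', hu⟩
  have := hmax k' hu
  rw [Fin.le_def] at this
  omega

/-- When no more offers can be made, there is an unassigned bidder only if there is no saturating
matching. -/
theorem Fair.unassigned_iff (hS : Fair E S) (hend : ∀ k j i, ¬ Bid E S k j i) {P : Fin n → Prop}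
    (hP : ∀ i j, E i j → P i) :
    (∃ i, P i ∧ Unassigned S i) ↔
      ¬ ∃ f : Fin n → Fin n, (∀ i, P i → E i (f i)) ∧ ∀ i i', P i → P i' → f i = f i' → i = i' := by
  constructor
  · rintro ⟨i₀, h₀, hu⟩ ⟨f, hf, hinj⟩
    -- An unassigned bidder could bid at the lowest free price among his acceptable objects, so at
    -- the end all their prices are used.
    have hall : ∀ m : ℕ, ∀ k j : Fin n, (k : ℕ) = m → E i₀ j → Used S k j := by
      intro m
      induction m using Nat.strong_induction_on with
      | _ m ih =>
        intro k j hk hE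
        by_contra hused
        exact hend k j i₀ ⟨hE, hused, hu, fun k' j' hlt hE' => ih k' (by omega) k' j' rfl hE'⟩
    choose! o ho using fun (j : Fin n) (h : ∃ k, Used S k j) =>
      let ⟨_, hk⟩ := h; hk.exists_not_topped
    -- The alternating chain: from a bidder to his object under `f`, and from there to the bidder
    -- who holds it in the auction.
    set c : ℕ → Fin n := fun t => (fun i => o (f i))^[t] i₀ with hc
    have hsucc : ∀ t, c (t + 1) = o (f (c t)) := fun t => iterate_succ_apply' _ _ _
    -- Along the chain prices drop by at most one per step: `c (t + 1)` has paid at least `n - 1 -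
    -- t`, and by `below` all smaller prices of the objects acceptable to him are used. With `n`
    -- prices the chain can make `n` steps.
    have hcP : ∀ t, t ≤ n → P (c t) ∧ ∀ j (k : Fin n), k + t < n → E (c t) j → Used S k j := by
      intro t
      induction t with
      | zero => exact fun _ => ⟨h₀, fun j k _ hE => hall k k j rfl hE⟩
      | succ t ih =>
        intro ht
        obtain ⟨hPt, hUt⟩ := ih (by omega)
        have hu1 : Used S ⟨n - 1 - t, by omega⟩ (f (c t)) :=
          hUt _ _ (by simp only; omega) (hf _ hPt)
        obtain ⟨l, hl, htop⟩ := ho _ ⟨_, hu1⟩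
        rw [hsucc]
        refine ⟨hP _ _ (hS.edge hl), fun j k hk hE => hS.below hl ?_ hE⟩
        have := hS.le_of_not_topped htop hu1
        rw [Fin.le_def] at this
        simp only at this
        rw [Fin.lt_def]
        omega
    have hown : ∀ t < n, ∃ l, (l, f (c t), c (t + 1)) ∈ S ∧ ¬ Topped S l (f (c t)) := by
      intro t ht
      obtain ⟨hPt, hUt⟩ := hcP t ht.le
      rw [hsucc]
      exact ho _ ⟨⟨0, by omega⟩, hUt _ _ (by simpa using ht) (hf _ hPt)⟩
    -- A repetition can be traced back along the chain, since a bidder holds at most one object and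
    -- `f` is injective. It would end at `c 0`, who holds none.
    have hne : ∀ s t, s < t → t ≤ n → c s ≠ c t := by
      intro s
      induction s with
      | zero =>
        rintro (_ | t) hst htn heq
        · omega
        · obtain ⟨l, hl, htop⟩ := hown t (by omega)
          rw [← heq] at hl
          exact htop (hu _ _ hl)
      | succ s ih =>
        rintro (_ | t) hst htn heq
        · omega
        · obtain ⟨l, hl, htop⟩ := hown t (by omega)
          obtain ⟨l', hl', htop'⟩ := hown s (by omega)
          rw [heq] at hl'
          exact ih t (by omega) (by omega) (hinj _ _ (hcP s (by omega)).1 (hcP t (by omega)).1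
            (hS.owner hl' htop' hl htop))
    have hinjc : Injective fun t : Fin (n + 1) => c t := by
      intro s t hst
      by_contra hst'
      rcases lt_or_gt_of_ne hst' with h | h
      · exact hne s t h (by omega) hst
      · exact hne t s h (by omega) hst.symm
    -- The chain would consist of `n + 1` different bidders among `n`.
    simpa using Fintype.card_le_of_injective _ hinjc
  · intro h
    by_contra hu
    apply h
    have hass : ∀ i, P i → ∃ j k, (k, j, i) ∈ S ∧ ¬ Topped S k j := by
      intro i hi
      by_contra hne
      exact hu ⟨i, hi, fun k j hk => by_contra fun ht => hne ⟨j, k, hk, ht⟩⟩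
    choose! f k hf hk using hass
    refine ⟨f, fun i hi => hS.edge (hf i hi), fun i i' hi hi' heq => ?_⟩
    have h1 := hf i hi
    have h2 := hf i' hi'
    have t1 := hk i hi
    have t2 := hk i' hi'
    rw [← heq] at h2 t2
    -- Both offers are the highest for the same object, so they agree in price and therefore in
    -- bidder.
    have hkk : k i = k i' :=
      le_antisymm (hS.le_of_not_topped t2 ⟨_, h1⟩) (hS.le_of_not_topped t1 ⟨_, h2⟩)
    rw [← hkk] at h2
    exact hS.unique h1 h2

/-! ### Rounds and termination of the auction -/

open Classical in
/-- Making the offer of a price `k` by `i` for `j`, if possible. -/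
noncomputable def offer (E : Fin n → Fin n → Prop) (k j i : Fin n) (S : Offers n) : Offers n :=
  if Bid E S k j i then insert (k, j, i) S else S

/-- Making all possible offers in turn. -/
noncomputable def round (E : Fin n → Fin n → Prop) : Offers n → Offers n :=
  iterFin n fun k => iterFin n fun j => iterFin n fun i => offer E k j i

theorem iterFin_induction {α : Type} {f : Fin n → α → α} {Q : α → Prop}
    (h : ∀ a x, Q x → Q (f a x)) {x : α} (hx : Q x) : Q (iterFin n f x) := by
  rw [iterFin]
  induction List.finRange n generalizing x with
  | nil => exact hx
  | cons a l ih => exact ih (h a x hx)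

/-- Inflationary maps cannot undo each other: if the composite fixes `x`, then by antisymmetry none
of them moves `x`. -/
theorem iterFin_inflationary {α : Type} [PartialOrder α] {f : Fin n → α → α}
    (h : ∀ a x, x ≤ f a x) (x : α) :
    x ≤ iterFin n f x ∧ (iterFin n f x = x → ∀ a, f a x = x) := by
  have : ∀ l : List (Fin n), ∀ x, x ≤ l.foldl (fun x a => f a x) x ∧
      (l.foldl (fun x a => f a x) x = x → ∀ a ∈ l, f a x = x) := by
    intro l
    induction l with
    | nil => simp
    | cons a l ih =>
      intro x
      obtain ⟨h1, h2⟩ := ih (f a x)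
      refine ⟨(h a x).trans h1, fun heq => ?_⟩
      have hax : f a x = x := le_antisymm (h1.trans heq.le) (h a x)
      rw [List.foldl_cons, hax] at heq
      rw [hax] at h2
      simpa [hax] using h2 heq
  exact ⟨(this _ x).1, fun heq a => (this _ x).2 heq a (List.mem_finRange a)⟩

theorem le_offer (k j i : Fin n) (S : Offers n) : S ≤ offer E k j i S := by
  rw [offer]
  split_ifs
  · exact Finset.subset_insert _ _
  · exact le_rfl

theorem le_round (S : Offers n) : S ≤ round E S :=
  (iterFin_inflationary (fun k S => (iterFin_inflationary (fun j S =>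
    (iterFin_inflationary (fun i S => le_offer k j i S) S).1) S).1) S).1

/-- In a round without effect every triple is examined against the same `S`, so an admissible offer
would have been inserted. -/
theorem not_bid_of_round_eq (h : round E S = S) (k j i : Fin n) : ¬ Bid E S k j i := by
  have h0 := fun k j (S : Offers n) => iterFin_inflationary (fun i S => le_offer (E := E) k j i S) S
  have h1 := fun k (S : Offers n) => iterFin_inflationary (fun j S => (h0 k j S).1) S
  have h2 := (iterFin_inflationary (fun k S => (h1 k S).1) S).2 h k
  have h3 := (h0 k j S).2 ((h1 k S).2 h2 j) i
  intro hb
  rw [offer, if_pos hb] at h3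
  exact hb.2.1 ⟨i, h3 ▸ Finset.mem_insert_self _ _⟩

theorem Fair.round (hS : Fair E S) : Fair E (round E S) := by
  refine iterFin_induction (fun k S hS => iterFin_induction (fun j S hS => iterFin_induction
    (fun i S hS => ?_) hS) hS) hS
  rw [offer]
  split_ifs with h
  · exact hS.insert h
  · exact hS

theorem fair_iterate (m : ℕ) : Fair E ((CQA.round E)^[m] ∅) := by
  induction m with
  | zero => exact fair_empty
  | succ m ih =>
    rw [iterate_succ_apply']
    exact ih.round

/-- The auction ends after at most `n ^ 3` rounds. -/
theorem round_iterate : round E ((round E)^[n * n * n] ∅) = (round E)^[n * n * n] ∅ := by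
  -- Every round before the end adds at least one of the `n ^ 3` triples.
  have key : ∀ t, round E ((round E)^[t] ∅) = (round E)^[t] ∅ ∨ t ≤ ((round E)^[t] ∅).card := by
    intro t
    induction t with
    | zero => simp
    | succ t ih =>
      rw [iterate_succ_apply']
      by_cases h : round E ((round E)^[t] ∅) = (round E)^[t] ∅
      · exact .inl (by rw [h, h])
      · right
        have := Finset.card_lt_card (lt_of_le_of_ne (le_round (E := E) ((round E)^[t] ∅)) (Ne.symm h))
        have := ih.resolve_left h
        omega
  rcases key (n * n * n) with h | h
  · exact h
  · have huniv : (round E)^[n * n * n] ∅ = Finset.univ := by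
      apply Finset.eq_univ_of_card
      refine le_antisymm (Finset.card_le_univ _) ?_
      simpa [Fintype.card_prod, Nat.mul_assoc] using h
    rw [huniv]
    exact le_antisymm (Finset.subset_univ _) (le_round _)

end Auction

/-! ### Running the auction on the positions of a word -/

/-- The tape on which the cells of the offers are marked. -/
noncomputable def tapeOf {n : ℕ} (S : Offers n) (a : ℕ) : Bool :=
  truth (∃ x ∈ S, address n x.1 x.2.1 x.2.2 = a)

/-- The three numbers are the digits of the address in base `n`. -/
theorem address_injective {n : ℕ} {x y : Fin n × Fin n × Fin n}
    (h : address n x.1 x.2.1 x.2.2 = address n y.1 y.2.1 y.2.2) : x = y := by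
  obtain ⟨a, b, c⟩ := x
  obtain ⟨a', b', c'⟩ := y
  have e : ∀ a b c : Fin n, address n a b c = (a * n + b) * n + c := fun a b c => by
    simp only [address]; ring
  have hdiv : ∀ (p : ℕ) (c : Fin n), (p * n + c) / n = p ∧ (p * n + c) % n = c := fun p c =>
    ⟨by rw [Nat.mul_comm, Nat.mul_add_div (by have := c.2; omega), Nat.div_eq_of_lt c.2, Nat.add_zero],
      by rw [Nat.mul_comm, Nat.mul_add_mod, Nat.mod_eq_of_lt c.2]⟩
  simp only [e] at h
  have h1 := (hdiv (a * n + b) c).1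
  have h2 := (hdiv (a * n + b) c).2
  rw [h] at h1 h2
  rw [(hdiv _ c').1] at h1
  rw [(hdiv _ c').2] at h2
  have h3 := (hdiv a b).1
  have h4 := (hdiv a b).2
  rw [← h1, (hdiv _ b').1] at h3
  rw [← h1, (hdiv _ b').2] at h4
  rw [Fin.ext h3, Fin.ext h4, Fin.ext h2]

theorem tapeOf_address {n : ℕ} {S : Offers n} {x y z : Fin n} :
    tapeOf S (address n x y z) = true ↔ (x, y, z) ∈ S := by
  simp only [tapeOf, truth, decide_eq_true_eq]
  constructor
  · rintro ⟨u, hu, h⟩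
    rwa [← address_injective (y := (x, y, z)) h]
  · exact fun h => ⟨_, h, rfl⟩

theorem tapeOf_insert {n : ℕ} {S : Offers n} (x y z : Fin n) :
    tapeOf (insert (x, y, z) S) = update (tapeOf S) (address n x y z) true := by
  funext a
  rw [update_apply]
  split_ifs with h
  · rw [h, tapeOf_address]
    exact Finset.mem_insert_self _ _
  · simp [tapeOf, truth, Ne.symm h]

theorem tapeOf_empty {n : ℕ} : tapeOf (∅ : Offers n) = fun _ => false := by
  funext a
  simp [tapeOf, truth]

namespace Fm

def used (x y : ℕ) : Fm := ex (mem (x + 1) (y + 1) 0)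

def topped (x y : ℕ) : Fm := ex (and (succ (x + 1) 0) (used 0 (y + 1)))

def unassigned (x : ℕ) : Fm := all (all (imp (mem 1 0 (x + 2)) (topped 1 0)))

/-- The offers that may be made; variables `2`, `1`, `0` are price, object and bidder. -/
def bid : Fm := and (edge 0 1) (and (not (used 2 1)) (and (unassigned 0)
  (all (all (imp (lt 1 4) (imp (edge 2 0) (used 1 0)))))))

section Holds

variable {w : List Letter} {S : Offers w.length} {v : ℕ → Fin w.length}

theorem holds_used {x y : ℕ} : (used x y).Holds w (tapeOf S) v ↔ Used S (v x) (v y) := by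
  simp only [used, holds_ex, holds_mem, tapeOf_address, scons_zero, scons_succ, Used]

theorem holds_topped {x y : ℕ} : (topped x y).Holds w (tapeOf S) v ↔ Topped S (v x) (v y) := by
  simp only [topped, holds_ex, holds_and, holds_succ, holds_used, scons_zero, scons_succ, Topped]

theorem holds_unassigned {x : ℕ} :
    (unassigned x).Holds w (tapeOf S) v ↔ Unassigned S (v x) := by
  simp only [unassigned, holds_all, holds_imp, holds_mem, holds_topped, tapeOf_address, scons_zero,
    scons_one, scons_add_two, Unassigned]

theorem holds_bid : bid.Holds w (tapeOf S) v ↔ Bid (Edge w) S (v 2) (v 1) (v 0) := by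
  have h2 : ∀ a b : Fin w.length, scons a (scons b v) 2 = v 0 := fun _ _ => rfl
  have h4 : ∀ a b : Fin w.length, scons a (scons b v) 4 = v 2 := fun _ _ => rfl
  simp only [bid, holds_and, holds_not, holds_all, holds_imp, holds_lt, holds_edge, holds_used,
    holds_unassigned, scons_zero, scons_one, h2, h4, Bid]

end Holds

open Prog

/-- The store with given counters and offers. -/
noncomputable def offerStore {n : ℕ} (c : ℕ → ℕ) (S : Offers n) : Store := ⟨c, 0, tapeOf S, 0, []⟩

/-- Counters `3`, `4`, `5` hold price, object and bidder; at depth three they are the variables `2`,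
`1`, `0` of `bid`. -/
def offerProg : Prog :=
  seq (bid.prog 3) (ite (.zero 0) skip
    (seq (act (.dec 0)) (seq (seek 3 4 5) (seq (act .mark) rewind))))

/-- The program deciding whether there is no saturating matching. -/
def auctionProg : Prog :=
  seq (rep (rep (rep (forEach 3 (forEach 4 (forEach 5 offerProg))))))
    ((ex (and (bidder 0) (unassigned 0))).prog 1)

theorem run_offerProg {w : List Letter} (k j i : Fin w.length) (S : Offers w.length) :
    offerProg.run w (offerStore (loopCtr [(k : ℕ), (j : ℕ), (i : ℕ)]) S) =
      offerStore (loopCtr [(k : ℕ), (j : ℕ), (i : ℕ)]) (offer (Edge w) k j i S) := by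
  classical
  set c := loopCtr [(k : ℕ), (j : ℕ), (i : ℕ)] with hc
  have hv : env 3 (offerStore c S) =
      fun x => ((scons i (scons j fun _ => k) x : Fin w.length) : ℕ) := by
    funext x
    rcases x with _ | _ | x
    · rfl
    · rfl
    · change c (3 + (2 - (x + 2))) = k
      rw [show 2 - (x + 2) = 0 by omega]
      rfl
  have hready : Ready w 3 (offerStore c S) :=
    ready_loopCtr (l := [(k : ℕ), (j : ℕ), (i : ℕ)]) (by simp [k.2.le, j.2.le, i.2.le]) _ _
  have hb : bid.Sat w (tapeOf S) (env 3 (offerStore c S)) ↔ Bid (Edge w) S k j i := by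
    rw [hv]
    exact holds_bid
  have h0 : update c 0 0 = c := update_eq_self_iff.2 (by simp [hc, loopCtr])
  rw [offerProg, run, run_prog bid (by omega) hready]
  change Prog.run w _ { offerStore c S with
    ctr := update c 0 (if bid.Sat w (tapeOf S) (env 3 (offerStore c S)) then 1 else 0) } = _
  rw [offer]
  by_cases h : Bid (Edge w) S k j i
  · rw [if_pos (hb.2 h), if_pos h, run, if_neg (by simp [Test.eval]), run]
    have hdec : (act (.dec 0)).run w { offerStore c S with ctr := update c 0 1 } = offerStore c S := by
      simp [run, Act.run, offerStore, h0]
    rw [hdec, run, run_seek (w := w) (x := 3) (y := 4) (z := 5) le_rfl (by omega) (by omega)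
      (offerStore c S) rfl k.2.le j.2.le i.2.le, run]
    have hle := address_le k.2.le j.2.le i.2.le
    rw [run_rewind]
    · simp only [run, Act.run, offerStore, tapeOf_insert]
      congr 2
      simp [hc, loopCtr]
    · simpa [run, Act.run, offerStore, hc, loopCtr] using hle
  · rw [if_neg (mt hb.1 h), if_neg h, h0, run, if_pos (by simp [Test.eval, hc, loopCtr]), run_skip]
    rfl

theorem run_round {w : List Letter} (S : Offers w.length) :
    (forEach 3 (forEach 4 (forEach 5 offerProg))).run w (offerStore (loopCtr []) S) =
      offerStore (loopCtr []) (round (Edge w) S) := by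
  refine run_forEach offerStore (fun _ _ => rfl) (fun _ _ _ => rfl) rfl
    (fun k => iterFin w.length fun j => iterFin w.length fun i => offer (Edge w) k j i)
    (fun k S => ?_) S
  have h3 := update_loopCtr [] k
  change update _ 3 _ = _ at h3
  rw [h3]
  refine run_forEach offerStore (fun _ _ => rfl) (fun _ _ _ => rfl) rfl
    (fun j => iterFin w.length fun i => offer (Edge w) k j i) (fun j S => ?_) S
  have h4 := update_loopCtr [(k : ℕ)] j
  change update _ 4 _ = _ at h4
  rw [List.nil_append, h4]
  refine run_forEach offerStore (fun _ _ => rfl) (fun _ _ _ => rfl) rfl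
    (fun i => offer (Edge w) k j i) (fun i S => ?_) S
  have h5 := update_loopCtr [(k : ℕ), (j : ℕ)] i
  change update _ 5 _ = _ at h5
  rw [List.singleton_append, h5]
  exact run_offerProg k j i S

theorem run_rep_of {w : List Letter} {α : Type} {p : Prog} {mk : α → Store} {g : α → α}
    (h : ∀ x, p.run w (mk x) = mk (g x)) (x : α) : (rep p).run w (mk x) = mk (g^[w.length] x) := by
  have := (show Semiconj mk g (p.run w) from fun x => (h x).symm).iterate_right w.length
  exact (this x).symm

/-- Three nested repetitions perform the `n ^ 3` rounds that suffice. The final sentence is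
evaluated at depth one, because the evaluator needs a counter to read from; its value plays no role.
-/
theorem run_auctionProg (w : List Letter) :
    (auctionProg.run w Store.zero).ctr 0 ≠ 0 ↔
      ¬ ∃ f : Fin w.length → Fin w.length, (∀ i, Bidder w i → Edge w i (f i)) ∧
        ∀ i i', Bidder w i → Bidder w i' → f i = f i' → i = i' := by
  classical
  set n := w.length with hn
  set S := (round (Edge w))^[n * n * n] ∅ with hS
  rw [← (fair_iterate (E := Edge w) (n * n * n)).unassigned_iff
    (not_bid_of_round_eq round_iterate) (fun i j h => h.1), ← hS]
  have hz : Store.zero = offerStore (loopCtr []) (∅ : Offers w.length) := by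
    rw [loopCtr_nil, offerStore, tapeOf_empty]; rfl
  have hrep := run_rep_of (mk := offerStore (loopCtr []))
    (run_rep_of (mk := offerStore (loopCtr [])) (run_rep_of (mk := offerStore (loopCtr []))
      (run_round (w := w)))) ∅
  have hready : Ready w 1 (offerStore (loopCtr []) S) := by
    rw [loopCtr_nil]
    exact ⟨rfl, rfl, Nat.zero_le _, rfl, rfl, fun _ _ => Nat.zero_le _, fun _ _ => rfl⟩
  rw [← iterate_mul, ← iterate_mul, ← Nat.mul_assoc] at hrep
  rw [auctionProg, run, hz, hrep, run_prog _ one_pos hready]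
  have henv : env 1 (offerStore (loopCtr []) S) = fun _ => 0 := by
    rw [loopCtr_nil]; rfl
  rw [henv]
  change update (fun _ => 0) 0 (if (ex _).Sat w (tapeOf S) _ then 1 else 0) 0 ≠ 0 ↔ _
  rw [update_self]
  have hsat : (ex (and (bidder 0) (unassigned 0))).Sat w (tapeOf S) (fun _ => 0) ↔
      ∃ i, Bidder w i ∧ Unassigned S i := by
    -- For the empty word there are no assignments of positions, so this case is separate.
    rcases Nat.eq_zero_or_pos w.length with h0 | hpos
    · exact ⟨fun ⟨a, ha, _⟩ => by omega, fun ⟨i, _⟩ => by have := i.2; omega⟩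
    · have := holds_ex (w := w) (tape := tapeOf S) (v := fun _ => ⟨0, hpos⟩)
        (φ := and (bidder 0) (unassigned 0))
      simp only [holds_and, holds_bidder, holds_unassigned, scons_zero] at this
      exact this
  split_ifs with h
  · exact ⟨fun _ => hsat.1 h, fun _ => one_ne_zero⟩
  · exact ⟨fun h' => (h' rfl).elim, fun h' => (h (hsat.2 h')).elim⟩

end Fm

/-! ### Repairs falsifying the query, and cliques of the solution graph -/

section Rotation

variable {A : Type} {D : Database sigR A}

def entry (t : Term sigR A) (i : Fin 3) : A := t.args i

theorem eq_of_entry {s t : Term sigR A} (h : ∀ i, entry s i = entry t i) : s = t := by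
  obtain ⟨⟨⟩, a⟩ := s
  obtain ⟨⟨⟩, b⟩ := t
  exact congrArg _ (funext h)

theorem eq_iff_entry {s t : Term sigR A} :
    s = t ↔ entry s 0 = entry t 0 ∧ entry s 1 = entry t 1 ∧ entry s 2 = entry t 2 := by
  refine ⟨by rintro rfl; simp, fun h => eq_of_entry fun i => ?_⟩
  fin_cases i
  exacts [h.1, h.2.1, h.2.2]

/-- The cyclic shift of a fact. -/
def rot (t : Term sigR A) : Term sigR A := R (entry t 2) (entry t 0) (entry t 1)

theorem rot_rot_rot (t : Term sigR A) : rot (rot (rot t)) = t :=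
  eq_iff_entry.2 ⟨rfl, rfl, rfl⟩

theorem map_R {V : Type} (μ : V → A) (x y z : V) : (R x y z).map μ = R (μ x) (μ y) (μ z) :=
  eq_iff_entry.2 ⟨rfl, rfl, rfl⟩

/-- The second atom of `q4` is the cyclic shift of the first, and the first uses all variables. So
the first fact determines the second. -/
theorem isSolution_iff {u v : Term sigR A} :
    IsSolution q4 D [u, v] ↔ u ∈ D ∧ v ∈ D ∧ v = rot u := by
  simp only [IsSolution, q4, List.map_cons, List.map_nil, map_R, List.cons.injEq, and_true,
    List.mem_cons, List.not_mem_nil, or_false, forall_eq_or_imp, forall_eq]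
  constructor
  · rintro ⟨μ, ⟨rfl, rfl⟩, hu, hv⟩
    exact ⟨hu, hv, rfl⟩
  · rintro ⟨hu, hv, rfl⟩
    exact ⟨entry u, ⟨eq_iff_entry.2 ⟨rfl, rfl, rfl⟩, rfl⟩, hu, hv⟩

theorem satisfies_iff : Satisfies D q4 ↔ ∃ u ∈ D, rot u ∈ D := by
  constructor
  · rintro ⟨us, hus⟩
    obtain ⟨μ, rfl, h⟩ := hus
    have := isSolution_iff.1 (show IsSolution q4 D [(R 0 1 2).map μ, (R 2 0 1).map μ] from ⟨μ, rfl, h⟩)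
    exact ⟨_, this.1, this.2.2 ▸ this.2.1⟩
  · rintro ⟨u, hu, hv⟩
    exact ⟨_, isSolution_iff.2 ⟨hu, hv, rfl⟩⟩

theorem keyEquiv_iff {s t : Term sigR A} : KeyEquiv s t ↔ entry s 0 = entry t 0 := by
  obtain ⟨⟨⟩, a⟩ := s
  obtain ⟨⟨⟩, b⟩ := t
  constructor
  · rintro ⟨_, h⟩
    exact h (0 : Fin 3) (Finset.mem_singleton_self _)
  · intro h
    refine ⟨rfl, fun i hi => ?_⟩
    obtain rfl := Finset.mem_singleton.1 hi
    exact h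

theorem isBlock_iff {B : Set (Term sigR A)} :
    IsBlock D B ↔ ∃ s ∈ D, B = {t | t ∈ D ∧ entry s 0 = entry t 0} := by
  simp only [IsBlock, keyEquiv_iff]

/-- Equality up to cyclic shifts. -/
def SameOrbit (s t : Term sigR A) : Prop := t = s ∨ t = rot s ∨ t = rot (rot s)

theorem SameOrbit.refl (s : Term sigR A) : SameOrbit s s := .inl rfl

theorem SameOrbit.symm {s t : Term sigR A} (h : SameOrbit s t) : SameOrbit t s := by
  rcases h with rfl | rfl | rfl
  · exact .inl rfl
  · exact .inr (.inr (rot_rot_rot s).symm)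
  · exact .inr (.inl (rot_rot_rot s).symm)

theorem SameOrbit.trans {s t u : Term sigR A} (h : SameOrbit s t) (h' : SameOrbit t u) :
    SameOrbit s u := by
  rcases h with rfl | rfl | rfl <;> rcases h' with rfl | rfl | rfl <;>
    simp [SameOrbit, rot_rot_rot]

/-- A choice of a fact with distinct cyclic shifts from each block, such that facts from different
blocks are not cyclic shifts of each other. -/
def GoodChoice (D : Database sigR A) : Prop :=
  ∃ c : A → Term sigR A, ∀ s ∈ D, c (entry s 0) ∈ D ∧ entry (c (entry s 0)) 0 = entry s 0 ∧
    rot (c (entry s 0)) ≠ c (entry s 0) ∧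
    ∀ t ∈ D, SameOrbit (c (entry s 0)) (c (entry t 0)) → entry s 0 = entry t 0

/-- A choice of one fact per block is the same as a repair. Facts related by the square of `rot`
form a solution in the opposite order, so avoiding solutions means avoiding common orbits. -/
theorem certain_iff : Certain q4 D ↔ ¬ GoodChoice D := by
  classical
  constructor
  · rintro hc ⟨c, h⟩
    obtain ⟨u, hu, hv⟩ := satisfies_iff.1 (hc (D.filter fun t => c (entry t 0) = t)
      ⟨Finset.filter_subset _ _, by
        rintro B hB
        obtain ⟨s, hs, rfl⟩ := isBlock_iff.1 hB
        obtain ⟨h1, h2, -, -⟩ := h s hs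
        refine ⟨c (entry s 0), ⟨Finset.mem_filter.2 ⟨h1, by rw [h2]⟩, h1, h2.symm⟩, ?_⟩
        rintro t ⟨ht, -, he⟩
        rw [he, (Finset.mem_filter.1 ht).2]⟩)
    rw [Finset.mem_filter] at hu hv
    obtain ⟨-, -, h3, h4⟩ := h u hu.1
    have := h4 _ hv.1 (by rw [hu.2, hv.2]; exact .inr (.inl rfl))
    rw [this, hv.2] at hu
    rw [hu.2] at hv
    exact h3 (by rw [hv.2, hu.2])
  · intro hg r hr
    by_contra hsat
    rw [satisfies_iff] at hsat
    have huniq : ∀ s ∈ D, ∃! t, t ∈ r ∧ entry t 0 = entry s 0 := by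
      intro s hs
      obtain ⟨t, ⟨ht, -, hk⟩, hu⟩ := hr.2 _ (isBlock_iff.2 ⟨s, hs, rfl⟩)
      exact ⟨t, ⟨ht, hk.symm⟩, fun t' ht' => hu t' ⟨ht'.1, hr.1 ht'.1, ht'.2.symm⟩⟩
    refine hg ⟨fun a => if h : ∃ t ∈ r, entry t 0 = a then h.choose else R a a a, fun s hs => ?_⟩
    have hex : ∀ s ∈ D, ∃ t ∈ r, entry t 0 = entry s 0 := fun s hs => (huniq s hs).exists
    have h1 := (hex s hs).choose_spec
    simp only [dif_pos (hex s hs)]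
    refine ⟨hr.1 h1.1, h1.2, fun h => hsat ⟨_, h1.1, by rw [h]; exact h1.1⟩, fun t ht ho => ?_⟩
    rw [dif_pos (hex t ht)] at ho
    have h2 := (hex t ht).choose_spec
    rcases ho with ho | ho | ho
    · rw [← h1.2, ← ho, h2.2]
    · exact (hsat ⟨_, h1.1, ho ▸ h2.1⟩).elim
    · refine (hsat ⟨_, h2.1, ?_⟩).elim
      rw [ho, rot_rot_rot]
      exact h1.1

theorem mem_loopFree {t : Term sigR A} : t ∈ loopFree D ↔ t ∈ D ∧ rot t ≠ t := by
  classical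
  simp only [loopFree, Finset.mem_filter, isSolution_iff, and_congr_right_iff]
  exact fun h => ⟨fun h' he => h' ⟨h, h, he.symm⟩, fun h' he => h' he.2.2.symm⟩

/-- Applying `rot` twice is the inverse of applying it once, so the two orders of a solution cover
the whole orbit. -/
theorem adj_iff {a b : {t // t ∈ D}} :
    (solutionGraph D).Adj a b ↔ a ≠ b ∧ SameOrbit a.1 b.1 := by
  simp only [solutionGraph, isSolution_iff, a.2, b.2, true_and]
  refine and_congr_right fun hne => ?_
  have hne' : b.1 ≠ a.1 := fun h => hne (Subtype.ext h.symm)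
  simp only [SameOrbit, hne', false_or]
  refine or_congr_right ⟨fun h => ?_, fun h => ?_⟩
  · rw [h, rot_rot_rot]
  · rw [h, rot_rot_rot]

theorem maximal_orbit (a : {t // t ∈ D}) :
    Maximal (solutionGraph D).IsClique {b | SameOrbit a.1 b.1} := by
  refine ⟨fun x hx y hy hne => adj_iff.2 ⟨hne, hx.symm.trans hy⟩, fun C hC hle b hb => ?_⟩
  by_cases h : a = b
  · exact h ▸ SameOrbit.refl _
  · exact (adj_iff.1 (hC (hle (SameOrbit.refl _)) hb h)).2

/-- A clique containing `a` lies in the orbit of `a`, which is itself a clique; maximality gives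
equality. -/
theorem mem_maximal_clique {C : Set {t // t ∈ D}} (hC : Maximal (solutionGraph D).IsClique C)
    {a b : {t // t ∈ D}} (ha : a ∈ C) : b ∈ C ↔ SameOrbit a.1 b.1 := by
  have : C ⊆ {b | SameOrbit a.1 b.1} := by
    intro b hb
    by_cases h : a = b
    · exact h ▸ SameOrbit.refl _
    · exact (adj_iff.1 (hC.1 ha hb h)).2
  exact ⟨fun h => this h, fun h => hC.2 (maximal_orbit a).1 this h⟩

/-- A clique assigned to a block meets it and so is the orbit of a fact of that block. Different
cliques are different orbits. -/
theorem blocksMatchCliques_iff : BlocksMatchCliques D ↔ GoodChoice D := by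
  classical
  constructor
  · rintro ⟨f, hf, h⟩
    have hblock : ∀ s ∈ D, IsBlock D {t | t ∈ D ∧ entry s 0 = entry t 0} :=
      fun s hs => isBlock_iff.2 ⟨s, hs, rfl⟩
    -- For a key `a` that occurs, `t` is a fact shared by the block of `a` and its clique. Other
    -- constants receive a dummy value.
    have hex : ∀ a, ∃ t, (∃ s ∈ D, entry s 0 = a) → ∃ (B : {B // IsBlock D B})
        (ht : t ∈ loopFree D), ⟨t, ht⟩ ∈ (f B).1 ∧ entry t 0 = a ∧ ∀ u ∈ B.1, entry u 0 = a := by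
      intro a
      by_cases ha : ∃ s ∈ D, entry s 0 = a
      · obtain ⟨s, hs, rfl⟩ := ha
        obtain ⟨t, ht, htB⟩ := h ⟨_, hblock s hs⟩
        exact ⟨t.1, fun _ => ⟨⟨_, hblock s hs⟩, t.2, ht, htB.2.symm, fun u hu => hu.2.symm⟩⟩
      · exact ⟨R a a a, fun h => (ha h).elim⟩
    choose c hc using hex
    refine ⟨c, fun s hs => ?_⟩
    obtain ⟨B, ht, hB, hk, hu⟩ := hc _ ⟨s, hs, rfl⟩
    refine ⟨(mem_loopFree.1 ht).1, hk, (mem_loopFree.1 ht).2, fun s' hs' ho => ?_⟩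
    obtain ⟨B', ht', hB', hk', hu'⟩ := hc _ ⟨s', hs', rfl⟩
    have hff : f B = f B' := by
      apply Subtype.ext
      ext b
      rw [mem_maximal_clique (f B).2 hB, mem_maximal_clique (f B').2 hB']
      exact ⟨fun h => ho.symm.trans h, fun h => ho.trans h⟩
    obtain rfl := hf hff
    obtain ⟨t, -, htB⟩ := h B
    rw [← hu _ htB, ← hu' _ htB]
  · rintro ⟨c, h⟩
    have hs : ∀ B : {B // IsBlock D B}, ∃ s ∈ D, B.1 = {t | t ∈ D ∧ entry s 0 = entry t 0} :=
      fun B => isBlock_iff.1 B.2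
    choose s hs hB using hs
    have hc : ∀ B, c (entry (s B) 0) ∈ loopFree D := fun B =>
      mem_loopFree.2 ⟨(h _ (hs B)).1, (h _ (hs B)).2.2.1⟩
    refine ⟨fun B => ⟨_, maximal_orbit ⟨_, hc B⟩⟩, fun B B' he => ?_, fun B =>
      ⟨⟨_, hc B⟩, SameOrbit.refl _, ?_⟩⟩
    · have hm : (⟨_, hc B'⟩ : {t // t ∈ loopFree D}) ∈
          {b : {t // t ∈ loopFree D} | SameOrbit (c (entry (s B) 0)) b.1} := by
        rw [show {b : {t // t ∈ loopFree D} | SameOrbit (c (entry (s B) 0)) b.1} = _ from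
          congrArg Subtype.val he]
        exact SameOrbit.refl _
      apply Subtype.ext
      rw [hB, hB, (h _ (hs B)).2.2.2 _ (hs B') hm]
    · rw [hB]
      exact ⟨(h _ (hs B)).1, (h _ (hs B)).2.1.symm⟩

end Rotation

/-! ### Facts at positions of the encoding of a database -/

section Encoding

variable {w : List Letter} {p q : ℕ} {x y : List Bool} {s t : Term sigR (List Bool)}

theorem encodeFact_eq (t : Term sigR (List Bool)) :
    encodeFact t = (entry t 0).map some ++ none :: ((entry t 1).map some ++
      none :: ((entry t 2).map some ++ [none])) := by
  change List.flatMap _ (List.ofFn (n := 3) (entry t)) = _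
  simp [List.ofFn_succ]

/-- The word `x` followed by a separator starts at position `p`. -/
def WordAt (w : List Letter) (p : ℕ) (x : List Bool) : Prop :=
  ∃ v, w.drop p = x.map some ++ none :: v

theorem WordAt.getElem?_end (h : WordAt w p x) : w[p + x.length]? = some none := by
  obtain ⟨v, h⟩ := h
  rw [← List.getElem?_drop, h]
  simp

theorem WordAt.getElem? (h : WordAt w p x) {e : ℕ} (he : e < x.length) :
    w[p + e]? = some (some x[e]) := by
  obtain ⟨v, h⟩ := h
  rw [← List.getElem?_drop, h, List.getElem?_append_left (by simpa using he)]
  simp [he]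

theorem WordAt.lt_length (h : WordAt w p x) : p < w.length := by
  obtain ⟨h', -⟩ := List.getElem?_eq_some_iff.1 h.getElem?_end
  omega

/-- The letters of a name are bits, so the first separator from `p` on is the one that ends the
word. -/
theorem WordAt.eq_length (h : WordAt w p x) {d : ℕ} (hd : w[p + d]? = some none)
    (he : ∀ e < d, w[p + e]? ≠ some none) : d = x.length := by
  rcases lt_trichotomy d x.length with hlt | rfl | hlt
  · rw [h.getElem? hlt] at hd
    cases hd
  · rfl
  · exact (he _ hlt h.getElem?_end).elim

theorem WordAt.next_iff (h : WordAt w p x) : Next w p q ↔ p + x.length + 1 = q := by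
  constructor
  · rintro ⟨d, hd, he, rfl⟩
    rw [h.eq_length hd he]
  · rintro rfl
    exact ⟨_, h.getElem?_end, fun e he => by simp [h.getElem? he], rfl⟩

theorem WordAt.sameWord_iff (hp : WordAt w p x) (hq : WordAt w q y) : SameWord w p q ↔ x = y := by
  constructor
  · rintro ⟨d, h1, h2, h3⟩
    have hx := hp.eq_length h1 fun e he => by
      obtain ⟨b, hb, -⟩ := h3 e he
      simp [hb]
    have hy := hq.eq_length h2 fun e he => by
      obtain ⟨b, -, hb⟩ := h3 e he
      simp [hb]
    refine List.ext_getElem (hx.symm.trans hy) fun e he he' => ?_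
    obtain ⟨b, hb, hb'⟩ := h3 e (by omega)
    rw [hp.getElem? he] at hb
    rw [hq.getElem? he'] at hb'
    exact Option.some.inj (Option.some.inj (hb.trans hb'.symm))
  · rintro rfl
    exact ⟨_, hp.getElem?_end, hq.getElem?_end, fun e he => ⟨_, hp.getElem? he, hq.getElem? he⟩⟩

/-- The fact `t` is written from position `p` on. -/
def FactAt (w : List Letter) (p : ℕ) (t : Term sigR (List Bool)) : Prop :=
  ∃ v, w.drop p = encodeFact t ++ v

theorem FactAt.exists_wordAt (h : FactAt w p t) : ∃ p₁ p₂ : Fin w.length,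
    WordAt w p (entry t 0) ∧ WordAt w p₁ (entry t 1) ∧ WordAt w p₂ (entry t 2) ∧
    (∀ q, Next w p q ↔ p₁ = q) ∧ ∀ q, Next w p₁ q ↔ p₂ = q := by
  obtain ⟨v, h⟩ := h
  rw [encodeFact_eq] at h
  have h0 : WordAt w p (entry t 0) := ⟨_, by rw [h, List.append_assoc, List.cons_append]⟩
  have h1 : WordAt w (p + (entry t 0).length + 1) (entry t 1) := by
    refine ⟨(entry t 2).map some ++ none :: v, ?_⟩
    rw [Nat.add_assoc, ← List.drop_drop, h, List.append_assoc, List.drop_append]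
    simp
  have h2 : WordAt w (p + (entry t 0).length + 1 + (entry t 1).length + 1) (entry t 2) := by
    obtain ⟨u, hu⟩ := h1
    have hu' := hu
    rw [Nat.add_assoc, ← List.drop_drop, h, List.append_assoc, List.drop_append] at hu'
    simp only [List.length_map, Nat.add_sub_cancel_left, List.cons_append, List.drop_succ_cons,
      List.drop_zero, List.append_assoc] at hu'
    rw [List.drop_eq_nil_of_le (by simp), List.nil_append, List.append_cancel_left_eq,
      List.cons.injEq] at hu'
    refine ⟨v, ?_⟩
    rw [Nat.add_assoc _ (entry t 1).length, ← List.drop_drop, hu, ← hu'.2, List.drop_append]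
    simp
  exact ⟨⟨_, h1.lt_length⟩, ⟨_, h2.lt_length⟩, h0, h1, h2, fun q => h0.next_iff,
    fun q => h1.next_iff⟩

theorem FactAt.lt_length (h : FactAt w p t) : p < w.length := by
  obtain ⟨p₁, p₂, h0, -⟩ := h.exists_wordAt
  exact h0.lt_length

theorem FactAt.sameWord_iff (hs : FactAt w p s) (ht : FactAt w q t) :
    SameWord w p q ↔ entry s 0 = entry t 0 := by
  obtain ⟨p₁, p₂, h0, -⟩ := hs.exists_wordAt
  obtain ⟨q₁, q₂, k0, -⟩ := ht.exists_wordAt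
  exact h0.sameWord_iff k0

theorem FactAt.sameOrbitAt_iff (hs : FactAt w p s) (ht : FactAt w q t) :
    SameOrbitAt w p q ↔ SameOrbit s t := by
  obtain ⟨p₁, p₂, h0, h1, h2, n1, n2⟩ := hs.exists_wordAt
  obtain ⟨q₁, q₂, k0, k1, k2, m1, m2⟩ := ht.exists_wordAt
  have key : SameOrbitAt w p q ↔ (SameWord w p q ∧ SameWord w p₁ q₁ ∧ SameWord w p₂ q₂ ∨
      SameWord w p q₁ ∧ SameWord w p₁ q₂ ∧ SameWord w p₂ q ∨
      SameWord w p q₂ ∧ SameWord w p₁ q ∧ SameWord w p₂ q₁) := by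
    constructor
    · rintro ⟨a, b, c, d, ha, hb, hc, hd, h⟩
      obtain rfl := Fin.ext ((n1 _).1 ha)
      obtain rfl := Fin.ext ((n2 _).1 hb)
      obtain rfl := Fin.ext ((m1 _).1 hc)
      obtain rfl := Fin.ext ((m2 _).1 hd)
      exact h
    · intro h
      exact ⟨p₁, p₂, q₁, q₂, (n1 _).2 rfl, (n2 _).2 rfl, (m1 _).2 rfl, (m2 _).2 rfl, h⟩
  rw [key, h0.sameWord_iff k0, h0.sameWord_iff k1, h0.sameWord_iff k2, h1.sameWord_iff k0,
    h1.sameWord_iff k1, h1.sameWord_iff k2, h2.sameWord_iff k0, h2.sameWord_iff k1,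
    h2.sameWord_iff k2, SameOrbit, eq_iff_entry, eq_iff_entry, eq_iff_entry]
  have e : ∀ a b c : List Bool, entry (R a b c) 0 = a ∧ entry (R a b c) 1 = b ∧
    entry (R a b c) 2 = c := fun _ _ _ => ⟨rfl, rfl, rfl⟩
  simp only [rot, e]
  refine or_congr ?_ (or_congr ?_ ?_)
  · exact ⟨fun ⟨h, h', h''⟩ => ⟨h.symm, h'.symm, h''.symm⟩,
      fun ⟨h, h', h''⟩ => ⟨h.symm, h'.symm, h''.symm⟩⟩
  · exact ⟨fun ⟨h, h', h''⟩ => ⟨h''.symm, h.symm, h'.symm⟩,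
      fun ⟨h, h', h''⟩ => ⟨h'.symm, h''.symm, h.symm⟩⟩
  · exact ⟨fun ⟨h, h', h''⟩ => ⟨h'.symm, h''.symm, h.symm⟩,
      fun ⟨h, h', h''⟩ => ⟨h''.symm, h.symm, h'.symm⟩⟩

theorem FactAt.loopAt_iff (hs : FactAt w p s) : LoopAt w p ↔ rot s = s := by
  obtain ⟨p₁, p₂, h0, h1, h2, n1, n2⟩ := hs.exists_wordAt
  have key : LoopAt w p ↔ SameWord w p p₁ ∧ SameWord w p p₂ := by
    constructor
    · rintro ⟨a, b, ha, hb, h⟩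
      obtain rfl := Fin.ext ((n1 _).1 ha)
      obtain rfl := Fin.ext ((n2 _).1 hb)
      exact h
    · intro h
      exact ⟨p₁, p₂, (n1 _).2 rfl, (n2 _).2 rfl, h⟩
  rw [key, h0.sameWord_iff h1, h0.sameWord_iff h2, eq_iff_entry]
  change _ ↔ entry s 2 = entry s 0 ∧ entry s 0 = entry s 1 ∧ entry s 1 = entry s 2
  exact ⟨fun ⟨h, h'⟩ => ⟨h'.symm, h, h.symm.trans h'⟩, fun ⟨h, h', _⟩ => ⟨h', h.symm⟩⟩

/-- Unique readability: separators determine where the second and third entries start, and each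
entry is determined by its position. -/
theorem FactAt.eq (hs : FactAt w p s) (ht : FactAt w p t) : s = t := by
  obtain ⟨p₁, p₂, h0, h1, h2, n1, n2⟩ := hs.exists_wordAt
  obtain ⟨q₁, q₂, k0, k1, k2, m1, m2⟩ := ht.exists_wordAt
  obtain rfl := Fin.ext ((n1 _).1 ((m1 _).2 rfl))
  obtain rfl := Fin.ext ((n2 _).1 ((m2 _).2 rfl))
  have hself : ∀ {p x}, WordAt w p x → SameWord w p p := fun h => (h.sameWord_iff h).2 rfl
  exact eq_iff_entry.2 ⟨(h0.sameWord_iff k0).1 (hself h0), (h1.sameWord_iff k1).1 (hself h1),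
    (h2.sameWord_iff k2).1 (hself h2)⟩

/-- Removing a whole fact from the front changes the number of separators by three and leaves a word
preceded by a separator. -/
theorem start_append {u w' : List Letter} (hu : u.count none = 3) {a : List Letter}
    (ha : u = a ++ [none]) : Start (u ++ w') (u.length + p) ↔ Start w' p := by
  rw [Start, Start, List.take_length_add_append, List.count_append, hu, Nat.add_mod_left]
  refine and_congr_right fun _ => ?_
  have hlen : u.length = a.length + 1 := by simp [ha]
  have hget : ∀ q, (u ++ w')[u.length + q]? = w'[q]? := fun q => by
    rw [List.getElem?_append_right (by omega), Nat.add_sub_cancel_left]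
  constructor
  · rintro (h | ⟨q, h, h'⟩)
    · omega
    · rcases Nat.eq_zero_or_pos p with hp | hp
      · exact .inl hp
      · refine .inr ⟨p - 1, by omega, ?_⟩
        rw [← hget, ← h', show u.length + (p - 1) = q by omega]
  · rintro (rfl | ⟨q, rfl, h'⟩)
    · refine .inr ⟨a.length, by omega, ?_⟩
      rw [ha]
      simp
    · exact .inr ⟨u.length + q, by omega, by rw [hget, h']⟩

/-- Inside the first fact, a position that follows a separator is preceded by one or two of them, a
number not divisible by three. -/
theorem start_of_lt {u w' : List Letter} (hu : u.count none = 3) {a : List Letter}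
    (ha : u = a ++ [none]) (hp : p < u.length) (h : Start (u ++ w') p) : p = 0 := by
  obtain ⟨h1, h2⟩ := h
  by_contra hp0
  obtain ⟨q, rfl, hq⟩ := h2.resolve_left hp0
  have hlen : u.length = a.length + 1 := by simp [ha]
  have hca : a.count none = 2 := by
    have := hu
    rw [ha, List.count_append] at this
    simpa using this
  have htake : (u ++ w').take (q + 1) = a.take (q + 1) := by
    rw [ha, List.append_assoc, List.take_append_of_le_length (by omega)]
  have hle : (a.take (q + 1)).count none ≤ 2 := hca ▸ (List.take_sublist _ _).count_le _
  have hpos : 0 < (a.take (q + 1)).count none := by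
    rw [List.count_pos_iff]
    rw [ha, List.append_assoc, List.getElem?_append_left (by omega)] at hq
    refine List.mem_of_getElem? (i := q) ?_
    rw [List.getElem?_take_of_lt (by omega), hq]
  rw [htake] at h1
  omega

theorem encodeFact_spec (t : Term sigR (List Bool)) :
    (encodeFact t).count none = 3 ∧ ∃ a, encodeFact t = a ++ [none] := by
  have h : ∀ x : List Bool, (x.map some).count none = 0 := fun x => by
    rw [List.count_eq_zero]
    simp
  rw [encodeFact_eq]
  constructor
  · simp [List.count_append, h]
  · exact ⟨(entry t 0).map some ++ none :: ((entry t 1).map some ++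
      none :: (entry t 2).map some), by simp⟩

/-- The restriction to positions inside the word is needed: the end of the word also satisfies
`Start`. -/
theorem start_encode (l : DatabaseInput) :
    (∀ p < (encodeDatabase l).length, Start (encodeDatabase l) p →
      ∃ t ∈ l, FactAt (encodeDatabase l) p t) ∧
    ∀ t ∈ l, ∃ p, Start (encodeDatabase l) p ∧ FactAt (encodeDatabase l) p t := by
  induction l with
  | nil => simp [encodeDatabase]
  | cons t l ih =>
    obtain ⟨hc, a, ha⟩ := encodeFact_spec t
    have he : encodeDatabase (t :: l) = encodeFact t ++ encodeDatabase l := by simp [encodeDatabase]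
    rw [he]
    have hfact : ∀ p s, FactAt (encodeDatabase l) p s →
        FactAt (encodeFact t ++ encodeDatabase l) ((encodeFact t).length + p) s := by
      rintro p s ⟨v, hv⟩
      exact ⟨v, by rw [List.drop_length_add_append, hv]⟩
    constructor
    · intro p hp hst
      rcases lt_or_ge p (encodeFact t).length with hlt | hge
      · obtain rfl := start_of_lt hc ha hlt hst
        exact ⟨t, List.mem_cons_self, _, rfl⟩
      · obtain ⟨p, rfl⟩ := Nat.exists_eq_add_of_le hge
        rw [start_append hc ha] at hst
        obtain ⟨s, hs, hf⟩ := ih.1 p (by simpa using hp) hst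
        exact ⟨s, List.mem_cons_of_mem _ hs, hfact _ _ hf⟩
    · intro s hs
      rcases List.mem_cons.1 hs with rfl | hs
      · exact ⟨0, ⟨by simp, .inl rfl⟩, _, rfl⟩
      · obtain ⟨p, hp, hf⟩ := ih.2 s hs
        exact ⟨_, (start_append hc ha).2 hp, hfact _ _ hf⟩

/-! ### Good choices as matchings of positions -/

theorem exists_minimal {n : ℕ} {Q : Fin n → Prop} (h : ∃ i, Q i) :
    ∃ i, Q i ∧ ∀ i' < i, ¬ Q i' :=
  ⟨_, wellFounded_lt.min_mem _ h, fun _ h' hq => wellFounded_lt.not_lt_min _ hq h'⟩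

/-- A good choice is a saturating matching of blocks to orbits. -/
theorem exists_matching_iff (l : DatabaseInput) :
    (∃ f : Fin (encodeDatabase l).length → Fin (encodeDatabase l).length,
      (∀ i, Bidder (encodeDatabase l) i → Edge (encodeDatabase l) i (f i)) ∧
        ∀ i i', Bidder (encodeDatabase l) i → Bidder (encodeDatabase l) i' → f i = f i' → i = i') ↔
      GoodChoice l.toDatabase := by
  classical
  have hmem : ∀ t, t ∈ l.toDatabase ↔ t ∈ l := fun t => by simp [DatabaseInput.toDatabase]
  obtain ⟨hst, hon⟩ := start_encode l
  set w := encodeDatabase l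
  -- `T p` will be the fact that starts at `p`, with a dummy value where none starts.
  have hT : ∀ p : Fin w.length, ∃ t, Start w p → t ∈ l ∧ FactAt w p t := fun p => by
    by_cases h : Start w p
    · obtain ⟨t, ht⟩ := hst p p.2 h
      exact ⟨t, fun _ => ht⟩
    · exact ⟨R [] [] [], fun h' => (h h').elim⟩
  choose T hT using hT
  have hon' : ∀ t ∈ l, ∃ p : Fin w.length, Start w p ∧ T p = t := fun t ht => by
    obtain ⟨p, hp, hf⟩ := hon t ht
    exact ⟨⟨p, hf.lt_length⟩, hp, FactAt.eq (hT ⟨p, hf.lt_length⟩ hp).2 hf⟩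
  have hword : ∀ p q : Fin w.length, Start w p → Start w q →
      (SameWord w p q ↔ entry (T p) 0 = entry (T q) 0) := fun p q hp hq =>
    (hT p hp).2.sameWord_iff (hT q hq).2
  have horb : ∀ p q : Fin w.length, Start w p → Start w q →
      (SameOrbitAt w p q ↔ SameOrbit (T p) (T q)) := fun p q hp hq =>
    (hT p hp).2.sameOrbitAt_iff (hT q hq).2
  have hbid : ∀ i i', Bidder w i → Bidder w i' → entry (T i) 0 = entry (T i') 0 → i = i' := by
    intro i i' hi hi' he
    rcases lt_trichotomy i i' with h | h | h
    · exact (hi'.2 i h hi.1 ((hword _ _ hi.1 hi'.1).2 he)).elim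
    · exact h
    · exact (hi.2 i' h hi'.1 ((hword _ _ hi'.1 hi.1).2 he.symm)).elim
  have hobj : ∀ j j', Object w j → Object w j' → SameOrbit (T j) (T j') → j = j' := by
    intro j j' hj hj' he
    rcases lt_trichotomy j j' with h | h | h
    · exact (hj'.2 j h hj.1 ((horb _ _ hj.1 hj'.1).2 he)).elim
    · exact h
    · exact (hj.2 j' h hj'.1 ((horb _ _ hj'.1 hj.1).2 he.symm)).elim
  constructor
  · rintro ⟨f, hf, hinj⟩
    -- For a key `a` that occurs, the first position of its block is a bidder `i`. The fact chosen
    -- is the one witnessing the edge from `i` to `f i`.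
    have hex : ∀ a, ∃ t, (∃ s ∈ l, entry s 0 = a) → ∃ i, Bidder w i ∧ entry (T i) 0 = a ∧ t ∈ l ∧
        entry t 0 = a ∧ rot t ≠ t ∧ Object w (f i) ∧ SameOrbit (T (f i)) t := by
      intro a
      by_cases ha : ∃ s ∈ l, entry s 0 = a
      · obtain ⟨s, hs, rfl⟩ := ha
        obtain ⟨p, hp, rfl⟩ := hon' s hs
        obtain ⟨i, ⟨hi, hik⟩, hmin⟩ := exists_minimal (n := w.length)
          (Q := fun i => Start w i ∧ entry (T i) 0 = entry (T p) 0) ⟨p, hp, rfl⟩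
        have hb : Bidder w i := ⟨hi, fun i' hlt hi' hw =>
          hmin i' hlt ⟨hi', ((hword _ _ hi' hi).1 hw).trans hik⟩⟩
        obtain ⟨-, ho, k, hk, hl, hw, hso⟩ := hf i hb
        refine ⟨T k, fun _ => ⟨i, hb, hik, (hT k hk).1, ?_, fun h => hl ((hT k hk).2.loopAt_iff.2 h),
          ho, (horb _ _ ho.1 hk).1 hso⟩⟩
        rw [← (hword _ _ hi hk).1 hw, hik]
      · exact ⟨R [] [] [], fun h => (ha h).elim⟩
    choose c hc using hex
    refine ⟨c, fun s hs => ?_⟩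
    obtain ⟨i, hi, hik, h1, h2, h3, ho, h4⟩ := hc _ ⟨s, (hmem s).1 hs, rfl⟩
    refine ⟨(hmem _).2 h1, h2, h3, fun s' hs' hso => ?_⟩
    obtain ⟨i', hi', hik', -, -, -, ho', h4'⟩ := hc _ ⟨s', (hmem s').1 hs', rfl⟩
    have := hinj i i' hi hi' (hobj _ _ ho ho' ((h4.trans hso).trans h4'.symm))
    rw [← hik, ← hik', this]
  · rintro ⟨c, hc⟩
    -- A bidder is sent to the first position of the orbit of the fact chosen for his block.
    have hex : ∀ i, ∃ j, Bidder w i → Edge w i j ∧ SameOrbit (T j) (c (entry (T i) 0)) := by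
      intro i
      by_cases hi : Bidder w i
      · obtain ⟨h1, h2, h3, -⟩ := hc (T i) ((hmem _).2 (hT i hi.1).1)
        obtain ⟨k, hk, hkc⟩ := hon' _ ((hmem _).1 h1)
        obtain ⟨j, ⟨hj, hjk⟩, hmin⟩ := exists_minimal (n := w.length)
          (Q := fun j => Start w j ∧ SameOrbit (T j) (T k)) ⟨k, hk, SameOrbit.refl _⟩
        refine ⟨j, fun _ => ⟨⟨hi, ⟨hj, fun j' hlt hj' ho =>
          hmin j' hlt ⟨hj', ((horb _ _ hj' hj).1 ho).trans hjk⟩⟩, k, hk, fun hl => ?_, ?_,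
          (horb _ _ hj hk).2 hjk⟩, hkc ▸ hjk⟩⟩
        · have := (hT k hk).2.loopAt_iff.1 hl
          rw [hkc] at this
          exact h3 this
        · rw [hword _ _ hi.1 hk, hkc, h2]
      · exact ⟨i, fun h => (hi h).elim⟩
    choose f hf using hex
    refine ⟨f, fun i hi => (hf i hi).1, fun i i' hi hi' he => hbid i i' hi hi' ?_⟩
    have h1 := (hf i hi).2
    have h2 := (hf i' hi').2
    rw [← he] at h2
    exact (hc (T i) ((hmem _).2 (hT i hi.1).1)).2.2.2 _ ((hmem _).2 (hT i' hi'.1).1)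
      (h1.symm.trans h2)

/-- Positions that are no bidders can be matched only to their private partners, which no bidder can
use. So only the matching of the bidders matters. -/
theorem hasSaturatingMatching_graphOf (w : List Letter) :
    (graphOf w).HasSaturatingMatching ↔
      ∃ f : Fin w.length → Fin w.length, (∀ i, Bidder w i → Edge w i (f i)) ∧
        ∀ i i', Bidder w i → Bidder w i' → f i = f i' → i = i' := by
  classical
  have hl : ∀ i j, (graphOf w).adj i (Fin.castAdd w.length j) = true ↔ Edge w i j := fun i j => by
    rw [show (graphOf w).adj i (Fin.castAdd w.length j) = truth (Edge w i j) from
      Fin.append_left (fun j => truth (Edge w i j)) (fun j => truth (i = j ∧ ¬ Bidder w i)) j]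
    simp [truth]
  have hr : ∀ i j, (graphOf w).adj i (Fin.natAdd w.length j) = true ↔ i = j ∧ ¬ Bidder w i :=
    fun i j => by
    rw [show (graphOf w).adj i (Fin.natAdd w.length j) = truth (i = j ∧ ¬ Bidder w i) from
      Fin.append_right (fun j => truth (Edge w i j)) (fun j => truth (i = j ∧ ¬ Bidder w i)) j]
    simp [truth]
  constructor
  · rintro ⟨f, hf, hadj⟩
    have hex : ∀ i : Fin w.length, ∃ j : Fin w.length, Bidder w i →
        f i = Fin.castAdd w.length j ∧ Edge w i j := by
      intro i
      by_cases hi : Bidder w i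
      · have ha := hadj i
        obtain ⟨k, hk⟩ : ∃ k : Fin (w.length + w.length), f i = k := ⟨_, rfl⟩
        rw [hk] at ha
        revert hk ha
        refine Fin.addCases (fun j ha hk => ⟨j, fun _ => ⟨hk, (hl i j).1 ha⟩⟩)
          (fun j ha hk => (((hr i j).1 ha).2 hi).elim) k
      · exact ⟨i, fun h => (hi h).elim⟩
    choose g hg using hex
    refine ⟨g, fun i hi => (hg i hi).2, fun i i' hi hi' he => hf ?_⟩
    rw [(hg i hi).1, (hg i' hi').1, he]
  · rintro ⟨f, hf, hinj⟩
    set g : Fin w.length → Fin (w.length + w.length) := fun i =>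
      if Bidder w i then Fin.castAdd w.length (f i) else Fin.natAdd w.length i with hg
    have hginj : Injective g := by
      intro i i' he
      have hii := congrArg Fin.val he
      by_cases hi : Bidder w i <;> by_cases hi' : Bidder w i' <;>
        simp only [hg, hi, hi', if_true, if_false, Fin.val_castAdd, Fin.val_natAdd] at hii
      · exact hinj i i' hi hi' (Fin.ext hii)
      · have := (f i).2
        omega
      · have := (f i').2
        omega
      · exact Fin.ext (by omega)
    refine ⟨g, hginj, fun i => ?_⟩
    by_cases hi : Bidder w i
    · simp only [hg, if_pos hi]
      exact (hl i (f i)).2 (hf i hi)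
    · simp only [hg, if_neg hi]
      exact (hr i i).2 ⟨rfl, hi⟩

end Encoding

end CQA

/-! ### Assembly of the three claims -/

theorem mainTheorem10 :
    -- the problem is in polynomial time
    CQA.InPTime CQA.encodeDatabase (fun D => CQA.Certain CQA.q4 D.toDatabase) ∧
    -- it reduces in logarithmic space to saturating bipartite matching, with one query whose
    -- answer is negated
    (∃ G : CQA.DatabaseInput → CQA.BipartiteGraph,
      CQA.LogspaceComputable CQA.encodeDatabase CQA.encodeGraph G ∧
      ∀ D, CQA.Certain CQA.q4 D.toDatabase ↔ ¬ (G D).HasSaturatingMatching) ∧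
    -- the matchings are those of blocks to cliques of the solution graph
    (∀ (A : Type) (D : CQA.Database CQA.sigR A),
      CQA.Certain CQA.q4 D ↔ ¬ CQA.BlocksMatchCliques D) := by
  open CQA in
  refine ⟨inPTime_of_prog _ _ Fm.auctionProg 0 ?_ fun l => ?_,
    ⟨fun l => graphOf (encodeDatabase l),
    logspaceComputable_of_prog _ _ _ graphProg noTape_graphProg fun l => run_graphProg _, fun l => ?_⟩,
    fun A D => ?_⟩
  · simp [Fm.auctionProg, Fm.prog, Prog.bound, Act.bound]
  · rw [Fm.run_auctionProg, certain_iff, exists_matching_iff]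
  · rw [certain_iff, hasSaturatingMatching_graphOf, exists_matching_iff]
  · rw [certain_iff, blocksMatchCliques_iff]
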